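/- All graphs are finite, simple and undirected. A matching of a graph $G$ is a set of pairwise disjoint edges of $G$; a maximal matching is a matching that is not properly contained in another matching. Let $\gamma(G)$ denote the minimum size (number of edges) of a maximal matching of $G$. A graph is subcubic if every vertex has degree at most $3$, and cubic if every vertex has degree exactly $3$. Let $G$ be a connected subcubic graph that is not isomorphic to the complete bipartite graph $K_{3,3}$, with $n$ vertices, $m$ edges and $n_1$ vertices of degree $1$. Let $I=1$ if $G$ is cubic and $I=0$ otherwise, and let $K=1$ if $G$ is isomorphic to the complete graph $K_2$ and $K=0$ otherwise. Put $$\mu(G):=\frac{4n-m}{6}+\frac{2I+K-n_1}{6}.$$ Then $$\gamma(G)\le \mu(G).$$ Moreover, if $G$ is not isomorphic to $K_2$, then for every vertex $v$ of degree $1$, with neighbour $u$, the graph $G$ has a maximal matching of size at most $\mu(G)$ that does not contain the edge $uv$. -/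

import Mathlib

namespace MinMaxMatching

variable {V : Type*}

/-- `M` is a maximal matching of `G`: a matching that is contained in no larger matching. A matching
in the sense of `SimpleGraph.Subgraph.IsMatching` is a subgraph in which each vertex has exactly one
neighbour, so it is the same thing as its set of edges, a set of pairwise disjoint edges. -/
def IsMaximalMatching {G : SimpleGraph V} (M : G.Subgraph) : Prop :=
  Maximal (fun N : G.Subgraph => N.IsMatching) M

/-- The number of edges of a matching. -/
noncomputable def size {G : SimpleGraph V} (M : G.Subgraph) : ℕ := M.edgeSet.ncard

/-- `γ(G)`, the minimum size of a maximal matching of `G`. -/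
noncomputable def gamma (G : SimpleGraph V) : ℕ :=
  sInf {k | ∃ M : G.Subgraph, IsMaximalMatching M ∧ size M = k}

/-- In a finite graph the infimum defining `γ(G)` is attained. -/
theorem exists_size_eq_gamma [Finite V] (G : SimpleGraph V) :
    ∃ M : G.Subgraph, IsMaximalMatching M ∧ size M = gamma G := by
  have hfin : Finite G.Subgraph := by
    refine Finite.of_injective
      (fun M : G.Subgraph => (M.verts, fun a b => M.Adj a b)) ?_
    intro M N h
    have h1 := congrArg Prod.fst h
    have h2 := congrArg Prod.snd h
    exact SimpleGraph.Subgraph.ext h1 h2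
  have hne : ({M | M.IsMatching} : Set G.Subgraph).Nonempty := ⟨⊥, fun v hv => by simp at hv⟩
  obtain ⟨M, hM⟩ := (Set.toFinite ({M | M.IsMatching} : Set G.Subgraph)).exists_maximal hne
  exact Nat.sInf_mem (s := {k | ∃ M : G.Subgraph, IsMaximalMatching M ∧ size M = k})
    ⟨size M, M, hM, rfl⟩

/-- Every vertex has degree at most three. -/
def IsSubcubic [Fintype V] (G : SimpleGraph V) [DecidableRel G.Adj] : Prop :=
  ∀ v, G.degree v ≤ 3

/-- `G` is isomorphic to the complete graph on two vertices. -/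
def IsK2 (G : SimpleGraph V) : Prop :=
  Nonempty (G ≃g (⊤ : SimpleGraph (Fin 2)))

/-- `G` is isomorphic to the complete bipartite graph with parts of size three. -/
def IsK33 (G : SimpleGraph V) : Prop :=
  Nonempty (G ≃g completeBipartiteGraph (Fin 3) (Fin 3))

open Classical in
/-- The number `(4n - m)/6 + (2I + K - n₁)/6`, where `n`, `m` and `n₁` count the vertices, edges and
degree-1 vertices of `G`, and `I`, `K` indicate that `G` is cubic and that `G` is isomorphic to the
complete graph on two vertices. -/
noncomputable def bound [Fintype V] (G : SimpleGraph V) [DecidableRel G.Adj] : ℚ :=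
  let n : ℚ := Fintype.card V
  let m : ℚ := G.edgeFinset.card
  let n₁ : ℚ := (Finset.univ.filter fun v => G.degree v = 1).card
  let I : ℚ := if G.IsRegularOfDegree 3 then 1 else 0
  let K : ℚ := if IsK2 G then 1 else 0
  (4 * n - m) / 6 + (2 * I + K - n₁) / 6

end MinMaxMatching

/-! A maximal matching is determined up to its pairing by the set `U` of vertices it misses: `U` is
independent and the rest is perfectly matched (`Adm`). Its size is `(n - |U|)/2`, and degree
counting gives `2m + n₁ ≤ 2n + n₃`, with `n₃` the number of cubic vertices. So it suffices to find
`U` with `n₁ + n₃ ≤ 6|U| + 4I + 2K` (`size_le_bound`).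

The core is `good_of_ok`: a subcubic graph without cubic components has such a `U` with `weight G ≤
6|U|`. Removing vertices means isolating them on the same vertex type, so induction runs on the
number of non-isolated vertices. An isolated vertex is always missed and weighs 6, a cubic vertex
weighs 1, and a leaf contributes 1 to its neighbour if that has degree at least 2.

If there is a leaf `v` at `u`, match `u` to another neighbour and leave `v` missed; the weight rises
by the required 12 (`weight_del_leaf_le`). As `v` is missed, this also proves the second claim. If
there are no leaves, the weight is even by the handshake lemma. Take `v` of degree 2 with neighbours
`u`, `w`, where `u` is cubic, leave `v` missed and match `u` and `w` to outside partners. This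
isolates five vertices and gains one missed vertex, so, parity included, seven cubic vertices may
stop being cubic (`good_of_lift`).

Plain deletion can lose too many. The remedy is the reduction `red`: once `v` is gone, `u` has
neighbours `q` and `p`; remove `u`, `p` and join `q` to a neighbour `c` of `p`. Then `q` and `c`
keep their degrees and only `p` and its third neighbour can be lost. A matching using `qc` lifts by
exchanging `qc` for `uq` and `pc`; otherwise `up` is added (`adm_of_red`). Doing this at `u` and at
`w` stays within seven (`good_of_two_steps`).

Three obstacles remain. The new edge would be a loop or a double edge for every choice of `c`
(`Blocked`): then `q` and `p` lie in a diamond or are twins, handled by `good_of_diamond` and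
`good_of_gadget`. The first new edge blocks the second reduction: explicit pairings work
(`good_of_red_blocked`). The new edge creates a cubic component: then a bridge has a wholly cubic
side `Y`, and splitting there wins by rounding, with the way of splitting chosen by `|Y|` modulo 12
(`IsBridgeSide.good`).

A connected cubic graph has a slack of 4. One deletion at a triangle, or one reduction at an edge,
leads to graphs covered by `good_of_ok`; if no reduction is available the graph is `K₃,₃`
(`exists_adm_of_cubic`). -/

namespace MinMaxMatching

set_option linter.unusedSectionVars false

/-! ### Degrees, isolating vertices, and sets missed by maximal matchings -/

section Basics

variable {V : Type*} [Fintype V] [DecidableEq V] {G H : SimpleGraph V}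

/-- The degree of a vertex, free of decidability assumptions. -/
noncomputable def deg (G : SimpleGraph V) (v : V) : ℕ := (G.neighborSet v).ncard

/-- Every vertex has at most three neighbours. -/
def Subcub (G : SimpleGraph V) : Prop := ∀ v, deg G v ≤ 3

/-- The graph obtained by deleting all edges with an end in `S`. -/
def del (G : SimpleGraph V) (S : Finset V) : SimpleGraph V where
  Adj a b := G.Adj a b ∧ a ∉ S ∧ b ∉ S
  symm := ⟨fun _ _ h => ⟨h.1.symm, h.2.2, h.2.1⟩⟩
  loopless := ⟨fun _ h => G.irrefl h.1⟩

@[simp] theorem del_adj (G : SimpleGraph V) (S : Finset V) (a b : V) :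
    (del G S).Adj a b ↔ G.Adj a b ∧ a ∉ S ∧ b ∉ S := Iff.rfl

/-- Delete all edges at `S`, then join `q` and `c`. -/
def red (G : SimpleGraph V) (S : Finset V) (q c : V) : SimpleGraph V :=
  del G S ⊔ SimpleGraph.edge q c

theorem red_adj (G : SimpleGraph V) (S : Finset V) {q c : V} (hqc : q ≠ c) (a b : V) :
    (red G S q c).Adj a b ↔
      (G.Adj a b ∧ a ∉ S ∧ b ∉ S) ∨ (a = q ∧ b = c) ∨ (a = c ∧ b = q) := by
  simp only [red, SimpleGraph.sup_adj, del_adj, SimpleGraph.edge_adj]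
  grind

/-- The complement of `U` is perfectly matched in `G`, and `U` is independent. -/
def Adm (G : SimpleGraph V) (U : Finset V) : Prop :=
  (∀ a ∈ U, ∀ b ∈ U, ¬ G.Adj a b) ∧
    ∃ f : V → V, ∀ v, v ∉ U → G.Adj v (f v) ∧ f v ∉ U ∧ f (f v) = v

theorem deg_eq_degree (G : SimpleGraph V) [DecidableRel G.Adj] (v : V) : deg G v = G.degree v := by
  rw [deg, Set.ncard_eq_toFinset_card', ← SimpleGraph.card_neighborFinset_eq_degree]
  congr

theorem deg_eq_zero {v : V} : deg G v = 0 ↔ ∀ x, ¬ G.Adj v x := by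
  rw [deg, Set.ncard_eq_zero]
  simp [Set.eq_empty_iff_forall_notMem]

theorem deg_ne_zero_of_adj {v x : V} (h : G.Adj v x) : deg G v ≠ 0 := fun h0 =>
  deg_eq_zero.1 h0 x h

theorem deg_le_deg {v : V} (h : ∀ x, H.Adj v x → G.Adj v x) : deg H v ≤ deg G v :=
  Set.ncard_le_ncard h

theorem deg_eq_deg {v : V} (h : ∀ x, H.Adj v x ↔ G.Adj v x) : deg H v = deg G v := by
  unfold deg
  congr 1
  ext x
  exact h x

theorem deg_lt_deg {v y : V} (h : ∀ x, H.Adj v x → G.Adj v x) (hy : G.Adj v y)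
    (hy' : ¬ H.Adj v y) : deg H v < deg G v :=
  Set.ncard_lt_ncard ⟨h, fun hh => hy' (hh hy)⟩

theorem deg_eq_one {v : V} : deg G v = 1 ↔ ∃ a, ∀ x, G.Adj v x ↔ x = a := by
  rw [deg, Set.ncard_eq_one]
  simp [Set.ext_iff]

theorem deg_eq_two {v : V} :
    deg G v = 2 ↔ ∃ a b, a ≠ b ∧ ∀ x, G.Adj v x ↔ x = a ∨ x = b := by
  rw [deg, Set.ncard_eq_two]
  simp [Set.ext_iff]

theorem deg_eq_three {v : V} : deg G v = 3 ↔
    ∃ a b c, a ≠ b ∧ a ≠ c ∧ b ≠ c ∧ ∀ x, G.Adj v x ↔ x = a ∨ x = b ∨ x = c := by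
  rw [deg, Set.ncard_eq_three]
  simp [Set.ext_iff]

theorem exists_of_deg_three {v a : V} (h : deg G v = 3) (ha : G.Adj v a) :
    ∃ b c, a ≠ b ∧ a ≠ c ∧ b ≠ c ∧ ∀ x, G.Adj v x ↔ x = a ∨ x = b ∨ x = c := by
  obtain ⟨x, y, z, h1, h2, h3, h4⟩ := deg_eq_three.1 h
  rcases (h4 a).1 ha with rfl | rfl | rfl
  · exact ⟨y, z, h1, h2, h3, h4⟩
  · exact ⟨x, z, h1.symm, h3, h2, fun w => by rw [h4]; tauto⟩
  · exact ⟨x, y, h2.symm, h3.symm, h1, fun w => by rw [h4]; tauto⟩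

theorem exists_of_deg_three₂ {v a b : V} (h : deg G v = 3) (ha : G.Adj v a) (hb : G.Adj v b)
    (hab : a ≠ b) : ∃ c, a ≠ c ∧ b ≠ c ∧ ∀ x, G.Adj v x ↔ x = a ∨ x = b ∨ x = c := by
  obtain ⟨x, y, h1, h2, h3, h4⟩ := exists_of_deg_three h ha
  rcases (h4 b).1 hb with rfl | rfl | rfl
  · exact absurd rfl hab
  · exact ⟨y, h2, h3, h4⟩
  · exact ⟨x, h1, h3.symm, fun w => by rw [h4]; tauto⟩

theorem exists_of_deg_two {v a : V} (h : deg G v = 2) (ha : G.Adj v a) :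
    ∃ b, a ≠ b ∧ ∀ x, G.Adj v x ↔ x = a ∨ x = b := by
  obtain ⟨x, y, h1, h4⟩ := deg_eq_two.1 h
  rcases (h4 a).1 ha with rfl | rfl
  · exact ⟨y, h1, h4⟩
  · exact ⟨x, h1.symm, fun w => by rw [h4]; tauto⟩

theorem deg_del_le (G : SimpleGraph V) (S : Finset V) (v : V) : deg (del G S) v ≤ deg G v :=
  deg_le_deg fun _ h => h.1

theorem deg_del_eq_zero {S : Finset V} {v : V} (h : v ∈ S) : deg (del G S) v = 0 :=
  deg_eq_zero.2 fun _ hx => hx.2.1 h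

theorem deg_del_eq {S : Finset V} {v : V} (h : v ∉ S) (h' : ∀ s ∈ S, ¬ G.Adj v s) :
    deg (del G S) v = deg G v :=
  deg_eq_deg fun x => ⟨fun hx => hx.1, fun hx => ⟨hx, h, fun hs => h' x hs hx⟩⟩

theorem deg_del_lt {S : Finset V} {v s : V} (hs : s ∈ S) (h : G.Adj v s) :
    deg (del G S) v < deg G v :=
  deg_lt_deg (fun _ h => h.1) h fun h' => h'.2.2 hs

theorem subcub_of_le (hG : Subcub G) (h : ∀ v, deg H v ≤ deg G v) : Subcub H := fun v =>
  (h v).trans (hG v)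

theorem subcub_del (hG : Subcub G) (S : Finset V) : Subcub (del G S) :=
  subcub_of_le hG (deg_del_le G S)

theorem del_del (G : SimpleGraph V) (S T : Finset V) : del (del G S) T = del G (S ∪ T) := by
  ext a b
  simp only [del_adj, Finset.mem_union]
  tauto

theorem mem_of_adm {U : Finset V} {v : V} (hU : Adm G U) (h : deg G v = 0) : v ∈ U := by
  obtain ⟨f, hf⟩ := hU.2
  by_contra hv
  exact deg_eq_zero.1 h _ (hf v hv).1

/-- Isolated vertices cannot be matched, so `u` and `x` are free to be paired with each other. -/
theorem adm_of_pair {U : Finset V} {u x : V} (hux : G.Adj u x) (hU : Adm (del G {u, x}) U) :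
    u ∈ U ∧ x ∈ U ∧ Adm G (U \ {u, x}) := by
  have hu : u ∈ U := mem_of_adm hU (deg_del_eq_zero (by simp))
  have hx : x ∈ U := mem_of_adm hU (deg_del_eq_zero (by simp))
  have hne := hux.ne
  have hxu := hux.symm
  obtain ⟨hi, f, hf⟩ := hU
  refine ⟨hu, hx, ?_, fun y => if y = u then x else if y = x then u else f y, ?_⟩
  · intro a ha b hb hab
    simp only [Finset.mem_sdiff, Finset.mem_insert, Finset.mem_singleton, not_or] at ha hb
    exact hi a ha.1 b hb.1 ⟨hab, by simp [ha.2], by simp [hb.2]⟩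
  · intro y hy
    simp only [Finset.mem_sdiff, Finset.mem_insert, Finset.mem_singleton, del_adj] at hy hf ⊢
    grind

theorem card_of_pair {U : Finset V} {u x : V} (hux : u ≠ x) (hu : u ∈ U) (hx : x ∈ U) :
    (U \ {u, x}).card + 2 = U.card := by
  have h1 : ({u, x} : Finset V) ⊆ U := by
    intro y hy
    simp only [Finset.mem_insert, Finset.mem_singleton] at hy
    rcases hy with rfl | rfl <;> assumption
  have h2 := Finset.card_sdiff_add_card_eq_card h1
  rw [Finset.card_pair hux] at h2
  exact h2

/-- If the pairing uses the artificial edge `qc`, replace it by `uq` and `pc`; otherwise add `up`.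
Either way exactly `u` and `p` leave the missed set. -/
theorem adm_of_red {U : Finset V} {u p q c : V} (hup : G.Adj u p) (huq : G.Adj u q)
    (hpc : G.Adj p c) (hqp : q ≠ p) (hcu : c ≠ u) (hqc : q ≠ c)
    (hU : Adm (red G {u, p} q c) U) : u ∈ U ∧ p ∈ U ∧ Adm G (U \ {u, p}) := by
  have hne := hup.ne
  have huq' := huq.ne
  have hpc' := hpc.ne
  have h1 := hup.symm
  have h2 := huq.symm
  have h3 := hpc.symm
  have hu : u ∈ U := mem_of_adm hU (deg_eq_zero.2 fun y => by
    rw [red_adj _ _ hqc]; simp; grind)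
  have hp : p ∈ U := mem_of_adm hU (deg_eq_zero.2 fun y => by
    rw [red_adj _ _ hqc]; simp; grind)
  obtain ⟨hi, f, hf⟩ := hU
  refine ⟨hu, hp, ?_, ?_⟩
  · intro a ha b hb hab
    simp only [Finset.mem_sdiff, Finset.mem_insert, Finset.mem_singleton, not_or] at ha hb
    exact hi a ha.1 b hb.1 ((red_adj _ _ hqc _ _).2 (Or.inl ⟨hab, by simp [ha.2], by simp [hb.2]⟩))
  simp only [red_adj _ _ hqc, Finset.mem_insert, Finset.mem_singleton] at hf
  by_cases hq : q ∉ U ∧ f q = c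
  · refine ⟨fun y => if y = u then q else if y = q then u else if y = p then c else
      if y = c then p else f y, fun y hy => ?_⟩
    simp only [Finset.mem_sdiff, Finset.mem_insert, Finset.mem_singleton] at hy ⊢
    grind
  · refine ⟨fun y => if y = u then p else if y = p then u else f y, fun y hy => ?_⟩
    simp only [Finset.mem_sdiff, Finset.mem_insert, Finset.mem_singleton] at hy ⊢
    grind

/-- Restoring the edges at a missed vertex spoils independence only if one of its neighbours is
missed too. -/
theorem adm_of_iso {U : Finset V} {v : V} (hU : Adm (del G {v}) U)
    (h : ∀ x, G.Adj v x → x ∉ U) : Adm G U := by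
  obtain ⟨hi, f, hf⟩ := hU
  refine ⟨fun a ha b hb hab => ?_, f, fun y hy => ?_⟩
  · refine hi a ha b hb ⟨hab, ?_, ?_⟩
    · rw [Finset.mem_singleton]
      rintro rfl
      exact h b hab hb
    · rw [Finset.mem_singleton]
      rintro rfl
      exact h a hab.symm ha
  · exact ⟨(hf y hy).1.1, (hf y hy).2⟩

/-- The number of vertices that are not isolated. -/
noncomputable def mu (G : SimpleGraph V) : ℕ := (Finset.univ.filter fun v => deg G v ≠ 0).card

theorem mu_lt {v : V} (h : ∀ x, deg H x ≤ deg G x) (hv : deg G v ≠ 0) (hv' : deg H v = 0) :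
    mu H < mu G := by
  refine Finset.card_lt_card ⟨fun x hx => ?_, fun hh => ?_⟩
  · have := h x
    simp only [Finset.mem_filter, Finset.mem_univ, true_and] at hx ⊢
    omega
  · have := @hh v (by simp [hv])
    simp [hv'] at this

theorem mu_del_lt {S : Finset V} {v : V} (h : v ∈ S) (hv : deg G v ≠ 0) :
    mu (del G S) < mu G :=
  mu_lt (deg_del_le G S) hv (deg_del_eq_zero h)

theorem exists_adm (G : SimpleGraph V) : ∃ U, Adm G U := by
  induction hk : mu G using Nat.strong_induction_on generalizing G with
  | _ k ih =>
    by_cases h : ∃ u x, G.Adj u x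
    · obtain ⟨u, x, hux⟩ := h
      obtain ⟨U, hU⟩ := ih (mu (del G {u, x})) (hk ▸ mu_del_lt (v := u) (by simp)
        (deg_ne_zero_of_adj hux)) _ rfl
      exact ⟨_, (adm_of_pair hux hU).2.2⟩
    · push Not at h
      exact ⟨Finset.univ, fun a _ b _ => h a b, id, fun v hv => absurd (Finset.mem_univ v) hv⟩

/-- The matching formed by the pairs of an admissible set. -/
theorem exists_matching_of_adm {U : Finset V} (hU : Adm G U) :
    ∃ M : G.Subgraph, IsMaximalMatching M ∧ 2 * size M + U.card = Fintype.card V ∧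
      M.verts = {v | v ∉ U} := by
  obtain ⟨hi, f, hf⟩ := hU
  let M : G.Subgraph :=
    { verts := {v | v ∉ U}
      Adj := fun a b => a ∉ U ∧ f a = b
      adj_sub := by
        rintro a b ⟨ha, rfl⟩
        exact (hf a ha).1
      edge_vert := fun h => h.1
      symm := ⟨by
        rintro a b ⟨ha, rfl⟩
        exact ⟨(hf a ha).2.1, (hf a ha).2.2⟩⟩ }
  have hM : M.IsMatching := fun v hv => ⟨f v, ⟨hv, rfl⟩, fun y hy => hy.2.symm⟩
  refine ⟨M, ⟨hM, fun N hN hMN => ?_⟩, ?_, rfl⟩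
  · have hN' : N.IsMatching := hN
    have hadj : ∀ a b, N.Adj a b → M.Adj a b := by
      intro a b hab
      by_cases ha : a ∈ U
      · by_cases hb : b ∈ U
        · exact absurd (N.adj_sub hab) (hi a ha b hb)
        · have h1 : N.Adj b (f b) := hMN.2 ⟨hb, rfl⟩
          have h2 := hN'.eq_of_adj_left h1 hab.symm
          exact absurd ha (h2 ▸ (hf b hb).2.1)
      · have h1 : N.Adj a (f a) := hMN.2 ⟨ha, rfl⟩
        exact ⟨ha, hN'.eq_of_adj_left h1 hab⟩
    refine ⟨fun v hv => ?_, fun a b h => hadj a b h⟩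
    obtain ⟨w, hw, -⟩ := hN' hv
    exact M.edge_vert (hadj v w hw)
  · classical
    have h1 := M.spanningCoe.sum_degrees_eq_twice_card_edges
    have h2 : ∀ v, M.spanningCoe.degree v = if v ∈ U then 0 else 1 := by
      intro v
      rw [← deg_eq_degree]
      split_ifs with hv
      · exact deg_eq_zero.2 fun x hx => hx.1 hv
      · exact deg_eq_one.2 ⟨f v, fun x => ⟨fun hx => hx.2.symm, fun hx => ⟨hv, hx.symm⟩⟩⟩
    have h3 : M.spanningCoe.edgeFinset.card = size M := by
      rw [size, Set.ncard_eq_toFinset_card', SimpleGraph.edgeFinset]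
      congr 1
      simp
    rw [h3, Finset.sum_congr rfl fun v _ => h2 v] at h1
    rw [← h1, Finset.sum_ite, Finset.sum_const_zero, zero_add, Finset.sum_const, smul_eq_mul,
      mul_one, add_comm]
    rw [← Finset.card_univ,
      ← Finset.card_filter_add_card_filter_not (s := Finset.univ) (fun x => x ∈ U)]
    simp

theorem even_of_adm {U : Finset V} (hU : Adm G U) : ∃ k, 2 * k + U.card = Fintype.card V := by
  obtain ⟨M, -, h, -⟩ := exists_matching_of_adm hU
  exact ⟨_, h⟩

end Basics

/-! ### Weights, survival of low-degree vertices, and the accounting step -/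

section Weights

variable {V : Type*} [Fintype V] [DecidableEq V] {G H : SimpleGraph V}

/-- The number of neighbours of `v` of degree one. -/
noncomputable def leafNbrs (G : SimpleGraph V) (v : V) : ℕ := {x | G.Adj v x ∧ deg G x = 1}.ncard

/-- The weight of a vertex without the contribution of leaves. -/
noncomputable def base (G : SimpleGraph V) (v : V) : ℕ :=
  if deg G v = 0 then 6 else if deg G v = 3 then 1 else 0

/-- The weight of a vertex. -/
noncomputable def val (G : SimpleGraph V) (v : V) : ℕ :=
  base G v + if 2 ≤ deg G v then leafNbrs G v else 0

/-- The total weight, a lower bound for `6 * U.card` for a suitable admissible `U`. -/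
noncomputable def weight (G : SimpleGraph V) : ℕ := ∑ v, val G v

/-- The total weight without the contribution of leaves. -/
noncomputable def baseWeight (G : SimpleGraph V) : ℕ := ∑ v, base G v

theorem baseWeight_le_weight (G : SimpleGraph V) : baseWeight G ≤ weight G :=
  Finset.sum_le_sum fun _ _ => Nat.le_add_right _ _

theorem leafNbrs_pos {v x : V} (h : G.Adj v x) (hx : deg G x = 1) : 1 ≤ leafNbrs G v :=
  (Set.ncard_pos (Set.toFinite _)).2 ⟨x, h, hx⟩

theorem baseWeight_lt_weight {v x : V} (h : G.Adj v x) (hx : deg G x = 1) (hv : 2 ≤ deg G v) :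
    baseWeight G + 1 ≤ weight G := by
  refine Finset.sum_lt_sum (fun _ _ => Nat.le_add_right _ _) ⟨v, Finset.mem_univ v, ?_⟩
  have := leafNbrs_pos h hx
  simp only [if_pos hv]
  omega

theorem weight_eq_baseWeight (h : ∀ v, deg G v ≠ 1) : weight G = baseWeight G := by
  refine Finset.sum_congr rfl fun v _ => ?_
  have : leafNbrs G v = 0 := by
    rw [leafNbrs, Set.ncard_eq_zero]
    ext x
    simp [h x]
  simp [val, this]

/-- `G` has an admissible set at least as large as its weight demands. -/
def Good (G : SimpleGraph V) : Prop := ∃ U, Adm G U ∧ weight G ≤ 6 * U.card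

/-- Every vertex reaches a vertex outside `E` of degree at most two. -/
def OkAvoid (E : Finset V) (G : SimpleGraph V) : Prop :=
  ∀ v, ∃ y, G.Reachable v y ∧ deg G y ≤ 2 ∧ y ∉ E

/-- Every vertex reaches a vertex of degree at most two. -/
def Ok (G : SimpleGraph V) : Prop := ∀ v, ∃ y, G.Reachable v y ∧ deg G y ≤ 2

theorem okAvoid_empty : OkAvoid ∅ G ↔ Ok G := by
  simp [OkAvoid, Ok]

theorem OkAvoid.ok {E : Finset V} (h : OkAvoid E G) : Ok G := fun v => by
  obtain ⟨y, h1, h2, -⟩ := h v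
  exact ⟨y, h1, h2⟩

/-- Follow a walk of `G` to a witness: it survives in `H` until it first meets `S`, so new witnesses
are needed only for the vertices next to `S`. -/
theorem okAvoid_of_boundary {E S : Finset V} (hES : ∀ s ∈ S, s ∉ E)
    (hG : ∀ v, ∃ y, G.Reachable v y ∧ (deg G y ≤ 2 ∧ y ∉ E ∨ y ∈ S))
    (hadj : ∀ a b, a ∉ S → b ∉ S → G.Adj a b → H.Adj a b)
    (hdeg : ∀ v, deg H v ≤ deg G v) (hS : ∀ s ∈ S, deg H s ≤ 2)
    (hb : ∀ y, y ∉ S → (∃ s ∈ S, G.Adj y s) → ∃ z, H.Reachable y z ∧ deg H z ≤ 2 ∧ z ∉ E) :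
    OkAvoid E H := by
  intro v
  obtain ⟨y, ⟨p⟩, hy⟩ := hG v
  induction p with
  | nil =>
    rename_i v
    by_cases hv : v ∈ S
    · exact ⟨v, .refl _, hS v hv, hES v hv⟩
    · rcases hy with hy | hy
      · exact ⟨v, .refl _, (hdeg v).trans hy.1, hy.2⟩
      · exact absurd hy hv
  | cons hab p ih =>
    rename_i a b c
    by_cases ha : a ∈ S
    · exact ⟨a, .refl _, hS a ha, hES a ha⟩
    by_cases hbS : b ∈ S
    · exact hb a ha ⟨b, hbS, hab⟩
    · obtain ⟨z, h1, h2⟩ := ih hy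
      exact ⟨z, (hadj a b ha hbS hab).reachable.trans h1, h2⟩

/-- A surviving neighbour of a removed vertex has lost an edge, hence has degree at most 2. -/
theorem ok_del_of_reach (hG : Subcub G) {S : Finset V}
    (h : ∀ v, ∃ y, G.Reachable v y ∧ (deg G y ≤ 2 ∨ y ∈ S)) : Ok (del G S) := by
  rw [← okAvoid_empty]
  refine okAvoid_of_boundary (G := G) (S := S) (by simp) (by simpa using h)
    (fun a b ha hb hab => ⟨hab, ha, hb⟩) (deg_del_le G S)
    (fun s hs => by rw [deg_del_eq_zero hs]; omega) ?_
  rintro y - ⟨s, hs, hys⟩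
  have h1 := deg_del_lt hs hys
  have h2 := hG y
  exact ⟨y, .refl _, by omega, by simp⟩

theorem ok_del (hG : Subcub G) (h : Ok G) (S : Finset V) : Ok (del G S) :=
  ok_del_of_reach hG fun v => by
    obtain ⟨y, h1, h2⟩ := h v
    exact ⟨y, h1, Or.inl h2⟩

/-- Without leaves the odd-degree vertices are exactly the cubic ones, and their number is even by
the handshake lemma. -/
theorem even_baseWeight (hG : Subcub G) (h : ∀ v, deg G v ≠ 1) : Even (baseWeight G) := by
  classical
  have h1 := G.even_card_odd_degree_vertices
  have h2 : baseWeight G = 6 * (Finset.univ.filter fun v => deg G v = 0).card +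
      (Finset.univ.filter fun v => Odd (G.degree v)).card := by
    rw [Finset.card_filter, Finset.card_filter, Finset.mul_sum, ← Finset.sum_add_distrib]
    refine Finset.sum_congr rfl fun v _ => ?_
    rw [← deg_eq_degree, base]
    have ha := h v
    have hb := hG v
    generalize deg G v = d at *
    interval_cases d <;> simp at ha ⊢ <;> decide
  rw [h2]
  exact (Even.mul_right (by decide) _).add h1

theorem sum_ite_mem (S : Finset V) (k : ℕ) : (∑ v, if v ∈ S then k else 0) = k * S.card := by
  rw [← Finset.sum_filter]
  simp [mul_comm]

theorem baseWeight_add_le {S T : Finset V} (hdeg : ∀ v, deg H v ≤ deg G v)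
    (hS : ∀ s ∈ S, deg G s ≠ 0) (hS' : ∀ s ∈ S, deg H s = 0)
    (hT : ∀ v, deg G v = 3 → deg H v ≠ 3 → v ∈ T) :
    baseWeight G + 6 * S.card ≤ baseWeight H + T.card := by
  rw [← sum_ite_mem, ← one_mul T.card, ← sum_ite_mem, baseWeight, baseWeight,
    ← Finset.sum_add_distrib, ← Finset.sum_add_distrib]
  refine Finset.sum_le_sum fun v _ => ?_
  have h1 := hdeg v
  have h2 := hS v
  have h3 := hS' v
  have h4 := hT v
  unfold base
  grind

/-- The general accounting step: an admissible set of a reduced graph that has two more vertices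
for every three new isolated vertices, or four more for every five. -/
theorem good_of_lift {S T U U' : Finset V} (hG : Subcub G) (hl : ∀ v, deg G v ≠ 1)
    (hdeg : ∀ v, deg H v ≤ deg G v)
    (hS : ∀ s ∈ S, deg G s ≠ 0) (hS' : ∀ s ∈ S, deg H s = 0)
    (hT : ∀ v, deg G v = 3 → deg H v ≠ 3 → v ∈ T)
    (hU' : baseWeight H + T.card ≤ 6 * U'.card + 7) (hU : Adm G U)
    (hc : U.card + S.card = U'.card + 1) : Good G := by
  refine ⟨U, hU, ?_⟩
  -- One extra missed vertex pays 6; the seventh unit of the budget is free because `baseWeight G ≤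
  -- 6 * U.card + 1` and `baseWeight G` is even.
  have h1 := baseWeight_add_le hdeg hS hS' hT
  obtain ⟨k, hk⟩ := even_baseWeight hG hl
  rw [weight_eq_baseWeight hl]
  omega

/-- Hypothesis of the induction: smaller graphs are good. -/
def Below (G : SimpleGraph V) : Prop :=
  ∀ H : SimpleGraph V, mu H < mu G → Subcub H → Ok H → Good H

theorem Below.mono (h : Below G) (hH : mu H ≤ mu G) : Below H := fun K hK =>
  h K (hK.trans_le hH)

/-- The vertices `v, u, w` are removed, `u` and `w` being matched. -/
theorem good_of_pm3 {v u w : V} {T : Finset V} (hG : Subcub G) (hl : ∀ v, deg G v ≠ 1)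
    (ih : Below G) (hok : Ok (del G {v, u, w})) (hv : deg G v ≠ 0)
    (huw : G.Adj u w) (hvu : v ≠ u) (hvw : v ≠ w)
    (hN : ∀ x, G.Adj v x → x = u ∨ x = w)
    (hT : ∀ x, deg G x = 3 → (x ∈ ({v, u, w} : Finset V) ∨ G.Adj v x ∨ G.Adj u x ∨ G.Adj w x) →
      x ∈ T) (hTc : T.card ≤ 7) : Good G := by
  obtain ⟨U', hU', hc⟩ := ih _ (mu_del_lt (v := v) (by simp) hv) (subcub_del hG _) hok
  have e : del G {v, u, w} = del (del G {v}) {u, w} := by rw [del_del]; rfl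
  have hadj : (del G {v}).Adj u w := ⟨huw, by simpa using hvu.symm, by simpa using hvw.symm⟩
  obtain ⟨h1, h2, h3⟩ := adm_of_pair hadj (e ▸ hU')
  have h4 := card_of_pair huw.ne h1 h2
  have h5 := baseWeight_le_weight (del G {v, u, w})
  refine good_of_lift (S := {v, u, w}) (T := T) (U := U' \ {u, w}) (U' := U') hG hl
    (deg_del_le G _) ?_ (fun s hs => deg_del_eq_zero hs) ?_ (by omega) (adm_of_iso h3 ?_) ?_
  · intro s hs
    simp only [Finset.mem_insert, Finset.mem_singleton] at hs
    rcases hs with rfl | rfl | rfl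
    · exact hv
    · exact deg_ne_zero_of_adj huw
    · exact deg_ne_zero_of_adj huw.symm
  · intro x hx hx'
    refine hT x hx ?_
    by_contra hcon
    push Not at hcon
    refine hx' (hx ▸ deg_del_eq hcon.1 fun s hs hxs => ?_)
    simp only [Finset.mem_insert, Finset.mem_singleton] at hs
    rcases hs with rfl | rfl | rfl
    exacts [hcon.2.1 hxs.symm, hcon.2.2.1 hxs.symm, hcon.2.2.2 hxs.symm]
  · intro x hx
    have := hN x hx
    simp
    tauto
  · have : ({v, u, w} : Finset V).card = 3 := Finset.card_eq_three.2 ⟨_, _, _, hvu, hvw, huw.ne, rfl⟩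
    omega

/-- The vertices `v, u, p, w, s` are removed, `u, p` and `w, s` being matched. The weight bound
is needed only if eight vertices stop being cubic. -/
theorem good_of_pm5' {v u p w s : V} {T : Finset V} (hG : Subcub G) (hl : ∀ v, deg G v ≠ 1)
    (ih : Below G) (hok : Ok (del G {v, u, p, w, s})) (hv : deg G v ≠ 0)
    (hup : G.Adj u p) (hws : G.Adj w s) (hd : [v, u, p, w, s].Nodup)
    (hN : ∀ x, G.Adj v x → x ∈ [u, p, w, s])
    (hT : ∀ x, deg G x = 3 → (x ∈ [v, u, p, w, s] ∨
      G.Adj v x ∨ G.Adj u x ∨ G.Adj p x ∨ G.Adj w x ∨ G.Adj s x) → x ∈ T)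
    (hTc : baseWeight (del G {v, u, p, w, s}) + T.card ≤
      weight (del G {v, u, p, w, s}) + 7) : Good G := by
  obtain ⟨U', hU', hc⟩ := ih _ (mu_del_lt (v := v) (by simp) hv) (subcub_del hG _) hok
  have e : del G {v, u, p, w, s} = del (del (del G {v}) {u, p}) {w, s} := by
    rw [del_del, del_del]
    congr 1
    ext
    simp only [Finset.mem_insert, Finset.mem_singleton, Finset.mem_union]
    tauto
  simp only [List.nodup_cons, List.mem_cons, List.not_mem_nil, or_false, not_or,
    List.nodup_nil, and_true, not_false_eq_true] at hd hN
  obtain ⟨⟨d1, d2, d3, d4⟩, ⟨d5, d6, d7⟩, ⟨d8, d9⟩, d10⟩ := hd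
  have hadj : (del G {v}).Adj u p := ⟨hup, by simp; tauto, by simp; tauto⟩
  have hadj' : (del (del G {v}) {u, p}).Adj w s := ⟨⟨hws, by simp; tauto, by simp; tauto⟩,
    by simp; tauto, by simp; tauto⟩
  obtain ⟨h1, h2, h3⟩ := adm_of_pair hadj' (e ▸ hU')
  have h4 := card_of_pair hws.ne h1 h2
  obtain ⟨h1', h2', h3'⟩ := adm_of_pair hadj h3
  have h4' := card_of_pair hup.ne h1' h2'
  refine good_of_lift (S := {v, u, p, w, s}) (T := T) (U' := U') hG hl
    (deg_del_le G _) ?_ (fun s hs => deg_del_eq_zero hs) ?_ (by omega) (adm_of_iso h3' ?_) ?_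
  · intro s hs
    simp only [Finset.mem_insert, Finset.mem_singleton] at hs
    rcases hs with rfl | rfl | rfl | rfl | rfl
    · exact hv
    · exact deg_ne_zero_of_adj hup
    · exact deg_ne_zero_of_adj hup.symm
    · exact deg_ne_zero_of_adj hws
    · exact deg_ne_zero_of_adj hws.symm
  · intro x hx hx'
    refine hT x hx ?_
    by_contra hcon
    push Not at hcon
    refine hx' (hx ▸ deg_del_eq (by simpa using hcon.1) fun s hs hxs => ?_)
    simp only [Finset.mem_insert, Finset.mem_singleton] at hs
    rcases hs with rfl | rfl | rfl | rfl | rfl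
    exacts [hcon.2.1 hxs.symm, hcon.2.2.1 hxs.symm, hcon.2.2.2.1 hxs.symm, hcon.2.2.2.2.1 hxs.symm,
      hcon.2.2.2.2.2 hxs.symm]
  · intro x hx
    have := hN x hx
    simp
    tauto
  · have : ({v, u, p, w, s} : Finset V).card = 5 := by
      rw [Finset.card_insert_of_notMem (by simp; tauto), Finset.card_insert_of_notMem
        (by simp; tauto), Finset.card_insert_of_notMem (by simp; tauto), Finset.card_pair d10]
    omega

theorem good_of_pm5 {v u p w s : V} (T : Finset V) (hG : Subcub G) (hl : ∀ v, deg G v ≠ 1)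
    (ih : Below G) (hok : Ok G) (hv : deg G v ≠ 0)
    (hup : G.Adj u p) (hws : G.Adj w s) (hd : [v, u, p, w, s].Nodup)
    (hN : ∀ x, G.Adj v x → x ∈ [u, p, w, s])
    (hT : ∀ x, deg G x = 3 → (x ∈ [v, u, p, w, s] ∨
      G.Adj v x ∨ G.Adj u x ∨ G.Adj p x ∨ G.Adj w x ∨ G.Adj s x) → x ∈ T)
    (hTc : T.card ≤ 7) : Good G :=
  good_of_pm5' hG hl ih (ok_del hG hok _) hv hup hws hd hN hT
    (add_le_add (baseWeight_le_weight _) hTc)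

end Weights

/-! ### Graphs with a leaf -/

section Leaves

variable {V : Type*} [Fintype V] [DecidableEq V] {G H : SimpleGraph V}

open Classical in
theorem deg_eq_sum (G : SimpleGraph V) (v : V) : deg G v = ∑ y, if G.Adj y v then 1 else 0 := by
  rw [deg, Set.ncard_eq_toFinset_card', ← Finset.card_filter]
  congr 1
  ext
  simp [G.adj_comm]

open Classical in
theorem leafNbrs_eq_sum (G : SimpleGraph V) (v : V) :
    leafNbrs G v = ∑ y, if G.Adj y v ∧ deg G y = 1 then 1 else 0 := by
  rw [leafNbrs, Set.ncard_eq_toFinset_card', ← Finset.card_filter]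
  congr 1
  ext
  simp [G.adj_comm]

theorem leafNbrs_le_deg (G : SimpleGraph V) (v : V) : leafNbrs G v ≤ deg G v :=
  Set.ncard_le_ncard fun _ h => h.1

open Classical in
theorem deg_eq_deg_del_add {S : Finset V} {y : V} (hy : y ∉ S) :
    deg G y = deg (del G S) y + ∑ s ∈ S, if G.Adj y s then 1 else 0 := by
  rw [deg_eq_sum, deg_eq_sum, ← Finset.sum_add_sum_compl S, add_comm,
    ← Finset.sum_add_sum_compl S (fun z => if (del G S).Adj z y then 1 else 0)]
  have h1 : (∑ z ∈ S, if (del G S).Adj z y then 1 else 0) = 0 :=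
    Finset.sum_eq_zero fun z hz => by simp [hz]
  rw [h1, zero_add]
  congr 1
  · refine Finset.sum_congr rfl fun z hz => ?_
    simp [hy, Finset.mem_compl.1 hz]
  · refine Finset.sum_congr rfl fun z hz => ?_
    simp [G.adj_comm]

theorem leafNbrs_le_of_del {S : Finset V} {y : V} (hy : y ∉ S)
    (h : ∀ z, G.Adj y z → deg G z = 1 → z ∉ S) : leafNbrs G y ≤ leafNbrs (del G S) y := by
  refine Set.ncard_le_ncard fun z hz => ?_
  have hzS := h z hz.1 hz.2
  refine ⟨⟨hz.1, hy, hzS⟩, ?_⟩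
  have h1 := deg_del_le G S z
  have h2 : deg (del G S) z ≠ 0 := deg_ne_zero_of_adj (x := y) ⟨hz.1.symm, hzS, hy⟩
  have := hz.2
  omega

theorem eq_of_deg_one {v a b : V} (h : deg G v = 1) (ha : G.Adj v a) (hb : G.Adj v b) : a = b := by
  obtain ⟨c, hc⟩ := deg_eq_one.1 h
  rw [(hc a).1 ha, (hc b).1 hb]

/-- Three new isolated vertices bring 18. Without further leaves at most 6 is lost: the cubic
weights of `u` and `x`, the leaf `v`, and one unit for each of the at most three edges leaving the
set. A further leaf at `u` or `x` becomes isolated, which more than pays for itself. -/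
theorem weight_del_leaf_le (hG : Subcub G) {v u x : V} (hv : deg G v = 1) (hvu : G.Adj v u)
    (hux : G.Adj u x) (hxv : x ≠ v) : weight G + 12 ≤ weight (del G {v, u, x}) := by
  classical
  set S : Finset V := {v, u, x} with hS
  have hu2 : 2 ≤ deg G u := by
    have : ({v, x} : Set V).ncard ≤ deg G u := Set.ncard_le_ncard (by
      rintro y (rfl | rfl)
      exacts [hvu.symm, hux])
    rwa [Set.ncard_pair hxv.symm] at this
  have hvx : ¬ G.Adj v x := fun h => hux.ne (eq_of_deg_one hv hvu h)
  have hmem : ∀ y, y ∈ S ↔ y = v ∨ y = u ∨ y = x := by simp [hS]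
  have hsum : ∀ g : V → ℕ, ∑ s ∈ S, g s = g v + (g u + g x) := fun g => by
    rw [hS, Finset.sum_insert (by simp [hvu.ne, hxv.symm]), Finset.sum_pair hux.ne]
  let c : V → ℕ := fun y => (if G.Adj y u then 1 else 0) + if G.Adj y x then 1 else 0
  let l : V → ℕ := fun y => (if G.Adj y u ∧ deg G y = 1 then 1 else 0) +
    if G.Adj y x ∧ deg G y = 1 then 1 else 0
  -- Each lost edge costs its outer end at most 1. This covers an outer end that falls to degree 1
  -- and can no longer be credited with a leaf.
  have hpt : ∀ y ∈ Sᶜ, val G y + 6 * l y ≤ val (del G S) y + c y := by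
    intro y hy
    have hy' := Finset.mem_compl.1 hy
    have hyv : ¬ G.Adj y v := fun h => hy' (by
      rw [hmem, eq_of_deg_one hv h.symm hvu]; simp)
    have h1 := deg_eq_deg_del_add (G := G) hy'
    rw [hsum, if_neg hyv, zero_add] at h1
    have h2 : leafNbrs G y ≤ leafNbrs (del G S) y := leafNbrs_le_of_del hy' fun z hyz hz hzS => by
      rcases (hmem z).1 hzS with rfl | rfl | rfl
      · exact hyv hyz
      · omega
      · exact hy' (by rw [hmem, eq_of_deg_one hz hyz.symm hux.symm]; simp)
    have h3 := leafNbrs_le_deg (del G S) y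
    have h4 := hG y
    have h5 : l y ≤ c y := by
      refine add_le_add ?_ ?_ <;> split_ifs with i1 i2 <;>
        first | omega | exact absurd i1.1 i2
    have h6 : deg G y = 1 ∨ l y = 0 := or_iff_not_imp_left.2 fun h => by simp [l, h]
    change deg G y = deg (del G S) y + c y at h1
    unfold val base
    generalize leafNbrs G y = a at *
    generalize leafNbrs (del G S) y = a' at *
    generalize deg G y = d at *
    generalize deg (del G S) y = d' at *
    generalize c y = k at *
    generalize l y = m at *
    split_ifs <;> omega
  have hpt' := Finset.sum_le_sum hpt
  rw [Finset.sum_add_distrib, Finset.sum_add_distrib, ← Finset.mul_sum] at hpt'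
  have hW := Finset.sum_add_sum_compl S (val G)
  have hW' := Finset.sum_add_sum_compl S (val (del G S))
  rw [hsum] at hW hW'
  have hv0 : val G v = 0 := by simp [val, base, hv]
  have hS6 : ∀ s ∈ S, val (del G S) s = 6 := fun s hs => by simp [val, base, deg_del_eq_zero hs]
  rw [hS6 v (by simp [hS]), hS6 u (by simp [hS]), hS6 x (by simp [hS])] at hW'
  have hdu := deg_eq_sum G u
  have hdx := deg_eq_sum G x
  have hlu := leafNbrs_eq_sum G u
  have hlx := leafNbrs_eq_sum G x
  rw [← Finset.sum_add_sum_compl S, hsum] at hdu hdx hlu hlx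
  simp only [hvu, hvx, hux, hux.symm, hv, G.irrefl, and_self, if_true, if_false, false_and,
    true_and, show deg G u ≠ 1 by omega] at hdu hdx hlu hlx
  have h3u := hG u
  have h3x := hG x
  have hc : ∑ y ∈ Sᶜ, c y = (∑ y ∈ Sᶜ, if G.Adj y u then 1 else 0) +
    ∑ y ∈ Sᶜ, if G.Adj y x then 1 else 0 := Finset.sum_add_distrib
  have hl : ∑ y ∈ Sᶜ, l y = (∑ y ∈ Sᶜ, if G.Adj y u ∧ deg G y = 1 then 1 else 0) +
    ∑ y ∈ Sᶜ, if G.Adj y x ∧ deg G y = 1 then 1 else 0 := Finset.sum_add_distrib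
  have hbu : base G u ≤ 1 := by unfold base; split_ifs <;> omega
  have hbx : base G x ≤ 1 := by
    have := deg_ne_zero_of_adj hux.symm
    unfold base; split_ifs <;> omega
  have hvu' : val G u = base G u + leafNbrs G u := by simp [val, hu2]
  have hvx' : val G x ≤ (if deg G x = 1 then 0 else 1 + leafNbrs G x) := by
    have := deg_ne_zero_of_adj hux.symm
    unfold val
    split_ifs <;> first | omega | simp_all [base]
  unfold weight
  split_ifs at hlu hvx' <;> omega

/-- A `K₂` component weighs nothing, since leaves are credited only to vertices of degree at least
2. That is why `K` enters the final bound. -/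
theorem weight_del_pair_le {u v : V} (hu : deg G u = 1) (hv : deg G v = 1)
    (huv : G.Adj u v) : weight G + 12 ≤ weight (del G {u, v}) := by
  have h := sum_ite_mem ({u, v} : Finset V) 6
  rw [Finset.card_pair huv.ne] at h
  rw [weight, weight, show 12 = 6 * 2 from rfl, ← h, ← Finset.sum_add_distrib]
  refine Finset.sum_le_sum fun y _ => ?_
  split_ifs with hy
  · have h1 := deg_del_eq_zero (G := G) hy
    have h2 : deg G y = 1 := by
      simp only [Finset.mem_insert, Finset.mem_singleton] at hy
      rcases hy with rfl | rfl <;> assumption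
    simp [val, base, h1, h2]
  · have hy' : ∀ s ∈ ({u, v} : Finset V), ¬ G.Adj y s := by
      simp only [Finset.mem_insert, Finset.mem_singleton, not_or] at hy ⊢
      rintro s (rfl | rfl) hs
      · exact hy.2 (eq_of_deg_one hu hs.symm huv)
      · exact hy.1 (eq_of_deg_one hv hs.symm huv.symm)
    have h1 := deg_del_eq hy hy'
    have h2 := leafNbrs_le_of_del hy fun z hz _ hzs => hy' z hzs hz
    simp only [val, base, h1]
    split_ifs <;> omega

/-- The matching edge at `u` avoids `v`, so `v` stays missed. Besides the induction, this serves the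
second claim of the theorem and the gluing along bridges. -/
theorem exists_adm_mem_of_leaf (hG : Subcub G) (ih : Below G) (hok : Ok G) {v u : V}
    (hv : deg G v = 1) (hvu : G.Adj v u) (hu : 2 ≤ deg G u) :
    ∃ U, Adm G U ∧ weight G ≤ 6 * U.card ∧ v ∈ U := by
  obtain ⟨x, hux, hxv⟩ : ∃ x, G.Adj u x ∧ x ≠ v := by
    obtain ⟨x, hx, hxv⟩ := Set.exists_ne_of_one_lt_ncard (s := G.neighborSet u) hu v
    exact ⟨x, hx, hxv⟩
  obtain ⟨U', hU', hc⟩ := ih _ (mu_del_lt (S := {v, u, x}) (v := v) (by simp) (by omega))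
    (subcub_del hG _) (ok_del hG hok _)
  have hw := weight_del_leaf_le hG hv hvu hux hxv
  have hvU : v ∈ U' := mem_of_adm hU' (deg_del_eq_zero (by simp))
  have e : del G {v, u, x} = del (del G {v}) {u, x} := by rw [del_del]; rfl
  have hadj : (del G {v}).Adj u x := ⟨hux, by simpa using hvu.ne.symm, by simpa using hxv⟩
  obtain ⟨h1, h2, h3⟩ := adm_of_pair hadj (e ▸ hU')
  have h4 := card_of_pair hux.ne h1 h2
  refine ⟨_, adm_of_iso h3 fun y hy => ?_, by omega, by simp [hvU, hvu.ne, hxv.symm]⟩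
  rw [eq_of_deg_one hv hy hvu]
  simp

theorem good_of_leaf (hG : Subcub G) (ih : Below G) (hok : Ok G) {v : V}
    (hv : deg G v = 1) : Good G := by
  obtain ⟨u, hu⟩ := deg_eq_one.1 hv
  have hvu : G.Adj v u := (hu u).2 rfl
  by_cases hu2 : 2 ≤ deg G u
  · obtain ⟨U, h1, h2, -⟩ := exists_adm_mem_of_leaf hG ih hok hv hvu hu2
    exact ⟨U, h1, h2⟩
  · have h0 := deg_ne_zero_of_adj hvu.symm
    obtain ⟨U', hU', hc⟩ := ih _ (mu_del_lt (S := {v, u}) (v := v) (by simp) (by omega))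
      (subcub_del hG _) (ok_del hG hok _)
    have hw := weight_del_pair_le hv (by omega : deg G u = 1) hvu
    obtain ⟨h1, h2, h3⟩ := adm_of_pair hvu hU'
    have h4 := card_of_pair hvu.ne h1 h2
    exact ⟨_, h3, by omega⟩

end Leaves

/-! ### Bridges with a cubic side -/

section Bridges

variable {V : Type*} [Fintype V] [DecidableEq V] {G H : SimpleGraph V}

/-- The edge joining `a ∉ Y` and `b ∈ Y` is the only edge that leaves `Y`. -/
structure IsBridgeSide (G : SimpleGraph V) (Y : Finset V) (a b : V) : Prop where
  mem : b ∈ Y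
  notMem : a ∉ Y
  adj : G.Adj a b
  eq : ∀ y ∈ Y, ∀ x, x ∉ Y → G.Adj y x → y = b ∧ x = a

variable {Y : Finset V} {a b : V}

theorem IsBridgeSide.compl (h : IsBridgeSide G Y a b) : IsBridgeSide G Yᶜ b a where
  mem := Finset.mem_compl.2 h.notMem
  notMem := fun hh => Finset.mem_compl.1 hh h.mem
  adj := h.adj.symm
  eq y hy x hx hyx :=
    (h.eq x (by simpa using hx) y (Finset.mem_compl.1 hy) hyx.symm).symm

/-- In the part `Y ∪ {a}` the vertex `a` is missed, so `b` is matched inside `Y`. Hence the edge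
`ab` cannot violate independence, whatever the other part does with `a`. -/
theorem IsBridgeSide.adm_glue (h : IsBridgeSide G Y a b) {U₁ U₂ : Finset V}
    (h₁ : Adm (del G Y) U₁) (h₂ : Adm (del G (Yᶜ.erase a)) U₂) (ha : a ∈ U₂) :
    ∃ U, Adm G U ∧ U.card + Fintype.card V = U₁.card + U₂.card := by
  have hY : Y ⊆ U₁ := fun y hy => mem_of_adm h₁ (deg_del_eq_zero hy)
  have hX : Yᶜ ⊆ U₂ := fun y hy => by
    by_cases hya : y = a
    · exact hya ▸ ha
    · exact mem_of_adm h₂ (deg_del_eq_zero (Finset.mem_erase.2 ⟨hya, hy⟩))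
  obtain ⟨hi₁, f₁, hf₁⟩ := h₁
  obtain ⟨hi₂, f₂, hf₂⟩ := h₂
  have hmem := h.mem
  have hbU : b ∉ U₂ := fun hb => hi₂ a ha b hb ⟨h.adj, by simp, by simp [hmem]⟩
  refine ⟨(U₁ \ Y) ∪ (U₂ \ Yᶜ), ⟨?_, fun y => if y ∈ Y then f₂ y else f₁ y, ?_⟩, ?_⟩
  · intro x hx y hy hxy
    have e1 := h.eq
    have e2 : ∀ x ∈ U₁, ∀ y ∈ U₁, x ∉ Y → y ∉ Y → ¬ G.Adj x y := fun x hx y hy h1 h2 h3 =>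
      hi₁ x hx y hy ⟨h3, h1, h2⟩
    have e3 : ∀ x ∈ U₂, ∀ y ∈ U₂, x ∈ Y → y ∈ Y → ¬ G.Adj x y := fun x hx y hy h1 h2 h3 =>
      hi₂ x hx y hy ⟨h3, by simp [h1], by simp [h2]⟩
    have e4 := hxy.symm
    simp only [Finset.mem_union, Finset.mem_sdiff, Finset.mem_compl, not_not] at hx hy
    grind
  · intro y hy
    simp only [Finset.mem_union, Finset.mem_sdiff, Finset.mem_compl, not_not] at hy ⊢
    by_cases hyY : y ∈ Y
    · have hyU : y ∉ U₂ := fun hh => hy (Or.inr ⟨hh, hyY⟩)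
      obtain ⟨h1, h2, h3⟩ := hf₂ y hyU
      have h4 : f₂ y ∈ Y := by
        by_contra hh
        exact h2 (hX (Finset.mem_compl.2 hh))
      simp [hyY, h4, h1.1, h2, h3]
    · have hyU : y ∉ U₁ := fun hh => hy (Or.inl ⟨hh, hyY⟩)
      obtain ⟨h1, h2, h3⟩ := hf₁ y hyU
      have h4 : f₁ y ∉ Y := fun hh => h2 (hY hh)
      simp [hyY, h4, h1.1, h2, h3]
  · rw [Finset.card_union_of_disjoint]
    · have h1 := Finset.card_sdiff_add_card_eq_card hY
      have h2 := Finset.card_sdiff_add_card_eq_card hX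
      have h3 := Finset.card_add_card_compl Y
      omega
    · rw [Finset.disjoint_left]
      intro y hy hy'
      simp only [Finset.mem_sdiff, Finset.mem_compl, not_not] at hy hy'
      exact hy.2 hy'.2

/-- Here the bridge itself is put into the matching, and the two sides without its ends are
independent problems. -/
theorem IsBridgeSide.adm_glue_match (h : IsBridgeSide G Y a b) {U₁ U₂ : Finset V}
    (h₁ : Adm (del G (insert a Y)) U₁) (h₂ : Adm (del G (insert b Yᶜ)) U₂) :
    ∃ U, Adm G U ∧ U.card + Fintype.card V + 2 = U₁.card + U₂.card := by
  have hY : insert a Y ⊆ U₁ := fun y hy => mem_of_adm h₁ (deg_del_eq_zero hy)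
  have hX : insert b Yᶜ ⊆ U₂ := fun y hy => mem_of_adm h₂ (deg_del_eq_zero hy)
  obtain ⟨hi₁, f₁, hf₁⟩ := h₁
  obtain ⟨hi₂, f₂, hf₂⟩ := h₂
  have hb := h.mem
  have ha := h.notMem
  have hab := h.adj
  have hab' := h.adj.symm
  have hY' : ∀ y, y = a ∨ y ∈ Y → y ∈ U₁ := fun y hy => hY (by simpa using hy)
  have hX' : ∀ y, y = b ∨ y ∉ Y → y ∈ U₂ := fun y hy => hX (by simpa using hy)
  refine ⟨(U₁ \ insert a Y) ∪ (U₂ \ insert b Yᶜ), ⟨?_, fun y => if y = a then b else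
    if y = b then a else if y ∈ Y then f₂ y else f₁ y, ?_⟩, ?_⟩
  · intro x hx y hy hxy
    have e1 := h.eq
    have e2 : ∀ x ∈ U₁, ∀ y ∈ U₁, x ∉ insert a Y → y ∉ insert a Y → ¬ G.Adj x y :=
      fun x hx y hy h1 h2 h3 => hi₁ x hx y hy ⟨h3, h1, h2⟩
    have e3 : ∀ x ∈ U₂, ∀ y ∈ U₂, x ∉ insert b Yᶜ → y ∉ insert b Yᶜ → ¬ G.Adj x y :=
      fun x hx y hy h1 h2 h3 => hi₂ x hx y hy ⟨h3, h1, h2⟩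
    have e4 := hxy.symm
    simp only [Finset.mem_union, Finset.mem_sdiff, Finset.mem_compl, Finset.mem_insert, not_not,
      not_or] at hx hy e2 e3
    grind
  · intro y hy
    simp only [Finset.mem_union, Finset.mem_sdiff, Finset.mem_compl, Finset.mem_insert, not_not,
      not_or, del_adj] at hy hf₁ hf₂ ⊢
    grind
  · rw [Finset.card_union_of_disjoint]
    · have h1 := Finset.card_sdiff_add_card_eq_card hY
      have h2 := Finset.card_sdiff_add_card_eq_card hX
      have h3 := Finset.card_add_card_compl Y
      rw [Finset.card_insert_of_notMem ha] at h1
      rw [Finset.card_insert_of_notMem (by simpa using hb)] at h2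
      omega
    · rw [Finset.disjoint_left]
      intro y hy hy'
      simp only [Finset.mem_sdiff, Finset.mem_compl, Finset.mem_insert, not_or, not_not] at hy hy'
      exact hy.2.2 hy'.2.2

theorem IsBridgeSide.deg_del_compl (h : IsBridgeSide G Y a b) {y : V} (hy : y ∈ Y) {S : Finset V}
    (hS : ∀ s ∈ S, s ∉ Y) (hne : y ≠ b ∨ a ∉ S) : deg (del G S) y = deg G y :=
  deg_del_eq (fun hh => hS y hh hy) fun s hs hys => by
    obtain ⟨h1, h2⟩ := h.eq y hy s (hS s hs) hys
    rcases hne with hne | hne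
    · exact hne h1
    · exact hne (h2 ▸ hs)

theorem card_mul_add_card_le {S T : Finset V} (hS : ∀ s ∈ S, deg H s = 0)
    (hT : ∀ t ∈ T, deg H t = 3) : 6 * S.card + T.card ≤ baseWeight H := by
  rw [← sum_ite_mem, ← one_mul T.card, ← sum_ite_mem, ← Finset.sum_add_distrib]
  refine Finset.sum_le_sum fun v _ => ?_
  have h1 := hS v
  have h2 := hT v
  unfold base
  grind

/-- In the graph induced on `Y` only `b` has degree 2 and all others are cubic, so `|Y| - 1` is
even. -/
theorem IsBridgeSide.odd_card (h : IsBridgeSide G Y a b) (hG : Subcub G)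
    (h3 : ∀ y ∈ Y, deg G y = 3) : Odd Y.card := by
  have hb : deg (del G Yᶜ) b = 2 := by
    classical
    have h1 := deg_eq_deg_del_add (G := G) (S := Yᶜ) (y := b) (by simpa using h.mem)
    have h2 : (∑ s ∈ Yᶜ, if G.Adj b s then 1 else 0) = 1 := by
      rw [Finset.sum_eq_single_of_mem a (by simpa using h.notMem)]
      · simp [h.adj.symm]
      · intro x hx hxa
        rw [if_neg]
        exact fun hbx => hxa (h.eq b h.mem x (by simpa using hx) hbx).2
    have := h3 b h.mem
    omega
  have hy : ∀ y ∈ Y, y ≠ b → deg (del G Yᶜ) y = 3 := fun y hy hyb =>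
    (h.deg_del_compl hy (by simp) (Or.inl hyb)).trans (h3 y hy)
  have hx : ∀ x, x ∉ Y → deg (del G Yᶜ) x = 0 := fun x hx => deg_del_eq_zero (by simpa using hx)
  have h1 := even_baseWeight (subcub_del hG Yᶜ) fun v => by
    by_cases hv : v ∈ Y
    · by_cases hvb : v = b
      · rw [hvb, hb]; omega
      · rw [hy v hv hvb]; omega
    · rw [hx v hv]; omega
  have h2 : baseWeight (del G Yᶜ) = 6 * Yᶜ.card + (Y.erase b).card := by
    rw [← sum_ite_mem, ← one_mul (Y.erase b).card, ← sum_ite_mem, ← Finset.sum_add_distrib]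
    refine Finset.sum_congr rfl fun v _ => ?_
    unfold base
    simp only [Finset.mem_compl, Finset.mem_erase]
    grind
  rw [h2, Nat.even_add, Finset.card_erase_of_mem h.mem] at h1
  have h3 : Even (Y.card - 1) := h1.1 (Even.mul_right (by decide) _)
  have h4 : 0 < Y.card := Finset.card_pos.2 ⟨b, h.mem⟩
  obtain ⟨k, hk⟩ := h3
  exact ⟨k, by omega⟩

theorem exists_nbrs_subset (hG : Subcub G) {v x : V} (h : G.Adj v x) :
    ∃ y z, ∀ w, G.Adj v w → w = x ∨ w = y ∨ w = z := by
  have h0 := deg_ne_zero_of_adj h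
  have h1 := hG v
  obtain h2 | h2 | h2 : deg G v = 1 ∨ deg G v = 2 ∨ deg G v = 3 := by omega
  · exact ⟨x, x, fun w hw => Or.inl (eq_of_deg_one h2 hw h)⟩
  · obtain ⟨y, -, hy⟩ := exists_of_deg_two h2 h
    exact ⟨y, y, fun w hw => by have := (hy w).1 hw; tauto⟩
  · obtain ⟨y, z, -, -, -, hy⟩ := exists_of_deg_three h2 h
    exact ⟨y, z, fun w hw => (hy w).1 hw⟩

theorem exists_adj_ne {v : V} (h : 2 ≤ deg G v) (x : V) : ∃ y, G.Adj v y ∧ y ≠ x := by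
  obtain ⟨y, hy, hyx⟩ := Set.exists_ne_of_one_lt_ncard (s := G.neighborSet v) h x
  exact ⟨y, hy, hyx⟩

theorem card_insert_insert_le (S : Finset V) (x y : V) : (insert x (insert y S)).card ≤ S.card + 2 :=
  (Finset.card_insert_le _ _).trans (by have := Finset.card_insert_le y S; omega)

variable (hG : Subcub G) (hl : ∀ v, deg G v ≠ 1) (ih : Below G)
  (hr : ∀ v, ∃ y, G.Reachable v y ∧ (deg G y ≤ 2 ∨ y = b)) (h3 : ∀ y ∈ Y, deg G y = 3)

include hG hl ih hr h3

/-- Split into `G - Y` and the graph on `Y ∪ {a}`, where `a` is a leaf chosen to be missed. If the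
latter misses `R` vertices, then `6R ≥ |Y| + 1` and `R` is even, so `6R` is a multiple of 12. For
the residues 1, 3, 5 this rounds up to the required `|Y| + 7`. -/
theorem IsBridgeSide.good_left (h : IsBridgeSide G Y a b)
    (hc : Y.card % 12 = 1 ∨ Y.card % 12 = 3 ∨ Y.card % 12 = 5) : Good G := by
  have ha0 := deg_ne_zero_of_adj h.adj
  have ha2 : 2 ≤ deg G a := by have := hl a; omega
  obtain ⟨x, hax, hxb⟩ := exists_adj_ne ha2 b
  have hxY : x ∉ Y := fun hx => hxb (h.eq x hx a h.notMem hax.symm).1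
  have hok₁ : Ok (del G Y) := ok_del_of_reach hG fun v => by
    obtain ⟨y, hy, hy'⟩ := hr v
    exact ⟨y, hy, hy'.imp_right fun e => by rw [e]; exact h.mem⟩
  have hok₂ : Ok (del G (Yᶜ.erase a)) := ok_del_of_reach hG fun v => by
    obtain ⟨y, hy, hy' | rfl⟩ := hr v
    · exact ⟨y, hy, Or.inl hy'⟩
    · exact ⟨x, hy.trans (h.adj.symm.reachable.trans hax.reachable), Or.inr (by
        simp [hax.ne.symm, hxY])⟩
  have hb0 := deg_ne_zero_of_adj h.adj.symm
  obtain ⟨U₁, hU₁, hw₁⟩ := ih _ (mu_del_lt h.mem hb0) (subcub_del hG _) hok₁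
  have hmu := mu_del_lt (G := G) (S := Yᶜ.erase a) (v := x) (by simp [hax.ne.symm, hxY])
    (deg_ne_zero_of_adj hax.symm)
  have hdY : ∀ y ∈ Y, deg (del G (Yᶜ.erase a)) y = 3 := fun y hy =>
    (h.deg_del_compl hy (fun s hs => by simpa using (Finset.mem_erase.1 hs).2)
      (Or.inr (by simp))).trans (h3 y hy)
  have hda : deg (del G (Yᶜ.erase a)) a = 1 := deg_eq_one.2 ⟨b, fun z => by
    constructor
    · rintro ⟨h1, -, h2⟩
      have hz : z ∈ Y := by
        by_contra hz
        exact h2 (by simp [hz, h1.ne.symm])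
      exact (h.eq z hz a h.notMem h1.symm).1
    · rintro rfl
      exact ⟨h.adj, by simp, by simp [h.mem]⟩⟩
  have hadj : (del G (Yᶜ.erase a)).Adj a b := ⟨h.adj, by simp, by simp [h.mem]⟩
  obtain ⟨U₂, hU₂, hw₂, haU⟩ := exists_adm_mem_of_leaf (subcub_del hG (Yᶜ.erase a))
    (ih.mono hmu.le) hok₂ hda hadj (by rw [hdY b h.mem]; omega)
  obtain ⟨U, hU, hUc⟩ := h.adm_glue hU₁ hU₂ haU
  refine ⟨U, hU, ?_⟩
  rw [weight_eq_baseWeight hl]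
  have e1 := baseWeight_add_le (G := G) (H := del G Y) (S := Y) (T := insert a Y) (deg_del_le G Y)
    (fun s hs => by rw [h3 s hs]; omega) (fun s hs => deg_del_eq_zero hs) (fun v hv hv' => by
      by_contra hcon
      rw [Finset.mem_insert, not_or] at hcon
      refine hv' (hv ▸ deg_del_eq hcon.2 fun s hs hvs => ?_)
      exact hcon.1 (h.eq s hs v hcon.2 hvs.symm).2)
  have e2 := card_mul_add_card_le (H := del G (Yᶜ.erase a)) (S := Yᶜ.erase a) (T := Y)
    (fun s hs => deg_del_eq_zero hs) hdY
  have e3 := baseWeight_lt_weight hadj.symm hda (by rw [hdY b h.mem]; omega)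
  have e4 := baseWeight_le_weight (del G Y)
  rw [Finset.card_insert_of_notMem h.notMem] at e1
  rw [Finset.card_erase_of_mem (by simpa using h.notMem)] at e2
  have e5 := Finset.card_add_card_compl Y
  have e6 : 0 < Yᶜ.card := Finset.card_pos.2 ⟨a, by simpa using h.notMem⟩
  obtain ⟨k₁, hk₁⟩ := even_of_adm hU₁
  obtain ⟨k₂, hk₂⟩ := even_of_adm hU₂
  omega

/-- Now `b` is a missed leaf attached to the other side. The graph on `Y` misses an odd number `R`
of vertices with `6R ≥ |Y| - 1`, so `6R` is 6 modulo 12; for the residues 9 and 11 this rounds up to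
at least `|Y| + 7`. -/
theorem IsBridgeSide.good_right (h : IsBridgeSide G Y a b)
    (hc : Y.card % 12 = 9 ∨ Y.card % 12 = 11) : Good G := by
  have ha0 := deg_ne_zero_of_adj h.adj
  have ha2 : 2 ≤ deg G a := by have := hl a; omega
  have hb3 := h3 b h.mem
  obtain ⟨x, hbx, hxa⟩ := exists_adj_ne (show 2 ≤ deg G b by omega) a
  have hxY : x ∈ Y := by
    by_contra hx
    exact hxa (h.eq b h.mem x hx hbx).2
  have hok₁ : Ok (del G (Y.erase b)) := ok_del_of_reach hG fun v => by
    obtain ⟨y, hy, hy' | rfl⟩ := hr v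
    · exact ⟨y, hy, Or.inl hy'⟩
    · exact ⟨x, hy.trans hbx.reachable, Or.inr (by simp [hbx.ne.symm, hxY])⟩
  have hok₂ : Ok (del G Yᶜ) := ok_del_of_reach hG fun v => by
    obtain ⟨y, hy, hy' | rfl⟩ := hr v
    · exact ⟨y, hy, Or.inl hy'⟩
    · exact ⟨a, hy.trans h.adj.symm.reachable, Or.inr (by simp [h.notMem])⟩
  have hmu := mu_del_lt (G := G) (S := Y.erase b) (v := x) (by simp [hbx.ne.symm, hxY])
    (deg_ne_zero_of_adj hbx.symm)
  have hda : deg (del G (Y.erase b)) a = deg G a :=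
    deg_del_eq (by simp [h.notMem]) fun s hs has => (Finset.mem_erase.1 hs).1
      (h.eq s (Finset.mem_erase.1 hs).2 a h.notMem has.symm).1
  have hdb : deg (del G (Y.erase b)) b = 1 := deg_eq_one.2 ⟨a, fun z => by
    constructor
    · rintro ⟨h1, -, h2⟩
      exact (h.eq b h.mem z (fun hz => h2 (by simp [hz, h1.ne.symm])) h1).2
    · rintro rfl
      exact ⟨h.adj.symm, by simp, by simp [h.notMem]⟩⟩
  have hadj : (del G (Y.erase b)).Adj b a := ⟨h.adj.symm, by simp, by simp [h.notMem]⟩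
  obtain ⟨U₁, hU₁, hw₁⟩ := ih _ (mu_del_lt (S := Yᶜ) (v := a) (by simp [h.notMem]) ha0)
    (subcub_del hG _) hok₂
  obtain ⟨U₂, hU₂, hw₂, hbU⟩ := exists_adm_mem_of_leaf (subcub_del hG (Y.erase b))
    (ih.mono hmu.le) hok₁ hdb hadj (by omega)
  obtain ⟨U, hU, hUc⟩ := h.compl.adm_glue hU₁ (by rwa [compl_compl]) hbU
  refine ⟨U, hU, ?_⟩
  rw [weight_eq_baseWeight hl]
  have e1 := baseWeight_add_le (G := G) (H := del G (Y.erase b)) (S := Y.erase b) (T := Y)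
    (deg_del_le G _) (fun s hs => by rw [h3 s (Finset.mem_erase.1 hs).2]; omega)
    (fun s hs => deg_del_eq_zero hs) (fun v hv hv' => by
      by_contra hcon
      refine hv' (hv ▸ deg_del_eq (by simp [hcon]) fun s hs hvs => ?_)
      exact (Finset.mem_erase.1 hs).1 (h.eq s (Finset.mem_erase.1 hs).2 v hcon hvs.symm).1)
  have e2 := card_mul_add_card_le (H := del G Yᶜ) (S := Yᶜ) (T := Y.erase b)
    (fun s hs => deg_del_eq_zero hs) (fun y hy =>
      (h.deg_del_compl (Finset.mem_erase.1 hy).2 (by simp) (Or.inl (Finset.mem_erase.1 hy).1)).trans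
        (h3 y (Finset.mem_erase.1 hy).2))
  have e3 := baseWeight_lt_weight hadj.symm hdb (by omega)
  have e4 := baseWeight_le_weight (del G Yᶜ)
  rw [Finset.card_erase_of_mem h.mem] at e1 e2
  have e5 := Finset.card_add_card_compl Y
  have e6 : 0 < Y.card := Finset.card_pos.2 ⟨b, h.mem⟩
  obtain ⟨k₁, hk₁⟩ := even_of_adm hU₁
  obtain ⟨k₂, hk₂⟩ := even_of_adm hU₂
  omega

/-- With `ab` matched, the graph on `Y - b` misses an even number `R` of vertices with `6R ≥ |Y| -
3`. For the residue 7 the next multiple of 12 is `|Y| + 5`, just enough to cover the two neighbours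
of `a` that may be lost. -/
theorem IsBridgeSide.good_match (h : IsBridgeSide G Y a b) (hc : Y.card % 12 = 7) : Good G := by
  have ha0 := deg_ne_zero_of_adj h.adj
  have hb3 := h3 b h.mem
  obtain ⟨x₁, x₂, hx⟩ := exists_nbrs_subset hG h.adj
  obtain ⟨y₁, y₂, hy⟩ := exists_nbrs_subset hG h.adj.symm
  have hok₁ : Ok (del G (insert a Y)) := ok_del_of_reach hG fun v => by
    obtain ⟨y, hy, hy'⟩ := hr v
    exact ⟨y, hy, hy'.imp_right fun e => by simp [e, h.mem]⟩
  have hok₂ : Ok (del G (insert b Yᶜ)) := ok_del_of_reach hG fun v => by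
    obtain ⟨y, hy, hy'⟩ := hr v
    exact ⟨y, hy, hy'.imp_right fun e => by simp [e]⟩
  obtain ⟨U₁, hU₁, hw₁⟩ := ih _ (mu_del_lt (S := insert a Y) (v := a) (by simp) ha0)
    (subcub_del hG _) hok₁
  obtain ⟨U₂, hU₂, hw₂⟩ := ih _ (mu_del_lt (S := insert b Yᶜ) (v := b) (by simp) (by omega))
    (subcub_del hG _) hok₂
  obtain ⟨U, hU, hUc⟩ := h.adm_glue_match hU₁ hU₂
  refine ⟨U, hU, ?_⟩
  rw [weight_eq_baseWeight hl]
  have e1 := baseWeight_add_le (G := G) (H := del G (insert a Y)) (S := insert a Y)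
    (T := insert x₁ (insert x₂ (insert a Y))) (deg_del_le G _)
    (fun s hs => by
      rcases Finset.mem_insert.1 hs with rfl | hs
      · exact ha0
      · rw [h3 s hs]; omega)
    (fun s hs => deg_del_eq_zero hs) (fun v hv hv' => by
      by_contra hcon
      simp only [Finset.mem_insert, not_or] at hcon
      refine hv' (hv ▸ deg_del_eq (by simp [hcon]) fun s hs hvs => ?_)
      rcases Finset.mem_insert.1 hs with rfl | hs
      · rcases hx v hvs.symm with rfl | rfl | rfl
        · exact hcon.2.2.2 h.mem
        · exact hcon.1 rfl
        · exact hcon.2.1 rfl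
      · exact hcon.2.2.1 (h.eq s hs v hcon.2.2.2 hvs.symm).2)
  have e1' := card_insert_insert_le (insert a Y) x₁ x₂
  have e2 := card_mul_add_card_le (H := del G (insert b Yᶜ)) (S := insert b Yᶜ)
    (T := ((Y.erase b).erase y₁).erase y₂)
    (fun s hs => deg_del_eq_zero hs) (fun y hyT => by
      simp only [Finset.mem_erase] at hyT
      refine (deg_del_eq (by simp [hyT]) fun s hs hys => ?_).trans (h3 y hyT.2.2.2)
      rcases Finset.mem_insert.1 hs with rfl | hs
      · rcases hy y hys.symm with rfl | rfl | rfl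
        · exact h.notMem hyT.2.2.2
        · exact hyT.2.1 rfl
        · exact hyT.1 rfl
      · exact hyT.2.2.1 (h.eq y hyT.2.2.2 s (by simpa using hs) hys).1)
  have e2' := Finset.pred_card_le_card_erase (s := (Y.erase b).erase y₁) (a := y₂)
  have e2'' := Finset.pred_card_le_card_erase (s := Y.erase b) (a := y₁)
  have e3 := baseWeight_le_weight (del G (insert a Y))
  have e4 := baseWeight_le_weight (del G (insert b Yᶜ))
  rw [Finset.card_erase_of_mem h.mem] at e2''
  rw [Finset.card_insert_of_notMem h.notMem] at e1 e1'
  rw [Finset.card_insert_of_notMem (by simpa using h.mem)] at e2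
  have e5 := Finset.card_add_card_compl Y
  obtain ⟨k₁, hk₁⟩ := even_of_adm hU₁
  obtain ⟨k₂, hk₂⟩ := even_of_adm hU₂
  omega

/-- A bridge one of whose sides has only cubic vertices makes a graph good. -/
theorem IsBridgeSide.good (h : IsBridgeSide G Y a b) : Good G := by
  obtain ⟨k, hk⟩ := h.odd_card hG h3
  by_cases h1 : Y.card % 12 = 1 ∨ Y.card % 12 = 3 ∨ Y.card % 12 = 5
  · exact h.good_left hG hl ih hr h3 h1
  by_cases h2 : Y.card % 12 = 9 ∨ Y.card % 12 = 11
  · exact h.good_right hG hl ih hr h3 h2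
  · exact h.good_match hG hl ih hr h3 (by omega)

end Bridges

/-! ### Direct pairings around a vertex of degree two -/

section Local

variable {V : Type*} [Fintype V] [DecidableEq V] {G H : SimpleGraph V}

/-- The neighbours of `v` are `a` and `b`. -/
def Nbrs₂ (G : SimpleGraph V) (v a b : V) : Prop := a ≠ b ∧ ∀ x, G.Adj v x ↔ x = a ∨ x = b

/-- The neighbours of `v` are `a`, `b` and `c`. -/
def Nbrs₃ (G : SimpleGraph V) (v a b c : V) : Prop :=
  a ≠ b ∧ a ≠ c ∧ b ≠ c ∧ ∀ x, G.Adj v x ↔ x = a ∨ x = b ∨ x = c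

theorem Nbrs₂.deg {v a b : V} (h : Nbrs₂ G v a b) : deg G v = 2 := deg_eq_two.2 ⟨a, b, h⟩

theorem Nbrs₃.deg {v a b c : V} (h : Nbrs₃ G v a b c) : deg G v = 3 := deg_eq_three.2 ⟨a, b, c, h⟩

theorem Nbrs₂.swap {v a b : V} (h : Nbrs₂ G v a b) : Nbrs₂ G v b a :=
  ⟨h.1.symm, fun x => by rw [h.2]; tauto⟩

theorem Nbrs₃.swap {v a b c : V} (h : Nbrs₃ G v a b c) : Nbrs₃ G v a c b :=
  ⟨h.2.1, h.1, h.2.2.1.symm, fun x => by rw [h.2.2.2]; tauto⟩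

theorem exists_nbrs_subset₂ (hG : Subcub G) {v x y : V} (hx : G.Adj v x) (hy : G.Adj v y)
    (hxy : x ≠ y) : ∃ z, ∀ w, G.Adj v w → w = x ∨ w = y ∨ w = z := by
  obtain ⟨a, b, h⟩ := exists_nbrs_subset hG hx
  rcases h y hy with rfl | rfl | rfl
  · exact absurd rfl hxy
  · exact ⟨b, h⟩
  · exact ⟨a, fun w hw => by have := h w hw; tauto⟩

theorem exists_nbrs_subset_of_le_two {v x : V} (h2 : deg G v ≤ 2) (hx : G.Adj v x) :
    ∃ z, ∀ w, G.Adj v w → w = x ∨ w = z := by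
  have h0 := deg_ne_zero_of_adj hx
  obtain h | h : deg G v = 1 ∨ deg G v = 2 := by omega
  · exact ⟨x, fun w hw => Or.inl (eq_of_deg_one h hw hx)⟩
  · obtain ⟨y, -, hy⟩ := exists_of_deg_two h hx
    exact ⟨y, fun w hw => (hy w).1 hw⟩

theorem nbrs₃_of_adj (hG : Subcub G) {v a b c : V} (ha : G.Adj v a) (hb : G.Adj v b)
    (hc : G.Adj v c) (hab : a ≠ b) (hac : a ≠ c) (hbc : b ≠ c) : Nbrs₃ G v a b c := by
  obtain ⟨z, hz⟩ := exists_nbrs_subset₂ hG ha hb hab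
  obtain rfl : c = z := by
    rcases hz c hc with h | h | h
    exacts [absurd h.symm hac, absurd h.symm hbc, h]
  exact ⟨hab, hac, hbc, fun x => ⟨hz x, by rintro (rfl | rfl | rfl) <;> assumption⟩⟩

theorem card_le_seven (a b c d e f g : V) : ({a, b, c, d, e, f, g} : Finset V).card ≤ 7 := by
  refine (card_insert_insert_le _ _ _).trans (Nat.add_le_add_right (m := 5) ?_ 2)
  exact Finset.card_le_five

variable (hG : Subcub G) (hl : ∀ v, deg G v ≠ 1) (ih : Below G) (hok : Ok G)

include hG hl ih hok

/-- The list form leaves the counting to `card_le_seven`: an application only names the vertices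
that may stop being cubic, repeating one when fewer than seven are needed. -/
theorem good_of_list {v u p w s : V} (t₁ t₂ t₃ t₄ t₅ t₆ t₇ : V)
    (hv : deg G v ≠ 0) (hup : G.Adj u p) (hws : G.Adj w s) (hd : [v, u, p, w, s].Nodup)
    (hN : ∀ x, G.Adj v x → x ∈ [u, p, w, s])
    (hT : ∀ x, deg G x = 3 → (x ∈ [v, u, p, w, s] ∨
      G.Adj v x ∨ G.Adj u x ∨ G.Adj p x ∨ G.Adj w x ∨ G.Adj s x) →
      x ∈ [t₁, t₂, t₃, t₄, t₅, t₆, t₇]) : Good G :=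
  good_of_pm5 {t₁, t₂, t₃, t₄, t₅, t₆, t₇} hG hl ih hok hv hup hws hd hN
    (fun x hx h => by simpa using hT x hx h) (card_le_seven ..)

variable {v u w : V} (hv : Nbrs₂ G v u w)
include hv

/-- Leave `v` missed and match `u` with `w`; only `u`, `w` and one further neighbour of each can be
lost. -/
theorem good_of_triangle (hu : deg G u = 3) (huw : G.Adj u w) : Good G := by
  have hvd := hv.deg
  have hvu : G.Adj v u := (hv.2 u).2 (Or.inl rfl)
  have hvw : G.Adj v w := (hv.2 w).2 (Or.inr rfl)
  obtain ⟨c, -, -, hc⟩ := exists_of_deg_three₂ hu hvu.symm huw hvw.ne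
  obtain ⟨z, hz⟩ := exists_nbrs_subset₂ hG hvw.symm huw.symm hvu.ne
  refine good_of_pm3 (T := {u, w, c, z, u, u, u}) hG hl ih (ok_del hG hok {v, u, w}) (by omega) huw
    hvu.ne hvw.ne (fun x hx => (hv.2 x).1 hx) (fun x hx h => ?_) (card_le_seven ..)
  have h1 := hv.2 x
  have h2 := hc x
  have h3 := hz x
  simp only [Finset.mem_insert, Finset.mem_singleton] at h ⊢
  grind

/-- Matching `up` and `wq` leaves only one outgoing edge at each of `p` and `q`, so at most six
vertices are lost. -/
theorem good_of_common_common {p q : V} (hu : Nbrs₃ G u v p q) (hw : Nbrs₃ G w v p q) :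
    Good G := by
  have hvd := hv.deg
  have hvu : G.Adj v u := (hv.2 u).2 (by simp)
  have hup : G.Adj u p := (hu.2.2.2 p).2 (by simp)
  have huq : G.Adj u q := (hu.2.2.2 q).2 (by simp)
  have hwp : G.Adj w p := (hw.2.2.2 p).2 (by simp)
  have hwq : G.Adj w q := (hw.2.2.2 q).2 (by simp)
  obtain ⟨p', hp'⟩ := exists_nbrs_subset₂ hG hup.symm hwp.symm hv.1
  obtain ⟨q', hq'⟩ := exists_nbrs_subset₂ hG huq.symm hwq.symm hv.1
  obtain ⟨d1, hv⟩ := hv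
  obtain ⟨d2, d3, d4, hu⟩ := hu
  obtain ⟨d5, d6, d7, hw⟩ := hw
  have e1 := hup.ne
  have e2 := huq.ne
  have e3 := hwp.ne
  have e4 := hwq.ne
  have e5 := hvu.ne
  have e6 : v ≠ w := ((hv w).2 (by simp)).ne
  refine good_of_list hG hl ih hok (v := v) u w p q p' q' u (by omega) hup hwq ?_ ?_ ?_
  · simp; grind
  · simp; grind
  · intro x hx h
    have h1 := hp' x
    have h2 := hq' x
    simp only [hv, hu, hw, List.mem_cons, List.not_mem_nil, or_false] at h ⊢
    grind

theorem good_of_two_two {p q : V} (hu : Nbrs₃ G u v p q) (hw : Nbrs₂ G w v p) : Good G := by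
  have hvd := hv.deg
  have hwd := hw.deg
  have hvu : G.Adj v u := (hv.2 u).2 (by simp)
  have hvw : G.Adj v w := (hv.2 w).2 (by simp)
  have hup : G.Adj u p := (hu.2.2.2 p).2 (by simp)
  have huq : G.Adj u q := (hu.2.2.2 q).2 (by simp)
  have hwp : G.Adj w p := (hw.2 p).2 (by simp)
  obtain ⟨p', hp'⟩ := exists_nbrs_subset₂ hG hup.symm hwp.symm hv.1
  obtain ⟨q₁, q₂, hq'⟩ := exists_nbrs_subset hG huq.symm
  obtain ⟨d1, hv⟩ := hv
  obtain ⟨d2, d3, d4, hu⟩ := hu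
  obtain ⟨d5, hw⟩ := hw
  have e1 := hup.ne
  have e2 := huq.ne
  have e3 := hwp.ne
  have e5 := hvu.ne
  have e6 := hvw.ne
  have e7 : q ≠ w := by
    rintro rfl
    have := (hw u).1 huq.symm
    grind
  refine good_of_list hG hl ih hok (v := v) u q p p' q₁ q₂ u (by omega) huq hwp ?_ ?_ ?_
  · simp; grind
  · simp; grind
  · intro x hx h
    have h1 := hp' x
    have h2 := hq' x
    simp only [hv, hu, hw, List.mem_cons, List.not_mem_nil, or_false] at h ⊢
    grind

theorem good_of_common_two {c b t : V} (huw : ¬ G.Adj u w) (hu : Nbrs₃ G u v c b)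
    (hw : Nbrs₃ G w v c t) (hc : deg G c = 2) : Good G := by
  have hvd := hv.deg
  have hvu : G.Adj v u := (hv.2 u).2 (by simp)
  have hvw : G.Adj v w := (hv.2 w).2 (by simp)
  have huc : G.Adj u c := (hu.2.2.2 c).2 (by simp)
  have hub : G.Adj u b := (hu.2.2.2 b).2 (by simp)
  have hwc : G.Adj w c := (hw.2.2.2 c).2 (by simp)
  obtain ⟨c', hc1, hc'⟩ := exists_of_deg_two hc huc.symm
  have hcw := (hc' w).1 hwc.symm
  obtain ⟨b₁, b₂, hb'⟩ := exists_nbrs_subset hG hub.symm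
  obtain ⟨d1, hv⟩ := hv
  obtain ⟨d2, d3, d4, hu⟩ := hu
  obtain ⟨d5, d6, d7, hw⟩ := hw
  have e1 := huc.ne
  have e2 := hub.ne
  have e3 := hwc.ne
  have e5 := hvu.ne
  have e6 := hvw.ne
  have e7 : b ≠ w := by
    rintro rfl
    exact huw hub
  refine good_of_list hG hl ih hok (v := v) u b w t b₁ b₂ u (by omega) hub hwc ?_ ?_ ?_
  · simp; grind
  · simp; grind
  · intro x hx h
    have h2 := hb' x
    simp only [hv, hu, hw, hc', List.mem_cons, List.not_mem_nil, or_false] at h ⊢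
    grind

omit hv in
-- The missed vertex is moved into the diamond: `q` is missed, with `up` and `zr` matched, if `z`
-- has a third neighbour `r`. If `z` has degree 2, then `z` is missed and `pq` matched.
theorem good_of_diamond {p q z : V} (hvd : deg G v = 2) (hu : Nbrs₃ G u v p q)
    (hp : Nbrs₃ G p u q z) (hq : Nbrs₃ G q u p z) : Good G := by
  have hup : G.Adj u p := (hu.2.2.2 p).2 (by simp)
  have hpz : G.Adj p z := (hp.2.2.2 z).2 (by simp)
  have hpq : G.Adj p q := (hp.2.2.2 q).2 (by simp)
  have hqz : G.Adj q z := (hq.2.2.2 z).2 (by simp)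
  have hqd := hq.deg
  have e1 := hup.ne
  have e2 := hpz.ne
  have e3 := hpq.ne
  have e4 := hqz.ne
  obtain ⟨d2, d3, d4, hu⟩ := hu
  obtain ⟨d5, d6, d7, hp⟩ := hp
  obtain ⟨d8, d9, d10, hq⟩ := hq
  by_cases hz3 : deg G z = 3
  · obtain ⟨r, f1, f2, hz⟩ := exists_of_deg_three₂ hz3 hpz.symm hqz.symm e3
    have hzr : G.Adj z r := (hz r).2 (by simp)
    have e5 := hzr.ne
    obtain ⟨r₁, r₂, hr⟩ := exists_nbrs_subset hG hzr.symm
    have e6 : u ≠ r := by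
      rintro rfl
      have := (hu z).1 hzr.symm
      grind
    refine good_of_list hG hl ih hok (v := q) u p q z r r₁ r₂ (by omega) hup hzr ?_ ?_ ?_
    · simp; grind
    · simp; grind
    · intro x hx h
      have h2 := hr x
      simp only [hu, hp, hq, hz, List.mem_cons, List.not_mem_nil, or_false] at h ⊢
      grind
  · have hz0 := deg_ne_zero_of_adj hpz.symm
    have hz1 := hG z
    have hz2 := hl z
    obtain ⟨q', f1, hz⟩ := exists_of_deg_two (by omega : deg G z = 2) hpz.symm
    have hzq := (hz q).1 hqz.symm
    refine good_of_pm3 (T := {u, p, q, u, u, u, u}) hG hl ih (ok_del hG hok {z, p, q})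
      (by omega) hpq e2.symm e4.symm ?_ ?_ (card_le_seven ..)
    · grind
    · intro x hx h
      simp only [hp, hq, hz, Finset.mem_insert, Finset.mem_singleton] at h ⊢
      grind

end Local

/-! ### The reduction that joins `q` and `c` -/

section Reduce

variable {V : Type*} [Fintype V] [DecidableEq V] {G H : SimpleGraph V}

theorem deg_le_of_swap {v c u : V} (h : ∀ x, H.Adj v x → x = c ∨ G.Adj v x ∧ x ≠ u)
    (hu : G.Adj v u) : deg H v ≤ deg G v := by
  have h1 : G.neighborSet v \ {u} ⊆ G.neighborSet v := Set.sdiff_subset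
  have h2 := Set.ncard_sdiff_singleton_add_one (s := G.neighborSet v) (a := u) hu
  have h3 : deg H v ≤ (insert c (G.neighborSet v \ {u})).ncard :=
    Set.ncard_le_ncard fun x hx => by simpa using h x hx
  have h4 := Set.ncard_insert_le c (G.neighborSet v \ {u})
  unfold deg at *
  omega

theorem deg_lt_of_swap {v c u p : V} (h : ∀ x, H.Adj v x → x = c ∨ G.Adj v x ∧ x ≠ u ∧ x ≠ p)
    (hu : G.Adj v u) (hp : G.Adj v p) (hup : u ≠ p) : deg H v < deg G v := by
  have h2 := Set.ncard_sdiff_singleton_add_one (s := G.neighborSet v) (a := u) hu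
  have h2' := Set.ncard_sdiff_singleton_add_one (s := G.neighborSet v \ {u}) (a := p)
    ⟨hp, hup.symm⟩
  have h3 : deg H v ≤ (insert c ((G.neighborSet v \ {u}) \ {p})).ncard :=
    Set.ncard_le_ncard fun x hx => by simpa [and_assoc] using h x hx
  have h4 := Set.ncard_insert_le c ((G.neighborSet v \ {u}) \ {p})
  unfold deg at *
  omega

theorem deg_eq_of_swap {v c u : V} (h : ∀ x, H.Adj v x ↔ x = c ∨ G.Adj v x ∧ x ≠ u)
    (hu : G.Adj v u) (hc : ¬ G.Adj v c) : deg H v = deg G v := by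
  have h2 := Set.ncard_sdiff_singleton_add_one (s := G.neighborSet v) (a := u) hu
  have h3 : H.neighborSet v = insert c (G.neighborSet v \ {u}) := by
    ext x
    simpa using h x
  have h4 := Set.ncard_insert_of_notMem (a := c) (s := G.neighborSet v \ {u}) fun hh => hc hh.1
  unfold deg at *
  rw [h3, h4, h2]

/-- The vertices that are cubic in `G` but not in `H` belong to `T`. -/
def Lost (G H : SimpleGraph V) (T : Finset V) : Prop := ∀ x, deg G x = 3 → deg H x ≠ 3 → x ∈ T

/-- `H` arises from `G` by isolating `u` and `p`, and admissible sets lift from `H` to `G`. -/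
structure IsStep (G H : SimpleGraph V) (u p : V) : Prop where
  ne : u ≠ p
  deg_left : deg H u = 0
  deg_right : deg H p = 0
  deg_le : ∀ x, deg H x ≤ deg G x
  lift : ∀ U, Adm H U → Adm G (U \ {u, p})

theorem isStep_del {u p : V} (h : G.Adj u p) : IsStep G (del G {u, p}) u p where
  ne := h.ne
  deg_left := deg_del_eq_zero (by simp)
  deg_right := deg_del_eq_zero (by simp)
  deg_le := deg_del_le G _
  lift _ hU := (adm_of_pair h hU).2.2

/-- The configuration in which `u` and `p` are removed and `q`, `c` joined. -/
structure IsRed (G : SimpleGraph V) (u p q c k : V) : Prop where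
  nbrs_left : Nbrs₂ G u q p
  nbrs_right : Nbrs₃ G p u c k
  ne : c ≠ q
  not_adj : ¬ G.Adj q c

variable {u p q c k : V}

theorem IsRed.adj_iff (h : IsRed G u p q c k) (x y : V) :
    (red G {u, p} q c).Adj x y ↔ (G.Adj x y ∧ x ≠ u ∧ x ≠ p ∧ y ≠ u ∧ y ≠ p) ∨
      (x = q ∧ y = c) ∨ (x = c ∧ y = q) := by
  rw [red_adj _ _ h.ne.symm]
  simp only [Finset.mem_insert, Finset.mem_singleton]
  tauto

theorem IsRed.deg_zero (h : IsRed G u p q c k) :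
    deg (red G {u, p} q c) u = 0 ∧ deg (red G {u, p} q c) p = 0 := by
  have huq : G.Adj u q := (h.nbrs_left.2 q).2 (by simp)
  have hpc : G.Adj p c := (h.nbrs_right.2.2.2 c).2 (by simp)
  have h1 := huq.ne
  have h2 := hpc.ne
  have h3 := h.nbrs_right.1
  have h4 := h.nbrs_left.1
  constructor <;> refine deg_eq_zero.2 fun y => ?_ <;> rw [h.adj_iff] <;> tauto

theorem IsRed.deg_le (h : IsRed G u p q c k) (x : V) : deg (red G {u, p} q c) x ≤ deg G x := by
  have huq : G.Adj u q := (h.nbrs_left.2 q).2 (by simp)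
  have hpc : G.Adj p c := (h.nbrs_right.2.2.2 c).2 (by simp)
  by_cases hq : x = q
  · subst hq
    refine deg_le_of_swap (c := c) (u := u) (fun y hy => ?_) huq.symm
    have := h.ne
    rw [h.adj_iff] at hy
    tauto
  by_cases hc : x = c
  · subst hc
    refine deg_le_of_swap (c := q) (u := p) (fun y hy => ?_) hpc.symm
    rw [h.adj_iff] at hy
    tauto
  · refine deg_le_deg fun y hy => ?_
    rw [h.adj_iff] at hy
    tauto

/-- The vertex `k` loses `p` without compensation. If `k = q`, it loses both `u` and `p` and gains
only `c`. -/
theorem IsRed.deg_lt (h : IsRed G u p q c k) : deg (red G {u, p} q c) k < deg G k := by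
  have huq : G.Adj u q := (h.nbrs_left.2 q).2 (by simp)
  have hup : G.Adj u p := (h.nbrs_left.2 p).2 (by simp)
  have hpk : G.Adj p k := (h.nbrs_right.2.2.2 k).2 (by simp)
  have hck := h.nbrs_right.2.2.1
  by_cases hq : k = q
  · subst hq
    refine deg_lt_of_swap (c := c) (u := u) (p := p) (fun y hy => ?_) huq.symm hpk.symm hup.ne
    rw [h.adj_iff] at hy
    tauto
  · refine deg_lt_deg (y := p) (fun y hy => ?_) hpk.symm fun hh => ?_
    · rw [h.adj_iff] at hy
      tauto
    · rw [h.adj_iff] at hh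
      have := h.nbrs_left.1
      have := (h.nbrs_right.2.2.2 c).2 (by simp)
      have := this.ne
      tauto

/-- The end `q` trades `u` for `c`, and `c` trades `p` for `q`; `u` has degree 2 and was never
cubic. -/
theorem IsRed.lost (h : IsRed G u p q c k) : Lost G (red G {u, p} q c) {p, k} := by
  intro x hx hx'
  have huq : G.Adj u q := (h.nbrs_left.2 q).2 (by simp)
  have hpc : G.Adj p c := (h.nbrs_right.2.2.2 c).2 (by simp)
  by_contra hcon
  simp only [Finset.mem_insert, Finset.mem_singleton, not_or] at hcon
  obtain ⟨hxp, hxk⟩ := hcon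
  have hxu : x ≠ u := by
    rintro rfl
    have := h.nbrs_left.deg
    omega
  have hnu : x ≠ q → ¬ G.Adj x u := fun hq hh =>
    ((h.nbrs_left.2 x).1 hh.symm).elim hq hxp
  have hnp : x ≠ c → ¬ G.Adj x p := fun hc hh =>
    ((h.nbrs_right.2.2.2 x).1 hh.symm).elim hxu (fun h => h.elim hc hxk)
  have hqc := h.ne
  refine hx' (hx ▸ ?_)
  by_cases hq : x = q
  · have hxc : x ≠ c := hq.trans_ne hqc.symm
    have hnp' := hnp hxc
    subst hq
    refine deg_eq_of_swap (c := c) (u := u) (fun y => ?_) huq.symm h.not_adj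
    rw [h.adj_iff]
    clear h
    grind
  have hnu' := hnu hq
  by_cases hc : x = c
  · subst hc
    refine deg_eq_of_swap (c := q) (u := p) (fun y => ?_) hpc.symm fun hh => h.not_adj hh.symm
    rw [h.adj_iff]
    clear h
    grind
  · have hnp' := hnp hc
    refine deg_eq_deg fun y => ?_
    rw [h.adj_iff]
    clear h
    grind

theorem IsRed.isStep (h : IsRed G u p q c k) : IsStep G (red G {u, p} q c) u p where
  ne := ((h.nbrs_left.2 p).2 (by simp)).ne
  deg_left := h.deg_zero.1
  deg_right := h.deg_zero.2
  deg_le := h.deg_le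
  lift _ hU := (adm_of_red ((h.nbrs_left.2 p).2 (by simp)) ((h.nbrs_left.2 q).2 (by simp))
    ((h.nbrs_right.2.2.2 c).2 (by simp)) h.nbrs_left.1 h.nbrs_right.1.symm h.ne.symm hU).2.2

/-- The neighbours of `p` other than `u` offer no partner for `q`. -/
def Blocked (G : SimpleGraph V) (u q p : V) : Prop :=
  ∀ c, G.Adj p c → c ≠ u → c = q ∨ G.Adj q c

/-- Of the boundary vertices, `k` drops to degree at most 2 and serves itself. Only `q` and `c` can
keep full degree, and they are adjacent, so one witness for `q` is enough. -/
theorem IsRed.okAvoid (h : IsRed G u p q c k) (hG : Subcub G) {E : Finset V} (hE : OkAvoid E G)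
    (hEu : u ∉ E) (hEp : p ∉ E) (hEk : k ∉ E)
    (hq : ∃ y, (red G {u, p} q c).Reachable q y ∧ deg G y ≤ 2 ∧ y ∉ E ∨
      (red G {u, p} q c).Reachable q k) : OkAvoid E (red G {u, p} q c) := by
  have hk2 : deg (red G {u, p} q c) k ≤ 2 := by
    have h1 := h.deg_lt
    have h2 := hG k
    omega
  have hq' : ∃ y, (red G {u, p} q c).Reachable q y ∧ deg (red G {u, p} q c) y ≤ 2 ∧ y ∉ E := by
    obtain ⟨y, hy | hy⟩ := hq
    · exact ⟨y, hy.1, (h.deg_le y).trans hy.2.1, hy.2.2⟩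
    · exact ⟨k, hy, hk2, hEk⟩
  have hqc : (red G {u, p} q c).Adj c q := (h.adj_iff _ _).2 (by simp)
  refine okAvoid_of_boundary (S := {u, p}) (by simp [hEu, hEp]) (fun v => ?_) (fun a b ha hb hab => ?_)
    h.deg_le (by simp [h.deg_zero.1, h.deg_zero.2]) ?_
  · obtain ⟨y, h1, h2⟩ := hE v
    exact ⟨y, h1, Or.inl h2⟩
  · rw [red_adj _ _ h.ne.symm]
    exact Or.inl ⟨hab, ha, hb⟩
  · rintro y hy ⟨s, hs, hys⟩
    simp only [Finset.mem_insert, Finset.mem_singleton, not_or] at hs hy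
    have h1 : y = q ∨ y = c ∨ y = k := by
      rcases hs with rfl | rfl
      · have := (h.nbrs_left.2 y).1 hys.symm
        tauto
      · have := (h.nbrs_right.2.2.2 y).1 hys.symm
        tauto
    rcases h1 with rfl | rfl | rfl
    · exact hq'
    · obtain ⟨z, hz⟩ := hq'
      exact ⟨z, hqc.reachable.trans hz.1, hz.2⟩
    · exact ⟨y, .refl _, hk2, hEk⟩

/-- Choose `c` among `c₁`, `c₂` so that the unused one, whose degree drops, lies in the component of
the new edge. This is impossible only when `q`, `c₁`, `c₂` are pairwise separated; then `hr`
supplies a low-degree vertex on one of the three sides, and `c` is chosen to connect `q` to it. -/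
theorem exists_isRed (hG : Subcub G) {c₁ c₂ : V} (hu : Nbrs₂ G u q p) (hp : Nbrs₃ G p u c₁ c₂)
    (hb : ¬ Blocked G u q p) {E : Finset V} (hE : OkAvoid E G)
    (hEu : u ∉ E) (hEp : p ∉ E) (hE₁ : c₁ ∉ E) (hE₂ : c₂ ∉ E)
    (hr : ¬ (del G {u, p}).Reachable q c₁ → ¬ (del G {u, p}).Reachable q c₂ →
      ¬ (del G {u, p}).Reachable c₁ c₂ → ∃ y, deg G y ≤ 2 ∧ y ∉ E ∧
        ((del G {u, p}).Reachable q y ∨ (del G {u, p}).Reachable c₁ y ∨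
          (del G {u, p}).Reachable c₂ y)) :
    ∃ c k, IsRed G u p q c k ∧ OkAvoid E (red G {u, p} q c) := by
  have hle : ∀ c, del G {u, p} ≤ red G {u, p} q c := fun c => le_sup_left
  have hmono : ∀ c {x y}, (del G {u, p}).Reachable x y → (red G {u, p} q c).Reachable x y :=
    fun c x y h => h.mono (hle c)
  have huq : G.Adj u q := (hu.2 q).2 (by simp)
  have hpc₁ : G.Adj p c₁ := (hp.2.2.2 _).2 (by simp)
  have hpc₂ : G.Adj p c₂ := (hp.2.2.2 _).2 (by simp)
  have hadj : ∀ c, c = c₁ ∨ c = c₂ → G.Adj q c → (del G {u, p}).Adj q c := by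
    intro c hc hqc
    have h1 := hpc₁.ne
    have h2 := hpc₂.ne
    have h3 := huq.ne
    have h4 := hu.1
    have h5 := hp.1
    have h6 := hp.2.1
    refine ⟨hqc, by simp; tauto, ?_⟩
    rcases hc with rfl | rfl <;> simp <;> tauto
  have key : ∀ c k, Nbrs₃ G p u c k → c ≠ q → ¬ G.Adj q c → k ∉ E →
      (∃ y, (red G {u, p} q c).Reachable q y ∧ deg G y ≤ 2 ∧ y ∉ E ∨
      (red G {u, p} q c).Reachable q k) →
      ∃ c k, IsRed G u p q c k ∧ OkAvoid E (red G {u, p} q c) := fun c k h1 h2 h3 h4 h5 =>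
    have h : IsRed G u p q c k := ⟨hu, h1, h2, h3⟩
    ⟨c, k, h, h.okAvoid hG hE hEu hEp h4 h5⟩
  have hqc : ∀ c, c ≠ q → (red G {u, p} q c).Reachable q c := fun c hc =>
    SimpleGraph.Adj.reachable ((red_adj _ _ hc.symm _ _).2 (by simp))
  have hb' : (c₁ ≠ q ∧ ¬ G.Adj q c₁) ∨ (c₂ ≠ q ∧ ¬ G.Adj q c₂) := by
    by_contra hcon
    refine hb fun c hc hcu => ?_
    rcases (hp.2.2.2 c).1 hc with rfl | rfl | rfl <;> tauto
  by_cases h1 : (del G {u, p}).Reachable q c₁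
  · by_cases h2 : c₂ ≠ q ∧ ¬ G.Adj q c₂
    · exact key c₂ c₁ hp.swap h2.1 h2.2 hE₁ ⟨q, Or.inr (hmono _ h1)⟩
    · have h3 : (del G {u, p}).Reachable q c₂ := by
        by_cases h4 : c₂ = q
        · rw [h4]
        · exact (hadj c₂ (by simp) (by tauto)).reachable
      have h5 := hb'.resolve_right h2
      exact key c₁ c₂ hp h5.1 h5.2 hE₂ ⟨q, Or.inr (hmono _ h3)⟩
  have h1q : c₁ ≠ q := by rintro rfl; exact h1 (.refl _)
  have h1a : ¬ G.Adj q c₁ := fun hh => h1 (hadj c₁ (by simp) hh).reachable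
  by_cases h2 : (del G {u, p}).Reachable q c₂
  · exact key c₁ c₂ hp h1q h1a hE₂ ⟨q, Or.inr (hmono _ h2)⟩
  have h2q : c₂ ≠ q := by rintro rfl; exact h2 (.refl _)
  have h2a : ¬ G.Adj q c₂ := fun hh => h2 (hadj c₂ (by simp) hh).reachable
  by_cases h3 : (del G {u, p}).Reachable c₁ c₂
  · exact key c₁ c₂ hp h1q h1a hE₂ ⟨q, Or.inr ((hqc _ h1q).trans (hmono _ h3))⟩
  obtain ⟨y, hy2, hyE, hy | hy | hy⟩ := hr h1 h2 h3
  · exact key c₁ c₂ hp h1q h1a hE₂ ⟨y, Or.inl ⟨hmono _ hy, hy2, hyE⟩⟩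
  · exact key c₁ c₂ hp h1q h1a hE₂ ⟨y, Or.inl ⟨(hqc _ h1q).trans (hmono _ hy), hy2, hyE⟩⟩
  · exact key c₂ c₁ hp.swap h2q h2a hE₁ ⟨y, Or.inl ⟨(hqc _ h2q).trans (hmono _ hy), hy2, hyE⟩⟩

end Reduce

/-! ### Twins `p`, `q` with common neighbours `u`, `a`, `b`: the generic reduction -/

section Gadget

variable {V : Type*} [Fintype V] [DecidableEq V] {G H : SimpleGraph V}

/-- Either the new edge is unused, or its ends may be freed. -/
theorem adm_red_cases {S U : Finset V} {q c : V} (hqc : q ≠ c) (hU : Adm (red G S q c) U) :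
    (Adm (del G S) U ∧ ¬ (q ∈ U ∧ c ∈ U)) ∨ (q ∉ U ∧ c ∉ U ∧
      Adm (del G (S ∪ {q, c})) (insert q (insert c U))) := by
  obtain ⟨hi, f, hf⟩ := hU
  have hnot : ¬ (q ∈ U ∧ c ∈ U) := fun h => hi q h.1 c h.2 ((red_adj _ _ hqc _ _).2 (by simp))
  have hi' : ∀ a ∈ U, ∀ b ∈ U, ¬ (del G S).Adj a b := fun a ha b hb hab =>
    hi a ha b hb ((red_adj _ _ hqc _ _).2 (Or.inl hab))
  simp only [red_adj _ _ hqc] at hf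
  by_cases h : q ∉ U ∧ f q = c
  · have hc := (hf q h.1).2
    rw [h.2] at hc
    refine Or.inr ⟨h.1, hc.1, ?_, f, ?_⟩
    · intro a ha b hb hab
      simp only [Finset.mem_insert, del_adj, Finset.mem_union, Finset.mem_singleton,
        not_or] at ha hb hab
      exact hi' a (by tauto) b (by tauto) ⟨hab.1, hab.2.1.1, hab.2.2.1⟩
    · intro x hx
      simp only [Finset.mem_insert, del_adj, Finset.mem_union, Finset.mem_singleton,
        not_or] at hx ⊢
      have := hf x hx.2.2
      grind
  · refine Or.inl ⟨⟨hi', f, fun x hx => ?_⟩, hnot⟩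
    have h1 := hf x hx
    rw [del_adj]
    grind

theorem adm_of_pair_of_eq {S S' U : Finset V} {u x : V} (hux : G.Adj u x) (hu : u ∉ S) (hx : x ∉ S)
    (hS : S' = S ∪ {u, x}) (hU : Adm (del G S') U) :
    u ∈ U ∧ x ∈ U ∧ Adm (del G S) (U \ {u, x}) ∧ (U \ {u, x}).card + 2 = U.card := by
  have e : del G S' = del (del G S) {u, x} := by rw [del_del, hS]
  obtain ⟨h1, h2, h3⟩ := adm_of_pair (G := del G S) ⟨hux, hu, hx⟩ (e ▸ hU)
  exact ⟨h1, h2, h3, card_of_pair hux.ne h1 h2⟩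

variable {v u w p q a b r : V}

/-- An admissible set lifts along the reduction of the gadget formed by `u, p, q, a, b`. -/
theorem exists_adm_of_gadget (hvu : G.Adj v u) (hu : Nbrs₃ G u v p q) (hp : Nbrs₃ G p u a b)
    (hq : Nbrs₃ G q u a b) (ha : Nbrs₃ G a p q r) (hva : v ≠ a) (hvb : v ≠ b) (hru : r ≠ u)
    (hrb : r ≠ b) (hrv : r ≠ v)
    {U' : Finset V} (hU' : Adm (red G {u, p, q, a, b} v r) U') :
    ∃ U, Adm G U ∧ U.card + 4 = U'.card := by
  have e1 : G.Adj u p := (hu.2.2.2 p).2 (by simp)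
  have e2 : G.Adj u q := (hu.2.2.2 q).2 (by simp)
  have e3 : G.Adj p a := (hp.2.2.2 a).2 (by simp)
  have e4 : G.Adj p b := (hp.2.2.2 b).2 (by simp)
  have e5 : G.Adj q a := (hq.2.2.2 a).2 (by simp)
  have e6 : G.Adj q b := (hq.2.2.2 b).2 (by simp)
  have e7 : G.Adj a r := (ha.2.2.2 r).2 (by simp)
  obtain ⟨d2, d3, d4, hu⟩ := hu
  obtain ⟨d5, d6, d7, hp⟩ := hp
  obtain ⟨d8, d9, d10, hq⟩ := hq
  obtain ⟨d11, d12, d13, ha⟩ := ha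
  have n1 := e1.ne
  have n2 := e2.ne
  have n3 := e3.ne
  have n4 := e4.ne
  have n5 := e5.ne
  have n6 := e6.ne
  have n7 := e7.ne
  have n8 := hvu.ne
  -- Exactly one gadget vertex is left missed: `a` if `v` is missed (then `r` is covered), `u` if
  -- `v` is covered and `vr` is unused, and `q` if `vr` is used, with `ar`, `vu`, `pb` matched in
  -- its place.
  rcases adm_red_cases hrv.symm hU' with ⟨h, hvr⟩ | ⟨h1, h2, h⟩
  · by_cases hvU : v ∈ U'
    · have hrU : r ∉ U' := fun hr => hvr ⟨hvU, hr⟩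
      obtain ⟨-, -, h5, h6⟩ := adm_of_pair_of_eq (S := {a, u, p}) e6 (by grind) (by grind)
        (by grind) h
      obtain ⟨-, -, h7, h8⟩ := adm_of_pair_of_eq (S := {a}) e1 (by grind) (by grind)
        (by grind) h5
      refine ⟨_, adm_of_iso h7 fun x hx => ?_, by omega⟩
      rcases (ha x).1 hx with rfl | rfl | rfl <;> simp [hrU]
    · obtain ⟨-, -, h5, h6⟩ := adm_of_pair_of_eq (S := {u, p, a}) e6 (by grind) (by grind)
        (by grind) h
      obtain ⟨-, -, h7, h8⟩ := adm_of_pair_of_eq (S := {u}) e3 (by grind) (by grind)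
        (by grind) h5
      refine ⟨_, adm_of_iso h7 fun x hx => ?_, by omega⟩
      rcases (hu x).1 hx with rfl | rfl | rfl <;> simp [hvU]
  · obtain ⟨-, -, h5, h6⟩ := adm_of_pair_of_eq (S := {q, v, u, p, b}) e7 (by grind) (by grind)
      (by grind) h
    obtain ⟨-, -, h7, h8⟩ := adm_of_pair_of_eq (S := {q, p, b}) hvu (by grind) (by grind)
      (by grind) h5
    obtain ⟨-, -, h9, h10⟩ := adm_of_pair_of_eq (S := {q}) e4 (by grind) (by grind)
      (by grind) h7
    rw [Finset.card_insert_of_notMem (by simp [h1, hrv.symm]), Finset.card_insert_of_notMem h2] at h6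
    refine ⟨_, adm_of_iso h9 fun x hx => ?_, by omega⟩
    rcases (hq x).1 hx with rfl | rfl | rfl <;> simp

variable (hG : Subcub G) (hl : ∀ v, deg G v ≠ 1) (ih : Below G) (hok : Ok G)

include hG hl ih hok

/-- All five gadget vertices are isolated and `v` is joined to `r`. Apart from them only `r'` can be
lost, and `v`, still of degree at most 2, is a witness for the component of the new edge. -/
theorem good_of_gadget_aux (hvd : deg G v = 2) (hvu : G.Adj v u) (hu : Nbrs₃ G u v p q)
    (hp : Nbrs₃ G p u a b)
    (hq : Nbrs₃ G q u a b) (ha : Nbrs₃ G a p q r) {r' : V} (hb : Nbrs₃ G b p q r') (hva : v ≠ a)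
    (hvb : v ≠ b) (hru : r ≠ u) (hrb : r ≠ b) (hrv : r ≠ v) (hvr : ¬ G.Adj v r) : Good G := by
  have e1 : G.Adj u p := (hu.2.2.2 p).2 (by simp)
  have e2 : G.Adj u q := (hu.2.2.2 q).2 (by simp)
  have e3 : G.Adj p a := (hp.2.2.2 a).2 (by simp)
  have e4 : G.Adj p b := (hp.2.2.2 b).2 (by simp)
  have e5 : G.Adj q a := (hq.2.2.2 a).2 (by simp)
  have e6 : G.Adj q b := (hq.2.2.2 b).2 (by simp)
  have e7 : G.Adj a r := (ha.2.2.2 r).2 (by simp)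
  have e8 : G.Adj b r' := (hb.2.2.2 r').2 (by simp)
  have hlift := fun U' => exists_adm_of_gadget (U' := U') hvu hu hp hq ha hva hvb hru hrb hrv
  have hud := hu.deg
  have hpd := hp.deg
  have hqd := hq.deg
  have had := ha.deg
  have hbd := hb.deg
  have ha3 := ha.2.2.2
  obtain ⟨d2, d3, d4, hu⟩ := hu
  obtain ⟨d5, d6, d7, hp⟩ := hp
  obtain ⟨-, -, -, hq⟩ := hq
  obtain ⟨-, d12, d13, ha⟩ := ha
  obtain ⟨-, d14, d15, hb⟩ := hb
  have n1 := e1.ne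
  have n2 := e2.ne
  have n3 := e3.ne
  have n4 := e4.ne
  have n5 := e5.ne
  have n6 := e6.ne
  have n7 := e7.ne
  have n8 := hvu.ne
  have hmem : ∀ x, x ∈ ({u, p, q, a, b} : Finset V) ↔ x = u ∨ x = p ∨ x = q ∨ x = a ∨ x = b := by
    simp
  set H := red G {u, p, q, a, b} v r with hH
  have hadj : ∀ x y, H.Adj x y ↔ (G.Adj x y ∧ x ∉ ({u, p, q, a, b} : Finset V) ∧
      y ∉ ({u, p, q, a, b} : Finset V)) ∨ (x = v ∧ y = r) ∨ (x = r ∧ y = v) :=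
    red_adj _ _ hrv.symm
  have hvS : v ∉ ({u, p, q, a, b} : Finset V) := by rw [hmem]; tauto
  have hrS : r ∉ ({u, p, q, a, b} : Finset V) := by
    rw [hmem]
    have := d12.symm
    have := d13.symm
    have := n7.symm
    tauto
  have hSz : ∀ s ∈ ({u, p, q, a, b} : Finset V), deg H s = 0 := fun s hs =>
    deg_eq_zero.2 fun y hy => by
      rcases (hadj s y).1 hy with h | h | h
      · exact h.2.1 hs
      · exact hvS (h.1 ▸ hs)
      · exact hrS (h.1 ▸ hs)
  have hS0 : ∀ s ∈ ({u, p, q, a, b} : Finset V), deg G s ≠ 0 := fun s hs => by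
    rcases (hmem s).1 hs with rfl | rfl | rfl | rfl | rfl <;> omega
  have hnb : ∀ s ∈ ({u, p, q, a, b} : Finset V), ∀ y, y ∉ ({u, p, q, a, b} : Finset V) →
      G.Adj s y → (s = u ∧ y = v) ∨ (s = a ∧ y = r) ∨ (s = b ∧ y = r') := by
    intro s hs y hy hsy
    rw [hmem, not_or, not_or, not_or, not_or] at hy
    rcases (hmem s).1 hs with rfl | rfl | rfl | rfl | rfl
    · have := (hu y).1 hsy; tauto
    · have := (hp y).1 hsy; tauto
    · have := (hq y).1 hsy; tauto
    · have := (ha y).1 hsy; tauto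
    · have := (hb y).1 hsy; tauto
  have hdeg : ∀ x, deg H x ≤ deg G x := by
    intro x
    by_cases hxv : x = v
    · subst hxv
      refine deg_le_of_swap (c := r) (u := u) (fun y hy => ?_) hvu
      rcases (hadj _ _).1 hy with h | h | h
      · exact Or.inr ⟨h.1, fun hh => h.2.2 (by simp [hh])⟩
      · exact Or.inl h.2
      · exact absurd h.1.symm hrv
    by_cases hxr : x = r
    · subst hxr
      refine deg_le_of_swap (c := v) (u := a) (fun y hy => ?_) e7.symm
      rcases (hadj _ _).1 hy with h | h | h
      · exact Or.inr ⟨h.1, fun hh => h.2.2 (by simp [hh])⟩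
      · exact absurd h.1 hxv
      · exact Or.inl h.2
    · refine deg_le_deg fun y hy => ?_
      rcases (hadj _ _).1 hy with h | h | h
      · exact h.1
      · exact absurd h.1 hxv
      · exact absurd h.1 hxr
  have hokH : Ok H := by
    rw [← okAvoid_empty]
    have hv2 : deg H v ≤ 2 := hvd ▸ hdeg v
    have hrv' : H.Adj r v := (hadj _ _).2 (by simp)
    refine okAvoid_of_boundary (G := G) (S := {u, p, q, a, b}) (by simp) (fun v => ?_)
      (fun x y hx hy hxy => (hadj _ _).2 (Or.inl ⟨hxy, hx, hy⟩)) hdeg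
      (fun s hs => by rw [hSz s hs]; omega) ?_
    · obtain ⟨y, h1, h2⟩ := hok v
      exact ⟨y, h1, Or.inl ⟨h2, by simp⟩⟩
    · rintro y hy ⟨s, hs, hys⟩
      rcases hnb s hs y hy hys.symm with ⟨-, rfl⟩ | ⟨-, rfl⟩ | ⟨rfl, rfl⟩
      · exact ⟨y, .refl _, hv2, by simp⟩
      · exact ⟨v, hrv'.reachable, hv2, by simp⟩
      · by_cases hyv : y = v
        · exact ⟨y, .refl _, hyv ▸ hv2, by simp⟩
        by_cases hyr : y = r
        · exact ⟨v, hyr ▸ hrv'.reachable, hv2, by simp⟩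
        · refine ⟨y, .refl _, ?_, by simp⟩
          have h1 := hG y
          have h2 : deg H y < deg G y := deg_lt_deg (y := s) (fun x hx => by
            rcases (hadj _ _).1 hx with h | h | h
            · exact h.1
            · exact absurd h.1 hyv
            · exact absurd h.1 hyr) hys (fun hx => by
            rcases (hadj _ _).1 hx with h | h | h
            · exact h.2.2 hs
            · exact hyv h.1
            · exact hyr h.1)
          omega
  obtain ⟨U', hU', hw'⟩ := ih H (mu_lt (v := u) hdeg (by omega) (hSz u (by simp)))
    (subcub_of_le hG hdeg) hokH
  obtain ⟨U, hU, hUc⟩ := hlift U' hU'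
  have hc : ({u, p, q, a, b} : Finset V).card = 5 := by
    rw [Finset.card_insert_of_notMem (by simp; tauto), Finset.card_insert_of_notMem
      (by simp; tauto), Finset.card_insert_of_notMem (by simp; tauto), Finset.card_pair d7]
  refine good_of_lift (S := {u, p, q, a, b}) (T := {u, p, q, a, b, r', r'}) (U' := U') hG hl hdeg hS0 hSz
    (fun x hx hx' => ?_) ?_ hU (by omega)
  · by_contra hcon
    simp only [Finset.mem_insert, Finset.mem_singleton, not_or] at hcon
    have hxS : x ∉ ({u, p, q, a, b} : Finset V) := by rw [hmem]; tauto
    refine hx' (hx ▸ ?_)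
    have hxv : x ≠ v := by rintro rfl; omega
    have hnx : ∀ s ∈ ({u, p, q, a, b} : Finset V), G.Adj s x → s = a ∧ x = r := fun s hs hsx => by
      rcases hnb s hs x hxS hsx with h | h | h
      · exact absurd h.2 hxv
      · exact h
      · exact absurd h.2 hcon.2.2.2.2.2.1
    by_cases hxr : x = r
    · subst hxr
      refine deg_eq_of_swap (c := v) (u := a) (fun y => ?_) e7.symm fun h => hvr h.symm
      rw [hadj]
      constructor
      · rintro (h | h | h)
        · exact Or.inr ⟨h.1, fun hh => h.2.2 (by simp [hh])⟩
        · exact absurd h.1 hxv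
        · exact Or.inl h.2
      · rintro (rfl | h)
        · exact Or.inr (Or.inr ⟨rfl, rfl⟩)
        · refine Or.inl ⟨h.1, hxS, fun hy => ?_⟩
          exact h.2 (hnx y hy h.1.symm).1
    · refine deg_eq_deg fun y => ?_
      rw [hadj]
      constructor
      · rintro (h | h | h)
        · exact h.1
        · exact absurd h.1 hxv
        · exact absurd h.1 hxr
      · intro h
        refine Or.inl ⟨h, hxS, fun hy => ?_⟩
        exact hxr (hnx y hy h.symm).2
  · have h1 := baseWeight_le_weight H
    have h2 := card_le_seven u p q a b r' r'
    omega

end Gadget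

/-! ### Blocked reductions: degenerate gadgets and the classification -/

section Blocked

variable {V : Type*} [Fintype V] [DecidableEq V] {G H : SimpleGraph V}
variable {v u w p q a b : V}
variable (hG : Subcub G) (hl : ∀ v, deg G v ≠ 1) (ih : Below G) (hok : Ok G)

include hG hl ih hok

theorem good_of_gadget_deg_two (hvd : deg G v = 2) (hu : Nbrs₃ G u v p q) (hp : Nbrs₃ G p u a b)
    (hq : Nbrs₃ G q u a b) (ha : deg G a = 2) : Good G := by
  have e1 : G.Adj u p := (hu.2.2.2 p).2 (by simp)
  have e3 : G.Adj p a := (hp.2.2.2 a).2 (by simp)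
  have e4 : G.Adj p b := (hp.2.2.2 b).2 (by simp)
  have e5 : G.Adj q a := (hq.2.2.2 a).2 (by simp)
  have e6 : G.Adj q b := (hq.2.2.2 b).2 (by simp)
  obtain ⟨q', f1, ha'⟩ := exists_of_deg_two ha e3.symm
  have hqq := (ha' q).1 e5.symm
  obtain ⟨r, hr⟩ := exists_nbrs_subset₂ hG e4.symm e6.symm hu.2.2.1
  obtain ⟨d2, d3, d4, hu⟩ := hu
  obtain ⟨d5, d6, d7, hp⟩ := hp
  obtain ⟨d8, d9, d10, hq⟩ := hq
  have n1 := e1.ne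
  have n3 := e3.ne
  have n4 := e4.ne
  have n5 := e5.ne
  have n6 := e6.ne
  have n2 : u ≠ q := ((hu q).2 (by simp)).ne
  refine good_of_list hG hl ih hok (v := a) p q u b r u u (by omega) e1.symm e6 ?_ ?_ ?_
  · simp; grind
  · simp; grind
  · intro x hx h
    have h2 := hr x
    simp only [hu, hp, hq, ha', List.mem_cons, List.not_mem_nil, or_false] at h ⊢
    grind

theorem good_of_gadget_eq (hv : Nbrs₂ G v u w) (hu : Nbrs₃ G u v p q)
    (hp : Nbrs₃ G p u w b) (hq : Nbrs₃ G q u w b) : Good G := by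
  have e1 : G.Adj u p := (hu.2.2.2 p).2 (by simp)
  have e2 : G.Adj u q := (hu.2.2.2 q).2 (by simp)
  have e3 : G.Adj p w := (hp.2.2.2 w).2 (by simp)
  have e5 : G.Adj q w := (hq.2.2.2 w).2 (by simp)
  have e7 : G.Adj v w := (hv.2 w).2 (by simp)
  have e8 : G.Adj v u := (hv.2 u).2 (by simp)
  have hvd := hv.deg
  have hw := nbrs₃_of_adj hG e7.symm e3.symm e5.symm hu.1 hu.2.1 hu.2.2.1
  obtain ⟨d1, hv⟩ := hv
  obtain ⟨d2, d3, d4, hu⟩ := hu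
  obtain ⟨d5, d6, d7, hp⟩ := hp
  obtain ⟨d8, d9, d10, hq⟩ := hq
  obtain ⟨d11, d12, d13, hw⟩ := hw
  have n1 := e1.ne
  have n2 := e2.ne
  have n3 := e3.ne
  have n5 := e5.ne
  have n7 := e7.ne
  have n8 := e8.ne
  refine good_of_list hG hl ih hok (v := v) u p w q b u u (by omega) e1 e5.symm ?_ ?_ ?_
  · simp; grind
  · simp; grind
  · intro x hx h
    simp only [hu, hp, hq, hv, hw, List.mem_cons, List.not_mem_nil, or_false] at h ⊢
    grind

theorem good_of_gadget_adj (hv : Nbrs₂ G v u w) (hu : Nbrs₃ G u v p q) (huw : ¬ G.Adj u w)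
    (hp : Nbrs₃ G p u a b) (hq : Nbrs₃ G q u a b) (haw : G.Adj a w) : Good G := by
  have e1 : G.Adj u p := (hu.2.2.2 p).2 (by simp)
  have e2 : G.Adj u q := (hu.2.2.2 q).2 (by simp)
  have e3 : G.Adj p a := (hp.2.2.2 a).2 (by simp)
  have e5 : G.Adj q a := (hq.2.2.2 a).2 (by simp)
  have e7 : G.Adj v w := (hv.2 w).2 (by simp)
  have e8 : G.Adj v u := (hv.2 u).2 (by simp)
  have hvd := hv.deg
  have hpw : p ≠ w := by rintro rfl; exact huw e1
  have hqw : q ≠ w := by rintro rfl; exact huw e2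
  have ha := nbrs₃_of_adj hG e3.symm e5.symm haw hu.2.2.1 hpw hqw
  obtain ⟨y, z, hw⟩ := exists_nbrs_subset hG e7.symm
  obtain ⟨d1, hv⟩ := hv
  obtain ⟨d2, d3, d4, hu⟩ := hu
  obtain ⟨d5, d6, d7, hp⟩ := hp
  obtain ⟨d8, d9, d10, hq⟩ := hq
  obtain ⟨-, -, -, ha⟩ := ha
  have n1 := e1.ne
  have n2 := e2.ne
  have n3 := e3.ne
  have n5 := e5.ne
  have n7 := e7.ne
  have n8 := e8.ne
  have n9 := haw.ne
  have n10 : v ≠ a := by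
    rintro rfl
    have := (ha u).1 e8
    grind
  -- One of `y`, `z` is `a`; the conditional picks the other, the possible third neighbour of `w`.
  refine good_of_list hG hl ih hok (v := v) u p w a q b (if y = a then z else y) (by omega) e1
    haw.symm ?_ ?_ ?_
  · simp; grind
  · simp; grind
  · intro x hx h
    have h2 := hw x
    have h3 := hw a haw.symm
    simp only [hu, hp, hv, ha, List.mem_cons, List.not_mem_nil, or_false] at h ⊢
    grind

theorem good_of_gadget_closed (hvd : deg G v = 2) (hu : Nbrs₃ G u v p q)
    (hp : Nbrs₃ G p u a b) (hq : Nbrs₃ G q u a b) (hab : G.Adj a b) : Good G := by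
  have e1 : G.Adj u p := (hu.2.2.2 p).2 (by simp)
  have e2 : G.Adj u q := (hu.2.2.2 q).2 (by simp)
  have e3 : G.Adj p a := (hp.2.2.2 a).2 (by simp)
  have e4 : G.Adj p b := (hp.2.2.2 b).2 (by simp)
  have e5 : G.Adj q a := (hq.2.2.2 a).2 (by simp)
  have e6 : G.Adj q b := (hq.2.2.2 b).2 (by simp)
  have hqd := hq.deg
  have n1 := e1.ne
  have n2 := e2.ne
  have n3 := e3.ne
  have n4 := e4.ne
  have n5 := e5.ne
  have n6 := e6.ne
  have ha := nbrs₃_of_adj hG e3.symm e5.symm hab hu.2.2.1 n4 n6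
  have hb := nbrs₃_of_adj hG e4.symm e6.symm hab.symm hu.2.2.1 n3 n5
  obtain ⟨d2, d3, d4, hu⟩ := hu
  obtain ⟨d5, d6, d7, hp⟩ := hp
  obtain ⟨d8, d9, d10, hq⟩ := hq
  obtain ⟨-, -, -, ha⟩ := ha
  obtain ⟨-, -, -, hb⟩ := hb
  refine good_of_list hG hl ih hok (v := q) u p q a b u u (by omega) e1 hab ?_ ?_ ?_
  · simp; grind
  · simp; grind
  · intro x hx h
    simp only [hu, hp, hq, ha, hb, List.mem_cons, List.not_mem_nil, or_false] at h ⊢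
    grind

/-- The five-vertex reduction needs a genuine outside neighbour `r` of `a` that is neither `v` nor
adjacent to `v`. Each way this can fail is settled by a direct pairing. -/
theorem good_of_gadget (hv : Nbrs₂ G v u w) (huw : ¬ G.Adj u w) (hu : Nbrs₃ G u v p q)
    (hp : Nbrs₃ G p u a b) (hq : Nbrs₃ G q u a b) : Good G := by
  have e1 : G.Adj u p := (hu.2.2.2 p).2 (by simp)
  have e2 : G.Adj u q := (hu.2.2.2 q).2 (by simp)
  have e3 : G.Adj p a := (hp.2.2.2 a).2 (by simp)
  have e4 : G.Adj p b := (hp.2.2.2 b).2 (by simp)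
  have e5 : G.Adj q a := (hq.2.2.2 a).2 (by simp)
  have e6 : G.Adj q b := (hq.2.2.2 b).2 (by simp)
  have e8 : G.Adj v u := (hv.2 u).2 (by simp)
  by_cases hab : G.Adj a b
  · exact good_of_gadget_closed hG hl ih hok hv.deg hu hp hq hab
  by_cases ha2 : deg G a = 2
  · exact good_of_gadget_deg_two hG hl ih hok hv.deg hu hp hq ha2
  by_cases hb2 : deg G b = 2
  · exact good_of_gadget_deg_two hG hl ih hok hv.deg hu hp.swap hq.swap hb2
  by_cases haw : a = w
  · subst haw
    exact good_of_gadget_eq hG hl ih hok hv hu hp hq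
  by_cases hbw : b = w
  · subst hbw
    exact good_of_gadget_eq hG hl ih hok hv hu hp.swap hq.swap
  by_cases haw' : G.Adj a w
  · exact good_of_gadget_adj hG hl ih hok hv hu huw hp hq haw'
  have h3 : ∀ x, G.Adj p x → deg G x ≠ 2 → deg G x = 3 := fun x hx h2 => by
    have := hG x
    have := hl x
    have := deg_ne_zero_of_adj hx.symm
    omega
  obtain ⟨r, f1, f2, ha⟩ := exists_of_deg_three₂ (h3 a e3 ha2) e3.symm e5.symm hu.2.2.1
  obtain ⟨r', f1', f2', hb⟩ := exists_of_deg_three₂ (h3 b e4 hb2) e4.symm e6.symm hu.2.2.1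
  have e7 : G.Adj a r := (ha r).2 (by simp)
  have hva' : ¬ G.Adj v a := fun h => ((hv.2 a).1 h).elim hp.1.symm haw
  have hvb : v ≠ b := by
    rintro rfl
    rcases (hv.2 p).1 e4.symm with rfl | rfl
    · exact G.irrefl e1
    · exact huw e1
  have hva : v ≠ a := by
    rintro rfl
    rcases (hv.2 p).1 e3.symm with rfl | rfl
    · exact G.irrefl e1
    · exact huw e1
  have hru : r ≠ u := by
    rintro rfl
    rcases (hu.2.2.2 a).1 e7.symm with rfl | rfl | rfl
    · exact hva rfl
    · exact G.irrefl e3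
    · exact G.irrefl e5
  have hrb : r ≠ b := by
    rintro rfl
    exact hab e7
  have hrv : r ≠ v := by
    rintro rfl
    exact hva' e7.symm
  have hvr : ¬ G.Adj v r := fun h => by
    rcases (hv.2 r).1 h with rfl | rfl
    · exact hru rfl
    · exact haw' e7
  exact good_of_gadget_aux hG hl ih hok hv.deg e8 hu hp hq ⟨hu.2.2.1, f1, f2, ha⟩
    ⟨hu.2.2.1, f1', f2', hb⟩ hva hvb hru hrb hrv hvr

/-- If `p` and `q` are adjacent they share their third neighbour and form a diamond with it and `u`;
otherwise `q` is adjacent to all neighbours of `p`, and the two are twins. -/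
theorem good_of_blocked (hv : Nbrs₂ G v u w) (huw : ¬ G.Adj u w) (hu : Nbrs₃ G u v q p)
    (hp : deg G p = 3) (hb : Blocked G u q p) : Good G := by
  have e1 : G.Adj u p := (hu.2.2.2 p).2 (by simp)
  have e2 : G.Adj u q := (hu.2.2.2 q).2 (by simp)
  by_cases hpq : G.Adj p q
  · obtain ⟨z, f1, f2, hp'⟩ := exists_of_deg_three₂ hp e1.symm hpq e2.ne
    have hqz := (hb z ((hp' z).2 (by simp)) f1.symm).resolve_left f2.symm
    have hpz : G.Adj p z := (hp' z).2 (by simp)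
    exact good_of_diamond hG hl ih hok hv.deg hu.swap ⟨e2.ne, f1, f2, hp'⟩
      (nbrs₃_of_adj hG e2.symm hpq.symm hqz e1.ne f1 hpz.ne)
  · obtain ⟨a, b, f1, f2, f3, hp'⟩ := exists_of_deg_three hp e1.symm
    have hpa : G.Adj p a := (hp' a).2 (by simp)
    have hpb : G.Adj p b := (hp' b).2 (by simp)
    have hqa := (hb a hpa f1.symm).resolve_left fun h => hpq (h ▸ hpa)
    have hqb := (hb b hpb f2.symm).resolve_left fun h => hpq (h ▸ hpb)
    exact good_of_gadget hG hl ih hok hv huw hu.swap ⟨f1, f2, f3, hp'⟩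
      (nbrs₃_of_adj hG e2.symm hqa hqb f1 f2 f3)

end Blocked

/-! ### Two consecutive steps, and bridges as the only obstruction to connectivity -/

section Sides

variable {V : Type*} [Fintype V] [DecidableEq V] {G H : SimpleGraph V}

theorem okAvoid_del (hG : Subcub G) {E S : Finset V} (hES : ∀ s ∈ S, s ∉ E)
    (hr : ∀ v, ∃ y, G.Reachable v y ∧ (deg G y ≤ 2 ∧ y ∉ E ∨ y ∈ S))
    (hb : ∀ y ∈ E, (∃ s ∈ S, G.Adj y s) →
      ∃ z, (del G S).Reachable y z ∧ deg (del G S) z ≤ 2 ∧ z ∉ E) : OkAvoid E (del G S) := by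
  refine okAvoid_of_boundary hES hr (fun a b ha hb hab => ⟨hab, ha, hb⟩) (deg_del_le G S)
    (fun s hs => by rw [deg_del_eq_zero hs]; omega) fun y hy hys => ?_
  by_cases hyE : y ∈ E
  · exact hb y hyE hys
  · obtain ⟨s, hs, hys⟩ := hys
    have h1 := deg_del_lt hs hys
    have h2 := hG y
    exact ⟨y, .refl _, by omega, hyE⟩

theorem notMem_of_reachable_del {S : Finset V} {b y : V} (hb : b ∉ S)
    (h : (del G S).Reachable b y) : y ∉ S := by
  obtain ⟨p⟩ := h.symm
  cases p with
  | nil => exact hb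
  | cons h _ => exact h.2.1

/-- Cut the walk where it leaves `S` for the last time. -/
theorem exists_reachable_del {S : Finset V} {v y : V} (h : G.Reachable v y) (hv : v ∈ S)
    (hy : y ∉ S) : ∃ s ∈ S, ∃ z, G.Adj s z ∧ z ∉ S ∧ (del G S).Reachable z y := by
  have key : ∀ {v y : V}, y ∉ S → G.Walk v y → (v ∉ S ∧ (del G S).Reachable v y) ∨
      ∃ s ∈ S, ∃ z, G.Adj s z ∧ z ∉ S ∧ (del G S).Reachable z y := by
    intro v y hy p
    induction p with
    | nil => exact Or.inl ⟨hy, .refl _⟩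
    | cons hab p ih =>
      rename_i a b c
      rcases ih hy with ⟨h1, h2⟩ | h1
      · by_cases ha : a ∈ S
        · exact Or.inr ⟨a, ha, b, hab, h1, h2⟩
        · have hab' : (del G S).Adj a b := ⟨hab, ha, h1⟩
          exact Or.inl ⟨ha, hab'.reachable.trans h2⟩
      · exact Or.inr h1
  obtain ⟨p⟩ := h
  exact (key hy p).resolve_left fun hh => hh.1 hv

/-- If no such `y` exists, the component of `b` after deleting `S` consists of vertices cubic in
`G`. None of them but `b` can touch `S`, since that would cost degree, so `ab` is a bridge with a
cubic side. -/
theorem good_or_exists_reachable (hG : Subcub G) (hl : ∀ v, deg G v ≠ 1) (ih : Below G)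
    {S : Finset V} {a b : V} (hr : ∀ v, ∃ y, G.Reachable v y ∧ (deg G y ≤ 2 ∨ y = b))
    (hb : b ∉ S) (ha : a ∈ S) (hab : G.Adj b a) (hS : ∀ s ∈ S, G.Adj b s → s = a)
    (hb3 : deg G b = 3) :
    Good G ∨ ∃ y, (del G S).Reachable b y ∧ deg (del G S) y ≤ 2 ∧ y ≠ b := by
  classical
  by_contra hcon
  push Not at hcon
  obtain ⟨hgood, hcon⟩ := hcon
  set Y : Finset V := Finset.univ.filter fun y => (del G S).Reachable b y with hY
  have hmem : ∀ y, y ∈ Y ↔ (del G S).Reachable b y := by simp [hY]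
  have h3 : ∀ y ∈ Y, y ≠ b → deg (del G S) y = 3 := by
    intro y hy hyb
    by_contra h
    have h1 := (deg_del_le G S y).trans (hG y)
    exact hyb (hcon y ((hmem y).1 hy) (by omega))
  refine hgood (IsBridgeSide.good (Y := Y) (a := a) (b := b) hG hl ih hr (fun y hy => ?_)
    ⟨(hmem b).2 (.refl _), fun h => notMem_of_reachable_del hb ((hmem a).1 h) ha, hab.symm, ?_⟩)
  · by_cases hyb : y = b
    · rw [hyb, hb3]
    · have h1 := h3 y hy hyb
      have h2 := deg_del_le G S y
      have := hG y
      omega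
  · intro y hy x hx hyx
    have hyS := notMem_of_reachable_del hb ((hmem y).1 hy)
    have hxS : x ∈ S := by
      by_contra hxS
      have h : (del G S).Adj y x := ⟨hyx, hyS, hxS⟩
      exact hx ((hmem x).2 (((hmem y).1 hy).trans h.reachable))
    have hyb : y = b := by
      by_contra hyb
      have h1 := deg_del_lt hxS hyx
      have h2 := h3 y hy hyb
      have := hG y
      omega
    subst hyb
    exact ⟨rfl, hS x hxS hyx⟩

theorem Nbrs₃.del {v u q p : V} (h : Nbrs₃ G u v q p) : Nbrs₂ (del G {v}) u q p := by
  obtain ⟨h1, h2, h3, h4⟩ := h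
  have huv := ((h4 v).2 (by simp)).ne
  refine ⟨h3, fun x => ?_⟩
  rw [del_adj, h4, Finset.mem_singleton, Finset.mem_singleton]
  constructor
  · tauto
  · rintro (rfl | rfl)
    · exact ⟨by simp, huv, h1.symm⟩
    · exact ⟨by simp, huv, h2.symm⟩

theorem Nbrs₃.del_of_notMem {S : Finset V} {v a b c : V} (h : Nbrs₃ G v a b c) (hv : v ∉ S)
    (ha : a ∉ S) (hb : b ∉ S) (hc : c ∉ S) : Nbrs₃ (MinMaxMatching.del G S) v a b c := by
  refine ⟨h.1, h.2.1, h.2.2.1, fun x => ?_⟩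
  rw [del_adj, h.2.2.2]
  constructor
  · tauto
  · rintro (rfl | rfl | rfl) <;> simp [*]

theorem exists_lost_del {u q p : V} (hu : Nbrs₂ G u q p) (hp : deg G p ≤ 2) :
    ∃ p', Lost G (del G {u, p}) {q, p'} := by
  have hup : G.Adj u p := (hu.2 p).2 (by simp)
  obtain ⟨p', hp'⟩ := exists_nbrs_subset_of_le_two hp hup.symm
  refine ⟨p', fun x hx hx' => ?_⟩
  by_contra hcon
  simp only [Finset.mem_insert, Finset.mem_singleton, not_or] at hcon
  have hud := hu.deg
  have hxu : x ≠ u := by rintro rfl; omega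
  have hxp : x ≠ p := by rintro rfl; omega
  refine hx' (hx ▸ deg_del_eq (by simp [hxu, hxp]) fun s hs hxs => ?_)
  simp only [Finset.mem_insert, Finset.mem_singleton] at hs
  rcases hs with rfl | rfl
  · have := (hu.2 x).1 hxs.symm
    tauto
  · have := hp' x hxs.symm
    tauto

/-- One of the two edges at `w` can be matched, provided that the neighbours of `w` are not
blocked. -/
theorem exists_isStep (hG : Subcub G) {w s t : V} (hw : Nbrs₂ G w s t) (hE : OkAvoid {w} G)
    (hb : deg G s = 3 → deg G t = 3 → ¬ Blocked G w s t) :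
    ∃ (H : SimpleGraph V) (x y z : V), G.Adj w x ∧ IsStep G H w x ∧ Ok H ∧ Lost G H {y, z} := by
  have hws : G.Adj w s := (hw.2 s).2 (by simp)
  have hwt : G.Adj w t := (hw.2 t).2 (by simp)
  by_cases hs : deg G s ≤ 2
  · obtain ⟨p', hp'⟩ := exists_lost_del hw.swap hs
    exact ⟨_, s, t, p', hws, isStep_del hws, ok_del hG hE.ok _, hp'⟩
  by_cases ht : deg G t ≤ 2
  · obtain ⟨p', hp'⟩ := exists_lost_del hw ht
    exact ⟨_, t, s, p', hwt, isStep_del hwt, ok_del hG hE.ok _, hp'⟩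
  have hs3 : deg G s = 3 := by have := hG s; omega
  have ht3 : deg G t = 3 := by have := hG t; omega
  obtain ⟨c₁, c₂, h1, h2, h3, h4⟩ := exists_of_deg_three ht3 hwt.symm
  -- The witness for `w` differs from `w` by `hE`. The last exit from `{w, t}` on the way to it
  -- passes through `s`, `c₁` or `c₂`, which is what the separated case needs.
  obtain ⟨c, k, hr, hok⟩ := exists_isRed hG hw ⟨h1, h2, h3, h4⟩ (hb hs3 ht3) (E := ∅)
    (okAvoid_empty.2 hE.ok) (by simp) (by simp) (by simp) (by simp) (fun _ _ _ => by
      obtain ⟨y, hy, hy2, hyw⟩ := hE w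
      rw [Finset.mem_singleton] at hyw
      have hyt : y ≠ t := by rintro rfl; omega
      obtain ⟨a, ha, z, haz, hzS, hzy⟩ := exists_reachable_del (S := {w, t}) hy (by simp)
        (by simp [hyw, hyt])
      simp only [Finset.mem_insert, Finset.mem_singleton, not_or] at ha hzS
      refine ⟨y, hy2, by simp, ?_⟩
      rcases ha with rfl | rfl
      · rcases (hw.2 z).1 haz with rfl | rfl
        · exact Or.inl hzy
        · exact absurd rfl hzS.2
      · rcases (h4 z).1 haz with rfl | rfl | rfl
        · exact absurd rfl hzS.1
        · exact Or.inr (Or.inl hzy)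
        · exact Or.inr (Or.inr hzy))
  exact ⟨_, t, t, k, hwt, hr.isStep, hok.ok, hr.lost⟩

variable (hG : Subcub G) (hl : ∀ v, deg G v ≠ 1) (ih : Below G) (hok : Ok G)

include hG hl ih

/-- Removing `v` costs at most the cubicity of `u` and `w`, so five of the seven permitted losses
remain for the two steps. -/
theorem good_of_two_steps {v u w p s : V} (hv : Nbrs₂ G v u w) {Γ : SimpleGraph V}
    (h₁ : IsStep (del G {v}) Γ u p) (h₂ : IsStep Γ H w s) (hp : deg (del G {v}) p ≠ 0)
    (hw : deg Γ w ≠ 0) (hs : deg Γ s ≠ 0) (hH : Ok H) {T₁ T₂ : Finset V}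
    (hT₁ : Lost (del G {v}) Γ T₁) (hT₂ : Lost Γ H T₂) (hT : T₁.card + T₂.card ≤ 5) : Good G := by
  have hvu : G.Adj v u := (hv.2 u).2 (by simp)
  have hvw : G.Adj v w := (hv.2 w).2 (by simp)
  have hvd := hv.deg
  have hdeg : ∀ x, deg H x ≤ deg G x := fun x =>
    ((h₂.deg_le x).trans (h₁.deg_le x)).trans (deg_del_le G _ x)
  have hΓv : deg Γ v = 0 := by
    have := h₁.deg_le v
    rw [deg_del_eq_zero (by simp)] at this
    omega
  have hle : ∀ x, deg Γ x = 0 → deg H x = 0 := fun x hx => by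
    have := h₂.deg_le x
    omega
  have hS' : ∀ x ∈ ({v, u, p, w, s} : Finset V), deg H x = 0 := by
    intro x hx
    simp only [Finset.mem_insert, Finset.mem_singleton] at hx
    rcases hx with rfl | rfl | rfl | rfl | rfl
    exacts [hle _ hΓv, hle _ h₁.deg_left, hle _ h₁.deg_right, h₂.deg_left, h₂.deg_right]
  obtain ⟨U', hU', hw'⟩ := ih H (mu_lt (v := v) hdeg (by omega) (hS' v (by simp)))
    (subcub_of_le hG hdeg) hH
  have hm : ∀ x ∈ ({v, u, p, w, s} : Finset V), x ∈ U' := fun x hx => mem_of_adm hU' (hS' x hx)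
  have e1 : v ≠ u := hvu.ne
  have e2 : v ≠ p := by
    rintro rfl
    exact hp (deg_del_eq_zero (by simp))
  have e3 : v ≠ w := hvw.ne
  have e4 : v ≠ s := by rintro rfl; exact hs hΓv
  have e5 : u ≠ p := h₁.ne
  have e6 : u ≠ w := hv.1
  have e7 : u ≠ s := by rintro rfl; exact hs h₁.deg_left
  have e8 : p ≠ w := by rintro rfl; exact hw h₁.deg_right
  have e9 : p ≠ s := by rintro rfl; exact hs h₁.deg_right
  have e10 : w ≠ s := h₂.ne
  have hU := h₁.lift _ (h₂.lift _ hU')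
  have c1 := card_of_pair e10 (hm w (by simp)) (hm s (by simp))
  have c2 := card_of_pair (U := U' \ {w, s}) e5 (by simp [hm u, e6, e7]) (by simp [hm p, e8, e9])
  have hpd : deg G p ≠ 0 := by have := deg_del_le G {v} p; omega
  have hsd : deg G s ≠ 0 := by
    have := (h₁.deg_le s).trans (deg_del_le G {v} s)
    omega
  refine good_of_lift (S := {v, u, p, w, s}) (T := {u, w} ∪ (T₁ ∪ T₂)) (U' := U') hG hl hdeg ?_ hS'
    ?_ ?_ (adm_of_iso hU ?_) ?_
  · intro x hx
    simp only [Finset.mem_insert, Finset.mem_singleton] at hx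
    rcases hx with rfl | rfl | rfl | rfl | rfl
    exacts [by omega, deg_ne_zero_of_adj hvu.symm, hpd, deg_ne_zero_of_adj hvw.symm, hsd]
  · intro x hx hx'
    by_contra hcon
    simp only [Finset.mem_union, Finset.mem_insert, Finset.mem_singleton, not_or] at hcon
    have h3 : deg (del G {v}) x = 3 := hx ▸ deg_del_eq (by
      rw [Finset.mem_singleton]; rintro rfl; omega) (fun z hz hxz => by
      rw [Finset.mem_singleton] at hz
      subst hz
      have := (hv.2 x).1 hxz.symm
      tauto)
    have h4 : deg Γ x = 3 := by
      by_contra h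
      exact hcon.2.1 (hT₁ x h3 h)
    exact hcon.2.2 (hT₂ x h4 hx')
  · have b1 := Finset.card_union_le {u, w} (T₁ ∪ T₂)
    have b2 := Finset.card_union_le T₁ T₂
    have b3 := Finset.card_le_two (a := u) (b := w)
    have b4 := baseWeight_le_weight H
    omega
  · intro x hx
    rcases (hv.2 x).1 hx with rfl | rfl <;> simp
  · have : ({v, u, p, w, s} : Finset V).card = 5 := by
      rw [Finset.card_insert_of_notMem (by simp [e1, e2, e3, e4]), Finset.card_insert_of_notMem
        (by simp [e5, e6, e7]), Finset.card_insert_of_notMem (by simp [e8, e9]),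
        Finset.card_pair e10]
    omega

theorem good_of_step {v u w p s t : V} (hv : Nbrs₂ G v u w) {Γ : SimpleGraph V}
    (h₁ : IsStep (del G {v}) Γ u p) (hp : deg (del G {v}) p ≠ 0) (hw : Nbrs₂ Γ w s t)
    (hE : OkAvoid {w} Γ) (hb : deg Γ s = 3 → deg Γ t = 3 → ¬ Blocked Γ w s t)
    {T : Finset V} (hT : Lost (del G {v}) Γ T) (hTc : T.card ≤ 3) : Good G := by
  have hΓ : Subcub Γ := fun x => ((h₁.deg_le x).trans (deg_del_le G _ x)).trans (hG x)
  obtain ⟨H, x, y, z, h1, h2, h3, h4⟩ := exists_isStep hΓ hw hE hb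
  have hwd := hw.deg
  have := Finset.card_le_two (a := y) (b := z)
  exact good_of_two_steps hG hl ih hv h₁ h2 hp (by omega) (deg_ne_zero_of_adj h1.symm) h3 hT h4
    (by omega)

include hok

/-- Without `v`, the vertex `w` has degree 2 and would be its own witness. As it is removed in the
second step, a different one is required; if there is none, `vw` is a bridge with a cubic side. -/
theorem good_or_okAvoid {v u w : V} (hv : Nbrs₂ G v u w) (hw : deg G w = 3) :
    Good G ∨ OkAvoid {w} (del G {v}) := by
  have hvw : G.Adj v w := (hv.2 w).2 (by simp)
  rcases good_or_exists_reachable hG hl ih (S := {v}) (a := v) (b := w) (fun x => by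
    obtain ⟨y, h1, h2⟩ := hok x
    exact ⟨y, h1, Or.inl h2⟩) (by simpa using hvw.ne.symm) (by simp) hvw.symm (by simp) hw with
    h | ⟨y, h1, h2, h3⟩
  · exact Or.inl h
  · refine Or.inr (okAvoid_del hG (by simpa using hvw.ne) (fun x => ?_) fun z hz _ => ?_)
    · obtain ⟨y, h1, h2⟩ := hok x
      exact ⟨y, h1, Or.inl ⟨h2, by rw [Finset.mem_singleton]; rintro rfl; omega⟩⟩
    · rw [Finset.mem_singleton] at hz
      subst hz
      exact ⟨y, h1, h2, by simpa using h3⟩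

theorem good_or_exists_isRed {v u w q p : V} (hv : Nbrs₂ G v u w) (huw : ¬ G.Adj u w)
    (hu : Nbrs₃ G u v q p) (hq : deg G q = 3) (hp : deg G p = 3) (hw : deg G w = 3)
    (hpw : ¬ G.Adj p w) (hb : ¬ Blocked G u q p) :
    Good G ∨ ∃ c k, IsRed (del G {v}) u p q c k ∧ OkAvoid {w} (red (del G {v}) {u, p} q c) := by
  rcases good_or_okAvoid hG hl ih hok hv hw with h | hE
  · exact Or.inl h
  by_contra hcon
  rw [not_or] at hcon
  obtain ⟨hgood, hcon⟩ := hcon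
  have hr : ∀ b x, ∃ y, G.Reachable x y ∧ (deg G y ≤ 2 ∨ y = b) := fun b x => by
    obtain ⟨y, h1, h2⟩ := hok x
    exact ⟨y, h1, Or.inl h2⟩
  have hvu : G.Adj v u := (hv.2 u).2 (by simp)
  have hvw : G.Adj v w := (hv.2 w).2 (by simp)
  have hup : G.Adj u p := (hu.2.2.2 p).2 (by simp)
  have huq : G.Adj u q := (hu.2.2.2 q).2 (by simp)
  have hvp : ¬ G.Adj v p := fun h => by
    rcases (hv.2 p).1 h with rfl | rfl
    · exact G.irrefl hup
    · exact huw hup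
  have hvq : ¬ G.Adj v q := fun h => by
    rcases (hv.2 q).1 h with rfl | rfl
    · exact G.irrefl huq
    · exact huw huq
  obtain ⟨c₁, c₂, h1, h2, h3, h4⟩ := exists_of_deg_three hp hup.symm
  have hpc₁ : G.Adj p c₁ := (h4 c₁).2 (by simp)
  have hpc₂ : G.Adj p c₂ := (h4 c₂).2 (by simp)
  have hc₁v : c₁ ≠ v := by rintro rfl; exact hvp hpc₁.symm
  have hc₂v : c₂ ≠ v := by rintro rfl; exact hvp hpc₂.symm
  have hpv : p ≠ v := hu.2.1.symm
  have hqv : q ≠ v := hu.1.symm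
  have hp' : Nbrs₃ (del G {v}) p u c₁ c₂ := Nbrs₃.del_of_notMem ⟨h1, h2, h3, h4⟩ (by simpa using hpv)
    (by simpa using hvu.ne.symm) (by simpa using hc₁v) (by simpa using hc₂v)
  have hb' : ¬ Blocked (del G {v}) u q p := fun h => hb fun c hc hcu => by
    have hcv : c ≠ v := by rintro rfl; exact hvp hc.symm
    exact (h c ⟨hc, by simpa using hpv, by simpa using hcv⟩ hcu).imp_right fun h => h.1
  have hc₁w : c₁ ≠ w := by rintro rfl; exact hpw hpc₁
  have hc₂w : c₂ ≠ w := by rintro rfl; exact hpw hpc₂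
  have hpw' : p ≠ w := by rintro rfl; exact huw hup
  refine hcon (exists_isRed (subcub_del hG _) hu.del hp' hb' hE (by simpa using hv.1)
    (by simpa using hpw') (by simpa using hc₁w) (by simpa using hc₂w) ?_)
  have e : del (del G {v}) {u, p} = del G {v, u, p} := by rw [del_del]; rfl
  rw [e]
  intro n1 n2 n3
  have hqc₁ : q ≠ c₁ := by rintro rfl; exact n1 (.refl _)
  have hqc₂ : q ≠ c₂ := by rintro rfl; exact n2 (.refl _)
  have hqp : ¬ G.Adj p q := fun h => by
    rcases (h4 q).1 h with rfl | rfl | rfl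
    · exact G.irrefl huq
    · exact hqc₁ rfl
    · exact hqc₂ rfl
  have hqS : q ∉ ({v, u, p} : Finset V) := by simp [hqv, huq.ne.symm, hu.2.2.1]
  have hcS : c₁ ∉ ({v, u, p} : Finset V) := by simp [hc₁v, h1.symm, hpc₁.ne.symm]
  have hdeg : ∀ y, y ∉ ({v, u, p} : Finset V) → (G.Adj u y → y = q → False) →
      (∀ c, c = c₁ ∨ c = c₂ → y = c → False) →
      deg (del G {v, u, p}) y ≤ 2 → deg (del G {v}) y ≤ 2 := by
    intro y hy m1 m2 hy2
    simp only [Finset.mem_insert, Finset.mem_singleton, not_or] at hy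
    rw [← e, deg_del_eq (by simp [hy.2]) fun z hz hyz => ?_] at hy2
    · exact hy2
    · simp only [Finset.mem_insert, Finset.mem_singleton] at hz
      rcases hz with rfl | rfl
      · rcases (hu.2.2.2 y).1 hyz.1.symm with h | h | h
        · exact hy.1 h
        · exact m1 hyz.1.symm h
        · exact hy.2.2 h
      · rcases (h4 y).1 hyz.1.symm with h | h | h
        · exact hy.2.1 h
        · exact m2 _ (Or.inl rfl) h
        · exact m2 _ (Or.inr rfl) h
  -- The three sides are disjoint, so a side without `w` can be chosen: that of `c₁` if `w` lies
  -- with `q`, and that of `q` otherwise. A side with no suitable witness would be a cubic side of a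
  -- bridge.
  by_cases hqw : (del G {v, u, p}).Reachable q w
  · by_cases hc2 : deg G c₁ ≤ 2
    · exact ⟨c₁, (deg_del_le G _ _).trans hc2, by simpa using hc₁w, by simp⟩
    obtain ⟨y, g1, g2, g3⟩ := (good_or_exists_reachable hG hl ih (S := {v, u, p}) (a := p) (b := c₁)
      (hr _) hcS (by simp) hpc₁.symm (fun s hs hcs => by
        simp only [Finset.mem_insert, Finset.mem_singleton] at hs
        rcases hs with rfl | rfl | rfl
        · rcases (hv.2 c₁).1 hcs.symm with h | h
          · exact absurd h.symm h1
          · exact absurd h hc₁w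
        · rcases (hu.2.2.2 c₁).1 hcs.symm with h | h | h
          · exact absurd h hc₁v
          · exact absurd h.symm hqc₁
          · exact absurd h.symm hpc₁.ne
        · rfl) (by have := hG c₁; omega)).resolve_left hgood
    refine ⟨y, hdeg y (notMem_of_reachable_del hcS g1) (fun _ h => n1 (h ▸ g1).symm) ?_ g2, ?_,
      Or.inr (Or.inl g1)⟩
    · rintro c (rfl | rfl) rfl
      · exact g3 rfl
      · exact n3 g1
    · rw [Finset.mem_singleton]
      rintro rfl
      exact n1 (hqw.trans g1.symm)
  · obtain ⟨y, g1, g2, g3⟩ := (good_or_exists_reachable hG hl ih (S := {v, u, p}) (a := u) (b := q)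
      (hr _) hqS (by simp) huq.symm (fun s hs hcs => by
        simp only [Finset.mem_insert, Finset.mem_singleton] at hs
        rcases hs with rfl | rfl | rfl
        · exact absurd hcs.symm hvq
        · rfl
        · exact absurd hcs.symm hqp) hq).resolve_left hgood
    refine ⟨y, hdeg y (notMem_of_reachable_del hqS g1) (fun _ h => g3 h) ?_ g2, ?_,
      Or.inl g1⟩
    · rintro c (rfl | rfl) rfl
      · exact n1 g1
      · exact n2 g1
    · rw [Finset.mem_singleton]
      rintro rfl
      exact hqw g1

end Sides

/-! ### Sides of low degree, and conflicts between the two reductions -/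

section Cases

variable {V : Type*} [Fintype V] [DecidableEq V] {G H : SimpleGraph V}

theorem adj_of_deg_le {x y : V} (h : ∀ z, H.Adj x z → G.Adj x z) (hd : deg G x ≤ deg H x)
    (hxy : G.Adj x y) : H.Adj x y := by
  by_contra hn
  have := deg_lt_deg h hxy hn
  omega

theorem Blocked.of_le {w s t : V} (h : Blocked H w s t) (hs : ∀ z, H.Adj s z → G.Adj s z)
    (ht : ∀ z, H.Adj t z → G.Adj t z) (hd : deg G t ≤ deg H t) : Blocked G w s t :=
  fun c hc hcw => (h c (adj_of_deg_le ht hd hc) hcw).imp_right (hs c)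

/-- With `t` cubic, blocking already exhausts the three neighbours of `s`, so the diamond or twin
structure is symmetric in `s` and `t`. -/
theorem Blocked.symm (hG : Subcub G) {w s t : V} (h : Blocked G w s t) (hws : G.Adj w s)
    (hwt : G.Adj w t) (hst : s ≠ t) (ht : deg G t = 3) : Blocked G w t s := by
  by_cases hts : G.Adj t s
  · obtain ⟨y, h1, h2, hy⟩ := exists_of_deg_three₂ ht hwt.symm hts hws.ne
    have hty := (hy y).2 (by simp)
    have hsy := (h y hty h1.symm).resolve_left h2.symm
    have hs := nbrs₃_of_adj hG hws.symm hts.symm hsy hwt.ne h1 hty.ne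
    intro c hc hcw
    rcases (hs.2.2.2 c).1 hc with rfl | rfl | rfl
    · exact absurd rfl hcw
    · exact Or.inl rfl
    · exact Or.inr hty
  · obtain ⟨x, y, h1, h2, h3, hy⟩ := exists_of_deg_three ht hwt.symm
    have htx := (hy x).2 (by simp)
    have hty := (hy y).2 (by simp)
    have hsx := (h x htx h1.symm).resolve_left fun e => hts (e ▸ htx)
    have hsy := (h y hty h2.symm).resolve_left fun e => hts (e ▸ hty)
    have hs := nbrs₃_of_adj hG hws.symm hsx hsy h1 h2 h3
    intro c hc hcw
    rcases (hs.2.2.2 c).1 hc with rfl | rfl | rfl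
    exacts [absurd rfl hcw, Or.inr htx, Or.inr hty]

variable (hG : Subcub G) (hl : ∀ v, deg G v ≠ 1) (ih : Below G) (hok : Ok G)

include hG hl ih hok

variable {v u w p q s t : V} (hv : Nbrs₂ G v u w)

include hv

/-- The pair `ws` is simply deleted, at the cost of `s` and two of its neighbours. This is the case
that uses the full allowance of three in `good_of_step`; the second step takes place at `u`. -/
theorem good_of_deg_two (hu : Nbrs₃ G u v p q) (hw : Nbrs₂ G w v s)
    (hsu : s ≠ u) (hsp : s ≠ p) (hsq : s ≠ q) : Good G := by
  have hvu : G.Adj v u := (hv.2 u).2 (by simp)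
  have hvw : G.Adj v w := (hv.2 w).2 (by simp)
  have hws : G.Adj w s := (hw.2 s).2 (by simp)
  have huw : ¬ G.Adj u w := fun h => by
    rcases (hw.2 u).1 h.symm with rfl | rfl
    · exact G.irrefl hvu
    · exact hsu rfl
  have hus : ¬ G.Adj u s := fun h => by
    rcases (hu.2.2.2 s).1 h with h | h | h
    exacts [hw.1 h.symm, hsp h, hsq h]
  have hud := hu.deg
  have hwd := hw.deg
  have e : del (del G {v}) {w, s} = del G {v, w, s} := by rw [del_del]; rfl
  have hvs := hw.1
  rcases good_or_exists_reachable hG hl ih (S := {v, w, s}) (a := v) (b := u) (fun x => by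
    obtain ⟨y, h1, h2⟩ := hok x
    exact ⟨y, h1, Or.inl h2⟩) (by simp [hvu.ne.symm, hv.1, hsu.symm]) (by simp) hvu.symm (by
      simp only [Finset.mem_insert, Finset.mem_singleton]
      rintro x (rfl | rfl | rfl) hx
      exacts [rfl, absurd hx huw, absurd hx hus]) hud with h | ⟨y, h1, h2, h3⟩
  · exact h
  have hE : OkAvoid {u} (del G {v, w, s}) := by
    refine okAvoid_del hG (fun x hx => ?_) (fun x => ?_) fun z hz _ => ?_
    · simp only [Finset.mem_insert, Finset.mem_singleton] at hx ⊢
      rcases hx with rfl | rfl | rfl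
      exacts [hvu.ne, hv.1.symm, hsu]
    · obtain ⟨y, h1, h2⟩ := hok x
      exact ⟨y, h1, Or.inl ⟨h2, by rw [Finset.mem_singleton]; rintro rfl; omega⟩⟩
    · rw [Finset.mem_singleton] at hz
      subst hz
      exact ⟨y, h1, h2, by simpa using h3⟩
  rw [← e] at hE
  obtain ⟨s₁, s₂, hs⟩ := exists_nbrs_subset hG hws.symm
  have hws' : (del G {v}).Adj w s := ⟨hws, by simpa using hvw.ne.symm, by simpa using hvs.symm⟩
  have hle : ∀ x y, (del (del G {v}) {w, s}).Adj x y → G.Adj x y := fun x y h => h.1.1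
  by_contra hgood
  refine hgood (good_of_step hG hl ih hv.swap (isStep_del hws') (deg_ne_zero_of_adj hws'.symm)
    (s := p) (t := q) ⟨hu.2.2.1, fun x => ?_⟩ hE (fun h1 h2 hb => hgood ?_) (T := {s, s₁, s₂})
    (fun x hx hx' => ?_) Finset.card_le_three)
  · have h1 := hu.2.2.2 x
    simp only [del_adj, Finset.mem_insert, Finset.mem_singleton]
    have hne : ∀ x, G.Adj u x → x ≠ w ∧ x ≠ s := fun x hx =>
      ⟨fun h => huw (h ▸ hx), fun h => hus (h ▸ hx)⟩
    have h2 := hne x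
    have h3 := hvu.ne
    have h4 := hv.1
    have h5 := hu.1
    have h6 := hu.2.1
    constructor
    · tauto
    · intro h7
      have h8 : G.Adj u x := h1.2 (Or.inr h7)
      have h9 : x ≠ v := by rintro rfl; tauto
      have := h2 h8
      have := hsu.symm
      exact ⟨⟨h8, h3.symm, h9⟩, by tauto, by tauto⟩
  · have hqd : deg G q = 3 := by
      have := ((deg_del_le (del G {v}) {w, s} q).trans (deg_del_le G {v} q))
      have := hG q
      omega
    exact good_of_blocked hG hl ih hok hv huw hu hqd
      (hb.of_le (hle p) (hle q) (by omega))
  · by_contra hcon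
    simp only [Finset.mem_insert, Finset.mem_singleton, not_or] at hcon
    have hxw : x ≠ w := by
      rintro rfl
      have := deg_del_le G {v} x
      omega
    refine hx' (hx ▸ deg_del_eq (by simp [hxw, hcon.1]) fun z hz hxz => ?_)
    simp only [Finset.mem_insert, Finset.mem_singleton] at hz
    rcases hz with rfl | rfl
    · rcases (hw.2 x).1 hxz.1.symm with rfl | h
      · exact hxz.2.1 (by simp)
      · exact hcon.1 h
    · have := hs x hxz.1.symm
      tauto

/-- With `p` of degree at most 2, plain deletion of `u` and `p` loses no more than a reduction
would. As `p` is not a neighbour of `w`, the second step at `w` is untouched. -/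
theorem good_of_side_two (huw : ¬ G.Adj u w) (hu : Nbrs₃ G u v q p) (hw : Nbrs₃ G w v s t)
    (hp : deg G p ≤ 2) (hps : p ≠ s) (hpt : p ≠ t) : Good G := by
  have hvu : G.Adj v u := (hv.2 u).2 (by simp)
  have hvw : G.Adj v w := (hv.2 w).2 (by simp)
  have hup : G.Adj u p := (hu.2.2.2 p).2 (by simp)
  have hws : G.Adj w s := (hw.2.2.2 s).2 (by simp)
  have hwt : G.Adj w t := (hw.2.2.2 t).2 (by simp)
  have hpw : ¬ G.Adj w p := fun h => by
    rcases (hw.2.2.2 p).1 h with h | h | h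
    exacts [hu.2.1 h.symm, hps h, hpt h]
  rcases good_or_okAvoid hG hl ih hok hv hw.deg with h | hE
  · exact h
  have hpw' : p ≠ w := by rintro rfl; exact huw hup
  have hus : s ≠ u := by rintro rfl; exact huw hws.symm
  have hut : t ≠ u := by rintro rfl; exact huw hwt.symm
  have hup' : (del G {v}).Adj u p := (hu.del.2 p).2 (by simp)
  obtain ⟨p', hp'⟩ := exists_lost_del hu.del ((deg_del_le G {v} p).trans hp)
  have hE' : OkAvoid {w} (del (del G {v}) {u, p}) := by
    refine okAvoid_del (subcub_del hG _) (by simp [hv.1, hpw'])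
      (fun x => ?_) fun z hz hz' => ?_
    · obtain ⟨y, h1, h2⟩ := hE x
      exact ⟨y, h1, Or.inl h2⟩
    · rw [Finset.mem_singleton] at hz
      subst hz
      obtain ⟨x, hx, hxz⟩ := hz'
      simp only [Finset.mem_insert, Finset.mem_singleton] at hx
      rcases hx with rfl | rfl
      · exact absurd hxz.1.symm huw
      · exact absurd hxz.1 hpw
  have hle : ∀ x y, (del (del G {v}) {u, p}).Adj x y → G.Adj x y := fun x y h => h.1.1
  by_contra hgood
  refine hgood (good_of_step hG hl ih hv (isStep_del hup') (deg_ne_zero_of_adj hup'.symm)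
    (s := s) (t := t) ⟨hw.2.2.1, fun x => ?_⟩ hE' (fun h1 h2 hb => hgood ?_) hp'
    (Finset.card_le_two.trans (by omega)))
  · rw [del_adj, hw.del.2]
    have := hv.1
    constructor
    · tauto
    · rintro (rfl | rfl) <;> simp [*, hv.1.symm, hpw'.symm, hps.symm, hpt.symm]
  · have htd : deg G t = 3 := by
      have := ((deg_del_le (del G {v}) {u, p} t).trans (deg_del_le G {v} t))
      have := hG t
      omega
    exact good_of_blocked hG hl ih hok hv.swap (fun h => huw h.symm) hw htd
      (hb.of_le (hle s) (hle t) (by omega))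

theorem good_of_conflict_common {c k a : V} (huw : ¬ G.Adj u w) (hu : Nbrs₃ G u v q p)
    (hw : Nbrs₃ G w v q t) (hp : Nbrs₃ G p u c k) (hq : Nbrs₃ G q u w a) (hqc : ¬ G.Adj q c)
    (hpt : p ≠ t) (hap : a ≠ p)
    (h : c = t ∧ G.Adj t a ∨ c ≠ t ∧ G.Adj t c ∧ (a = t ∨ G.Adj t a)) : Good G := by
  have hvd := hv.deg
  have e1 : G.Adj v u := (hv.2 u).2 (by simp)
  have e2 : G.Adj v w := (hv.2 w).2 (by simp)
  have e3 : G.Adj u p := (hu.2.2.2 p).2 (by simp)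
  have e4 : G.Adj u q := (hu.2.2.2 q).2 (by simp)
  have e5 : G.Adj w q := (hw.2.2.2 q).2 (by simp)
  have e6 : G.Adj w t := (hw.2.2.2 t).2 (by simp)
  have e7 : G.Adj p c := (hp.2.2.2 c).2 (by simp)
  have e8 : G.Adj q a := (hq.2.2.2 a).2 (by simp)
  have n1 := e1.ne
  have n2 := e2.ne
  have n3 := e3.ne
  have n4 := e4.ne
  have n5 := e5.ne
  have n6 := e6.ne
  have n9 : p ≠ w := by rintro rfl; exact huw e3
  have n10 : u ≠ t := by rintro rfl; exact huw e6.symm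
  have n11 : c ≠ a := by rintro rfl; exact hqc e8
  obtain ⟨d1, hv⟩ := hv
  obtain ⟨d2, d3, d4, hu⟩ := hu
  obtain ⟨d5, d6, d7, hw⟩ := hw
  obtain ⟨d8, d9, d10, hp⟩ := hp
  obtain ⟨d11, d12, d13, hq⟩ := hq
  rcases h with ⟨rfl, hta⟩ | ⟨hct, htc, rfl | hta⟩
  · have ht := nbrs₃_of_adj hG e7.symm e6.symm hta n9 hap.symm d13
    obtain ⟨-, -, -, ht⟩ := ht
    refine good_of_list hG hl ih hok (v := v) u p w c q k a (by omega) e3 e6 ?_ ?_ ?_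
    · simp; grind
    · simp; grind
    · intro x hx h
      simp only [hu, hp, hv, hw, ht, List.mem_cons, List.not_mem_nil, or_false] at h ⊢
      grind
  · refine good_of_list hG hl ih hok (v := v) u p w q a c k (by omega) e3 e5 ?_ ?_ ?_
    · simp; grind
    · simp; grind
    · intro x hx h
      simp only [hu, hp, hv, hw, hq, List.mem_cons, List.not_mem_nil, or_false] at h ⊢
      grind
  · have hcw : c ≠ w := by
      rintro rfl
      exact hqc e5.symm
    have ht := nbrs₃_of_adj hG e6.symm htc hta hcw.symm d13 n11
    obtain ⟨-, -, -, ht⟩ := ht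
    refine good_of_list hG hl ih hok (v := v) u q w t p a c (by omega) e4 e6 ?_ ?_ ?_
    · simp; grind
    · simp; grind
    · intro x hx h
      simp only [hu, hv, hw, hq, ht, List.mem_cons, List.not_mem_nil, or_false] at h ⊢
      grind

theorem good_of_conflict {k x : V} (huw : ¬ G.Adj u w) (hu : Nbrs₃ G u v q p)
    (hw : Nbrs₃ G w v s t) (hp : Nbrs₃ G p u s k) (hs : Nbrs₃ G s w p x) (hqs : ¬ G.Adj q s)
    (hqs' : q ≠ s) (hqt : q ≠ t) (hpt : p ≠ t) (htq : G.Adj t q) (hx : x = t ∨ G.Adj t x) :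
    Good G := by
  have hvd := hv.deg
  have e1 : G.Adj v u := (hv.2 u).2 (by simp)
  have e2 : G.Adj v w := (hv.2 w).2 (by simp)
  have e3 : G.Adj u p := (hu.2.2.2 p).2 (by simp)
  have e4 : G.Adj u q := (hu.2.2.2 q).2 (by simp)
  have e5 : G.Adj w s := (hw.2.2.2 s).2 (by simp)
  have e6 : G.Adj w t := (hw.2.2.2 t).2 (by simp)
  have e7 : G.Adj p s := (hp.2.2.2 s).2 (by simp)
  have e8 : G.Adj s x := (hs.2.2.2 x).2 (by simp)
  have hsd := hs.deg
  have n1 := e1.ne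
  have n2 := e2.ne
  have n3 := e3.ne
  have n4 := e4.ne
  have n5 := e5.ne
  have n6 := e6.ne
  have n7 := e7.ne
  have n8 := e8.ne
  have n9 : p ≠ w := by rintro rfl; exact huw e3
  have n10 : u ≠ t := by rintro rfl; exact huw e6.symm
  have n11 : q ≠ x := by rintro rfl; exact hqs e8.symm
  have n12 : w ≠ q := by rintro rfl; exact huw e4
  obtain ⟨d1, hv⟩ := hv
  obtain ⟨d2, d3, d4, hu⟩ := hu
  obtain ⟨d5, d6, d7, hw⟩ := hw
  obtain ⟨d8, d9, d10, hp⟩ := hp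
  obtain ⟨d11, d12, d13, hs⟩ := hs
  have hnd : [v, u, p, w, t].Nodup := by simp; grind
  have hN : ∀ y, G.Adj v y → y ∈ [u, p, w, t] := by simp; grind
  rcases hx with rfl | hx
  · have ht := nbrs₃_of_adj hG e6.symm htq e8.symm n12 n5 hqs'
    obtain ⟨-, -, -, ht⟩ := ht
    refine good_of_list hG hl ih hok (v := v) u p w x q s k (by omega) e3 e6 hnd hN ?_
    intro y hy h
    simp only [hu, hp, hv, hw, ht, List.mem_cons, List.not_mem_nil, or_false] at h ⊢
    grind
  have ht := nbrs₃_of_adj hG e6.symm htq hx n12 d12 n11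
  obtain ⟨-, -, -, ht⟩ := ht
  -- Matching `up` and `wt` can lose `u, p, w, t, q, s, k, x`, one too many unless `x = k` or `x` is
  -- not cubic.
  by_cases hkx : k = x
  · refine good_of_list hG hl ih hok (v := v) u p w t q s k (by omega) e3 e6 hnd hN ?_
    intro y hy h
    simp only [hu, hp, hv, hw, ht, List.mem_cons, List.not_mem_nil, or_false] at h ⊢
    grind
  by_cases hx2 : deg G x = 2
  · refine good_of_list hG hl ih hok (v := v) u p w t q s k (by omega) e3 e6 hnd hN ?_
    intro y hy h
    simp only [hu, hp, hv, hw, ht, List.mem_cons, List.not_mem_nil, or_false] at h ⊢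
    grind
  have hx3 : deg G x = 3 := by
    have := hG x
    have := hl x
    have := deg_ne_zero_of_adj e8.symm
    omega
  have hst : s ≠ t := d7
  obtain ⟨y, f1, f2, hxn⟩ := exists_of_deg_three₂ hx3 e8.symm hx.symm hst
  have hxy : G.Adj x y := (hxn y).2 (by simp)
  have hsv : s ≠ v := by rintro rfl; exact d5 rfl
  have hxv : x ≠ v := by
    rintro rfl
    have := (hv s).1 e8.symm
    have := hu s
    grind
  have hxS : x ∉ ({v, u, p, w, t} : Finset V) := by
    have := hu s
    have := hx.ne
    have := e3
    have := hw x
    have := e8.symm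
    simp only [Finset.mem_insert, Finset.mem_singleton]
    grind
  have hyS : y ∉ ({v, u, p, w, t} : Finset V) := by
    have h1 := hv x
    have h2 := hu x
    have h3 := hp x
    have h4 := hw x
    have h5 := hxy.symm
    simp only [Finset.mem_insert, Finset.mem_singleton] at hxS ⊢
    grind
  have hsS : s ∉ ({v, u, p, w, t} : Finset V) := by
    have := hu s
    have := e7
    simp only [Finset.mem_insert, Finset.mem_singleton]
    grind
  have hxsG : (del G {v, u, p, w, t}).Adj x s := ⟨e8.symm, hxS, hsS⟩
  have hxyG : (del G {v, u, p, w, t}).Adj x y := ⟨hxy, hxS, hyS⟩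
  have hs1 : deg (del G {v, u, p, w, t}) s = 1 := deg_eq_one.2 ⟨x, fun z => by
    constructor
    · rintro ⟨h1, -, h2⟩
      simp only [Finset.mem_insert, Finset.mem_singleton, not_or] at h2
      rcases (hs z).1 h1 with rfl | rfl | rfl
      · exact absurd rfl h2.2.2.2.1
      · exact absurd rfl h2.2.2.1
      · rfl
    · rintro rfl
      exact hxsG.symm⟩
  have hx2' : 2 ≤ deg (del G {v, u, p, w, t}) x := by
    have : ({s, y} : Set V).ncard ≤ deg (del G {v, u, p, w, t}) x := Set.ncard_le_ncard (by
      rintro z (rfl | rfl)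
      exacts [hxsG, hxyG])
    rwa [Set.ncard_pair f1] at this
  -- After the deletion `s` is a leaf at `x`, and `x` still has degree at least 2. The leaf's unit
  -- of weight pays for the eighth loss.
  have hw' := baseWeight_lt_weight hxsG hs1 hx2'
  refine good_of_pm5' (T := insert x {u, p, w, t, q, s, k}) hG hl ih (ok_del hG hok _) (by omega)
    e3 e6 hnd hN ?_ ?_
  · intro z hz h
    simp only [hu, hp, hv, hw, ht, List.mem_cons, List.not_mem_nil, or_false, Finset.mem_insert,
      Finset.mem_singleton] at h ⊢
    grind
  · have h1 := card_le_seven u p w t q s k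
    have h2 := Finset.card_insert_le x {u, p, w, t, q, s, k}
    omega

end Cases

/-! ### Assembling the induction -/

section Induction

variable {V : Type*} [Fintype V] [DecidableEq V] {G H : SimpleGraph V}

section

variable (hG : Subcub G) (hl : ∀ v, deg G v ≠ 1) (ih : Below G) (hok : Ok G)

include hG hl ih hok

variable {v u w p q s t : V} (hv : Nbrs₂ G v u w)

include hv

/-- Here `s` is an end of the new edge, so the blocking in the reduced graph need not come from `G`.
Translating it back yields the adjacencies required by the two conflict lemmas. -/
theorem good_of_red_blocked {c k : V} (huw : ¬ G.Adj u w) (hu : Nbrs₃ G u v q p)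
    (hw : Nbrs₃ G w v s t) (hpd : deg G p = 3) (hsd : deg G s = 3)
    (hpt : p ≠ t) (hpw : ¬ G.Adj p w)
    (hr : IsRed (del G {v}) u p q c k) (hks : s ≠ k)
    (hb : Blocked (red (del G {v}) {u, p} q c) w t s) (h : s = q ∨ s = c ∧ t ≠ q) : Good G := by
  have hvu : G.Adj v u := (hv.2 u).2 (by simp)
  have hvw : G.Adj v w := (hv.2 w).2 (by simp)
  have hup : G.Adj u p := (hu.2.2.2 p).2 (by simp)
  have huq : G.Adj u q := (hu.2.2.2 q).2 (by simp)
  have hws : G.Adj w s := (hw.2.2.2 s).2 (by simp)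
  have hwt : G.Adj w t := (hw.2.2.2 t).2 (by simp)
  have hpw' : p ≠ w := by rintro rfl; exact huw hup
  have hqw' : q ≠ w := by rintro rfl; exact huw huq
  have hpc' : (del G {v}).Adj p c := (hr.nbrs_right.2.2.2 c).2 (by simp)
  have hpc : G.Adj p c := hpc'.1
  have hpk : G.Adj p k := ((hr.nbrs_right.2.2.2 k).2 (by simp)).1
  have hcv : c ≠ v := by simpa using hpc'.2.2
  have hqv : q ≠ v := hu.1.symm
  have hcw : c ≠ w := by rintro rfl; exact hpw hpc
  have hqc : ¬ G.Adj q c := fun hh => hr.not_adj ⟨hh, by simpa using hqv, by simpa using hcv⟩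
  have hp : Nbrs₃ G p u c k := nbrs₃_of_adj hG hup.symm hpc hpk hr.nbrs_right.1
    hr.nbrs_right.2.1 hr.nbrs_right.2.2.1
  have hold : ∀ x y, (red (del G {v}) {u, p} q c).Adj x y → x ≠ q → x ≠ c → G.Adj x y := by
    intro x y hxy h1 h2
    rcases (hr.adj_iff x y).1 hxy with h | h | h
    exacts [h.1.1, absurd h.1 h1, absurd h.1 h2]
  have hst : s ≠ t := hw.2.2.1
  have hnew : ∀ x y, G.Adj x y → x ≠ v → x ≠ u → x ≠ p → y ≠ v → y ≠ u → y ≠ p →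
      (red (del G {v}) {u, p} q c).Adj x y := fun x y h h1 h2 h3 h4 h5 h6 =>
    (hr.adj_iff x y).2 (Or.inl ⟨⟨h, by simpa using h1, by simpa using h4⟩, h2, h3, h5, h6⟩)
  have hvn : ∀ x, G.Adj x v → x = u ∨ x = w := fun x hx => (hv.2 x).1 hx.symm
  rcases h with rfl | ⟨rfl, htq⟩
  · obtain ⟨a, f1, f2, ha⟩ := exists_of_deg_three₂ hsd huq.symm hws.symm hv.1
    have hsa : G.Adj s a := (ha a).2 (by simp)
    have hap : a ≠ p := by
      rintro rfl
      rcases (hp.2.2.2 s).1 hsa.symm with h | h | h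
      · exact huq.ne h.symm
      · exact hr.ne h.symm
      · exact hks h
    have hav : a ≠ v := by
      rintro rfl
      rcases hvn s hsa with h | h
      · exact huq.ne h.symm
      · exact hqw' h
    have hc' := hb c ((hr.adj_iff s c).2 (by simp)) hcw
    have ha' := hb a (hnew s a hsa hqv huq.ne.symm hu.2.2.1 hav f1.symm hap) f2.symm
    have hca : c ≠ a := by rintro rfl; exact hqc hsa
    refine good_of_conflict_common hG hl ih hok hv huw hu hw hp ⟨hv.1, f1, f2, ha⟩ hqc hpt hap ?_
    by_cases hct : c = t
    · have hta := ha'.resolve_left (fun h => hca (hct.trans h.symm))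
      rcases (hr.adj_iff t a).1 hta with h | h | h
      · exact Or.inl ⟨hct, h.1.1⟩
      · exact absurd h.1.symm hst
      · exact absurd h.2.symm hsa.ne
    · have htc := hold _ _ (hc'.resolve_left hct) hst.symm fun h => hct h.symm
      exact Or.inr ⟨hct, htc, ha'.imp_right fun h => hold _ _ h hst.symm fun h => hct h.symm⟩
  · have hpsw : w ≠ p := hpw'.symm
    obtain ⟨x, f1, f2, hx⟩ := exists_of_deg_three₂ hsd hws.symm hpc.symm hpsw
    have hsx : G.Adj s x := (hx x).2 (by simp)
    have hus : ¬ G.Adj u s := fun h => by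
      rcases (hu.2.2.2 s).1 h with h | h | h
      exacts [hcv h, hr.ne h, hpc.ne h.symm]
    have hxv : x ≠ v := by
      rintro rfl
      rcases hvn s hsx with h | h
      · exact hp.1 h.symm
      · exact hcw h
    have hxu : x ≠ u := by
      rintro rfl
      exact hus hsx.symm
    have hq' := hb q ((hr.adj_iff s q).2 (by simp)) hqw'
    have hx' := hb x (hnew s x hsx hcv hp.1.symm hpc.ne.symm hxv hxu f2.symm) f1.symm
    have htq' := hold _ _ (hq'.resolve_left htq.symm) htq hst.symm
    exact good_of_conflict hG hl ih hok hv huw hu hw hp ⟨hpsw, f1, f2, hx⟩ hqc hr.ne.symm htq.symm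
      hpt htq' (hx'.imp_right fun h => hold _ _ h htq hst.symm)

/-- Reduce at `u`, then at `w`. If the second reduction is blocked, either the new edge ends at `s`
or `t`, or both keep their old neighbourhoods and `w` was already blocked in `G`. -/
theorem good_of_side_three (huw : ¬ G.Adj u w) (hu : Nbrs₃ G u v q p) (hw : Nbrs₃ G w v s t)
    (hq : deg G q = 3) (hp : deg G p = 3) (hs : deg G s = 3) (ht : deg G t = 3)
    (hps : p ≠ s) (hpt : p ≠ t) : Good G := by
  have hup : G.Adj u p := (hu.2.2.2 p).2 (by simp)
  have huq : G.Adj u q := (hu.2.2.2 q).2 (by simp)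
  have hws : G.Adj w s := (hw.2.2.2 s).2 (by simp)
  have hwt : G.Adj w t := (hw.2.2.2 t).2 (by simp)
  have hpw : ¬ G.Adj p w := fun h => by
    rcases (hw.2.2.2 p).1 h.symm with h | h | h
    exacts [hu.2.1 h.symm, hps h, hpt h]
  by_contra hgood
  obtain ⟨c, k, hr, hE⟩ := (good_or_exists_isRed hG hl ih hok hv huw hu hq hp hw.deg hpw
    fun hb => hgood (good_of_blocked hG hl ih hok hv huw hu hp hb)).resolve_left hgood
  have hpc : G.Adj p c := ((hr.nbrs_right.2.2.2 c).2 (by simp)).1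
  have hwq : w ≠ q := by rintro rfl; exact huw huq
  have hwc : w ≠ c := by rintro rfl; exact hpw hpc
  have hwp : w ≠ p := by rintro rfl; exact huw hup
  have hsu : s ≠ u := by rintro rfl; exact huw hws.symm
  have htu : t ≠ u := by rintro rfl; exact huw hwt.symm
  have hw₂ : Nbrs₂ (red (del G {v}) {u, p} q c) w s t := by
    refine ⟨hw.2.2.1, fun x => ?_⟩
    rw [hr.adj_iff, hw.del.2]
    constructor
    · rintro (h | h | h)
      exacts [h.1, absurd h.1 hwq, absurd h.1 hwc]
    · rintro (rfl | rfl)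
      · exact Or.inl ⟨Or.inl rfl, hv.1.symm, hwp, hsu, hps.symm⟩
      · exact Or.inl ⟨Or.inr rfl, hv.1.symm, hwp, htu, hpt.symm⟩
  have hold : ∀ x, x ≠ q → x ≠ c → ∀ y, (red (del G {v}) {u, p} q c).Adj x y → G.Adj x y := by
    intro x h1 h2 y hxy
    rcases (hr.adj_iff x y).1 hxy with h | h | h
    exacts [h.1.1, absurd h.1 h1, absurd h.1 h2]
  have hsub : Subcub (red (del G {v}) {u, p} q c) :=
    subcub_of_le (subcub_del hG {v}) hr.deg_le
  have hk : ∀ x, deg (red (del G {v}) {u, p} q c) x = 3 → x ≠ k := by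
    rintro x hx rfl
    have h1 := hr.deg_lt
    have h2 := subcub_del hG {v} x
    omega
  refine hgood (good_of_step hG hl ih hv hr.isStep
    (deg_ne_zero_of_adj ((hr.nbrs_right.2.2.2 c).2 (by simp))) hw₂ hE (fun h1 h2 hb => hgood ?_)
    hr.lost (Finset.card_le_two.trans (by omega)))
  have hb' : Blocked (red (del G {v}) {u, p} q c) w t s :=
    hb.symm hsub ((hw₂.2 s).2 (by simp)) ((hw₂.2 t).2 (by simp)) hw.2.2.1 h2
  by_cases hsq : s = q
  · exact good_of_red_blocked hG hl ih hok hv huw hu hw hp hs hpt hpw hr (hk s h1) hb' (Or.inl hsq)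
  by_cases htq : t = q
  · exact good_of_red_blocked hG hl ih hok hv huw hu hw.swap hp ht hps hpw hr (hk t h2) hb
      (Or.inl htq)
  by_cases hsc : s = c
  · exact good_of_red_blocked hG hl ih hok hv huw hu hw hp hs hpt hpw hr (hk s h1) hb'
      (Or.inr ⟨hsc, htq⟩)
  by_cases htc : t = c
  · exact good_of_red_blocked hG hl ih hok hv huw hu hw.swap hp ht hps hpw hr (hk t h2) hb
      (Or.inr ⟨htc, hsq⟩)
  exact good_of_blocked hG hl ih hok hv.swap (fun h => huw h.symm) hw ht
    (hb.of_le (hold s hsq hsc) (hold t htq htc) (by omega))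

theorem good_of_deg_three (huw : ¬ G.Adj u w) (hu : Nbrs₃ G u v q p) (hw : Nbrs₃ G w v s t)
    (hps : p ≠ s) (hpt : p ≠ t) : Good G := by
  have hup : G.Adj u p := (hu.2.2.2 p).2 (by simp)
  have huq : G.Adj u q := (hu.2.2.2 q).2 (by simp)
  have hws : G.Adj w s := (hw.2.2.2 s).2 (by simp)
  have hwt : G.Adj w t := (hw.2.2.2 t).2 (by simp)
  have h3 : ∀ x y, G.Adj x y → deg G y = 2 ∨ deg G y = 3 := fun x y h => by
    have := hG y
    have := hl y
    have := deg_ne_zero_of_adj h.symm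
    omega
  have hwu : ¬ G.Adj w u := fun h => huw h.symm
  by_cases hp : deg G p = 2
  · exact good_of_side_two hG hl ih hok hv huw hu hw hp.le hps hpt
  have hp3 := (h3 _ _ hup).resolve_left hp
  by_cases hsq : s = q
  · subst hsq
    have hts : t ≠ s := hw.2.2.1.symm
    by_cases hs : deg G s = 2
    · exact good_of_common_two hG hl ih hok hv huw hu hw hs
    by_cases ht : deg G t = 2
    · exact good_of_side_two hG hl ih hok hv.swap hwu hw hu ht.le hts hpt.symm
    exact good_of_side_three hG hl ih hok hv huw hu hw ((h3 _ _ huq).resolve_left hs) hp3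
      ((h3 _ _ huq).resolve_left hs) ((h3 _ _ hwt).resolve_left ht) hps hpt
  by_cases hs : deg G s = 2
  · exact good_of_side_two hG hl ih hok hv.swap hwu hw.swap hu hs.le hsq hps.symm
  have hs3 := (h3 _ _ hws).resolve_left hs
  by_cases htq : t = q
  · subst htq
    by_cases ht : deg G t = 2
    · exact good_of_common_two hG hl ih hok hv huw hu hw.swap ht
    exact good_of_side_three hG hl ih hok hv huw hu hw ((h3 _ _ huq).resolve_left ht) hp3
      hs3 ((h3 _ _ huq).resolve_left ht) hps hpt
  by_cases ht : deg G t = 2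
  · exact good_of_side_two hG hl ih hok hv.swap hwu hw hu ht.le htq hpt.symm
  by_cases hq : deg G q = 2
  · exact good_of_side_two hG hl ih hok hv huw hu.swap hw hq.le (Ne.symm hsq) (Ne.symm htq)
  exact good_of_side_three hG hl ih hok hv huw hu hw ((h3 _ _ huq).resolve_left hq) hp3
    hs3 ((h3 _ _ hwt).resolve_left ht) hps hpt

omit hv in
theorem good_of_adj (hv : deg G v = 2) (hu : deg G u = 3) (hvu : G.Adj v u) : Good G := by
  obtain ⟨w, d1, hv'⟩ := exists_of_deg_two hv hvu
  have hv₂ : Nbrs₂ G v u w := ⟨d1, hv'⟩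
  have hvw : G.Adj v w := (hv' w).2 (by simp)
  by_cases huw : G.Adj u w
  · exact good_of_triangle hG hl ih hok hv₂ hu huw
  obtain ⟨a, b, d2, d3, d4, hu'⟩ := exists_of_deg_three hu hvu.symm
  have hu₃ : Nbrs₃ G u v a b := ⟨d2, d3, d4, hu'⟩
  obtain hw | hw : deg G w = 2 ∨ deg G w = 3 := by
    have := hG w
    have := hl w
    have := deg_ne_zero_of_adj hvw.symm
    omega
  · obtain ⟨s, d5, hw'⟩ := exists_of_deg_two hw hvw.symm
    have hw₂ : Nbrs₂ G w v s := ⟨d5, hw'⟩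
    have hsu : s ≠ u := by
      rintro rfl
      exact huw ((hw' s).2 (by simp)).symm
    by_cases hsa : s = a
    · subst hsa
      exact good_of_two_two hG hl ih hok hv₂ hu₃ hw₂
    by_cases hsb : s = b
    · subst hsb
      exact good_of_two_two hG hl ih hok hv₂ hu₃.swap hw₂
    exact good_of_deg_two hG hl ih hok hv₂ hu₃ hw₂ hsu hsa hsb
  · obtain ⟨s, t, d5, d6, d7, hw'⟩ := exists_of_deg_three hw hvw.symm
    have hw₃ : Nbrs₃ G w v s t := ⟨d5, d6, d7, hw'⟩
    by_cases hb : b ≠ s ∧ b ≠ t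
    · exact good_of_deg_three hG hl ih hok hv₂ huw hu₃ hw₃ hb.1 hb.2
    by_cases ha : a ≠ s ∧ a ≠ t
    · exact good_of_deg_three hG hl ih hok hv₂ huw hu₃.swap hw₃ ha.1 ha.2
    by_cases has : a = s
    · obtain rfl : b = t := by
        by_contra h
        exact hb ⟨fun h' => d4 (has.trans h'.symm), h⟩
      subst has
      exact good_of_common_common hG hl ih hok hv₂ hu₃ hw₃
    · obtain rfl : a = t := by
        by_contra h
        exact ha ⟨has, h⟩
      obtain rfl : b = s := by
        by_contra h
        exact hb ⟨h, d4.symm⟩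
      exact good_of_common_common hG hl ih hok hv₂ hu₃ hw₃.swap

end

/-- Only isolated vertices carry weight, and every maximal matching misses them. -/
theorem good_of_no_cubic (h1 : ∀ v, deg G v ≠ 1) (h3 : ∀ v, deg G v ≠ 3) : Good G := by
  obtain ⟨U, hU⟩ := exists_adm G
  refine ⟨U, hU, ?_⟩
  rw [weight_eq_baseWeight h1, ← sum_ite_mem, baseWeight]
  refine Finset.sum_le_sum fun v _ => ?_
  unfold base
  by_cases hv : deg G v = 0
  · simp [hv, mem_of_adm hU hv]
  · simp [hv, h3 v]

theorem exists_adj_cubic {x y : V} (h : G.Reachable x y) (hx : deg G x = 3) (hy : deg G y ≠ 3) :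
    ∃ u v, G.Adj v u ∧ deg G u = 3 ∧ deg G v ≠ 3 := by
  obtain ⟨p⟩ := h
  induction p with
  | nil => exact absurd hx hy
  | cons hab p ih =>
    rename_i a b c
    by_cases hb : deg G b = 3
    · exact ih hb hy
    · exact ⟨a, b, hab.symm, hx, hb⟩

/-- A subcubic graph without cubic components has an admissible set as large as its weight
demands. -/
theorem good_of_ok (hG : Subcub G) (hok : Ok G) : Good G := by
  induction hk : mu G using Nat.strong_induction_on generalizing G with
  | _ k ih =>
    have hb : Below G := fun H hH h1 h2 => ih (mu H) (hk ▸ hH) h1 h2 rfl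
    by_cases hl : ∃ v, deg G v = 1
    · obtain ⟨v, hv⟩ := hl
      exact good_of_leaf hG hb hok hv
    push Not at hl
    by_cases h3 : ∃ v, deg G v = 3
    · obtain ⟨x, hx⟩ := h3
      obtain ⟨y, hxy, hy⟩ := hok x
      obtain ⟨u, v, hvu, hu, hv⟩ := exists_adj_cubic hxy hx (by omega)
      refine good_of_adj hG hl hb hok (v := v) ?_ hu hvu
      have := hG v
      have := hl v
      have := deg_ne_zero_of_adj hvu
      omega
    · push Not at h3
      exact good_of_no_cubic hl h3

end Induction

/-! ### Connected cubic graphs -/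

section Cubic

variable {V : Type*} [Fintype V] [DecidableEq V] {G : SimpleGraph V}

theorem below (G : SimpleGraph V) : Below G := fun _ _ h1 h2 => good_of_ok h1 h2

variable {u x y y₂ x₁ x₂ y₁ : V}

theorem baseWeight_of_cubic (h3 : ∀ v, deg G v = 3) : baseWeight G = Fintype.card V := by
  simp [baseWeight, base, h3]

theorem ok_del_of_connected (hG : Subcub G) (hconn : G.Connected) {S : Finset V} (hu : u ∈ S) :
    Ok (del G S) :=
  ok_del_of_reach hG fun v => ⟨u, hconn.preconnected v u, Or.inr hu⟩

/-- Matching two triangle vertices loses at most five cubic vertices, as they share the third. That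
overshoots the slack of 4 by one, which parity recovers. -/
theorem exists_adm_of_cubic_triangle (hconn : G.Connected) (h3 : ∀ v, deg G v = 3)
    (hux : G.Adj u x) (huy : G.Adj u y) (hxy : G.Adj x y) :
    ∃ U, Adm G U ∧ Fintype.card V ≤ 6 * U.card + 4 := by
  have hG : Subcub G := fun v => (h3 v).le
  obtain ⟨a, -, -, ha⟩ := exists_of_deg_three₂ (h3 u) hux huy hxy.ne
  obtain ⟨b, -, -, hb⟩ := exists_of_deg_three₂ (h3 x) hux.symm hxy huy.ne
  obtain ⟨U', hU', hw⟩ := good_of_ok (subcub_del hG {u, x})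
    (ok_del_of_connected hG hconn (u := u) (by simp))
  obtain ⟨h1, h2, h4⟩ := adm_of_pair hux hU'
  have h5 := card_of_pair hux.ne h1 h2
  refine ⟨_, h4, ?_⟩
  have e1 := baseWeight_add_le (G := G) (H := del G {u, x}) (S := {u, x}) (T := {u, x, y, a, b})
    (deg_del_le G _) (fun s _ => by rw [h3 s]; omega) (fun s hs => deg_del_eq_zero hs)
    (fun z hz hz' => by
      by_contra hcon
      simp only [Finset.mem_insert, Finset.mem_singleton, not_or] at hcon
      refine hz' (hz ▸ deg_del_eq (by simp [hcon]) fun s hs hzs => ?_)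
      simp only [Finset.mem_insert, Finset.mem_singleton] at hs
      rcases hs with rfl | rfl
      · have := (ha z).1 hzs.symm
        tauto
      · have := (hb z).1 hzs.symm
        tauto)
  have e2 := baseWeight_le_weight (del G {u, x})
  have e3 : ({u, x, y, a, b} : Finset V).card ≤ 5 := Finset.card_le_five
  rw [Finset.card_pair hux.ne, baseWeight_of_cubic h3] at e1
  obtain ⟨k, hk⟩ := even_of_adm h4
  obtain ⟨l, hl⟩ := even_baseWeight hG fun v => by rw [h3 v]; omega
  rw [baseWeight_of_cubic h3] at hl
  omega

/-- The reduction at the edge `ux` loses only `u`, `x`, `y₂`, `x₂`, exactly the slack of 4. The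
hypothesis `hr` keeps the component of the new edge from being cubic, as `y₂` and `x₂` drop in
degree. -/
theorem exists_adm_of_cubic_red (hconn : G.Connected) (h3 : ∀ v, deg G v = 3)
    (hu : Nbrs₃ G u x y y₂) (hx : Nbrs₃ G x u x₁ x₂) (hyx : ¬ G.Adj x y) (hux₁ : ¬ G.Adj u x₁)
    (hy₂x : ¬ G.Adj x y₂) (hux₂ : ¬ G.Adj u x₂) (hyx₁ : ¬ G.Adj y x₁)
    (hr : (del G {u, x}).Reachable y y₂ ∨ (del G {u, x}).Reachable y x₂) :
    ∃ U, Adm G U ∧ Fintype.card V ≤ 6 * U.card + 4 := by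
  have hG : Subcub G := fun v => (h3 v).le
  have hux : G.Adj u x := (hu.2.2.2 x).2 (by simp)
  have huy : G.Adj u y := (hu.2.2.2 y).2 (by simp)
  have huy₂ : G.Adj u y₂ := (hu.2.2.2 y₂).2 (by simp)
  have hxx₁ : G.Adj x x₁ := (hx.2.2.2 x₁).2 (by simp)
  have hxx₂ : G.Adj x x₂ := (hx.2.2.2 x₂).2 (by simp)
  have hyx' : y ≠ x₁ := by rintro rfl; exact hyx hxx₁
  set H := red G {u, x} y x₁ with hH
  have hadj : ∀ a b, H.Adj a b ↔ (G.Adj a b ∧ a ∉ ({u, x} : Finset V) ∧ b ∉ ({u, x} : Finset V)) ∨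
      (a = y ∧ b = x₁) ∨ (a = x₁ ∧ b = y) := red_adj _ _ hyx'
  have hyS : y ∉ ({u, x} : Finset V) := by simp [huy.ne.symm, hu.1.symm]
  have hx₁S : x₁ ∉ ({u, x} : Finset V) := by simp [hx.1.symm, hxx₁.ne.symm]
  have hSz : ∀ s ∈ ({u, x} : Finset V), deg H s = 0 := fun s hs =>
    deg_eq_zero.2 fun b hb => by
      rcases (hadj s b).1 hb with h | h | h
      exacts [h.2.1 hs, hyS (h.1 ▸ hs), hx₁S (h.1 ▸ hs)]
  have hold : ∀ a, a ≠ y → a ≠ x₁ → ∀ b, H.Adj a b → G.Adj a b ∧ b ∉ ({u, x} : Finset V) := by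
    intro a h1 h2 b hb
    rcases (hadj a b).1 hb with h | h | h
    exacts [⟨h.1, h.2.2⟩, absurd h.1 h1, absurd h.1 h2]
  have hyH : deg H y = deg G y := by
    refine deg_eq_of_swap (c := x₁) (u := u) (fun b => ?_) huy.symm hyx₁
    rw [hadj]
    constructor
    · rintro (h | h | h)
      · exact Or.inr ⟨h.1, fun hb => h.2.2 (by simp [hb])⟩
      · exact Or.inl h.2
      · exact absurd h.1 hyx'
    · rintro (rfl | h)
      · exact Or.inr (Or.inl ⟨rfl, rfl⟩)
      · refine Or.inl ⟨h.1, hyS, ?_⟩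
        have : b ≠ x := by rintro rfl; exact hyx h.1.symm
        simp [this, h.2]
  have hx₁H : deg H x₁ = deg G x₁ := by
    refine deg_eq_of_swap (c := y) (u := x) (fun b => ?_) hxx₁.symm fun h => hyx₁ h.symm
    rw [hadj]
    constructor
    · rintro (h | h | h)
      · exact Or.inr ⟨h.1, fun hb => h.2.2 (by simp [hb])⟩
      · exact absurd h.1.symm hyx'
      · exact Or.inl h.2
    · rintro (rfl | h)
      · exact Or.inr (Or.inr ⟨rfl, rfl⟩)
      · refine Or.inl ⟨h.1, hx₁S, ?_⟩
        have : b ≠ u := by rintro rfl; exact hux₁ h.1.symm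
        simp [this, h.2]
  have hdeg : ∀ a, deg H a ≤ deg G a := by
    intro a
    by_cases h1 : a = y
    · rw [h1, hyH]
    by_cases h2 : a = x₁
    · rw [h2, hx₁H]
    exact deg_le_deg fun b hb => (hold a h1 h2 b hb).1
  have hlost : ∀ a s, s ∈ ({u, x} : Finset V) → G.Adj a s → a ≠ y → a ≠ x₁ → deg H a ≤ 2 := by
    intro a s hs has h1 h2
    have h4 : deg H a < deg G a := deg_lt_deg (fun b hb => (hold a h1 h2 b hb).1) has
      fun hb => (hold a h1 h2 s hb).2 hs
    rw [h3 a] at h4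
    omega
  have hy₂H : deg H y₂ ≤ 2 := hlost y₂ u (by simp) huy₂.symm hu.2.2.1.symm (by
    rintro rfl; exact hy₂x hxx₁)
  have hx₂H : deg H x₂ ≤ 2 := hlost x₂ x (by simp) hxx₂.symm (by
    rintro rfl; exact hyx hxx₂) hx.2.2.1.symm
  have hle : del G {u, x} ≤ H := le_sup_left
  have hyr : ∃ z, H.Reachable y z ∧ deg H z ≤ 2 ∧ z ∉ (∅ : Finset V) := by
    rcases hr with h | h
    · exact ⟨y₂, h.mono hle, hy₂H, by simp⟩
    · exact ⟨x₂, h.mono hle, hx₂H, by simp⟩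
  have hx₁y : H.Adj x₁ y := (hadj _ _).2 (by simp)
  have hok : Ok H := by
    rw [← okAvoid_empty]
    refine okAvoid_of_boundary (G := G) (S := {u, x}) (by simp) (fun v => ?_)
      (fun a b ha hb hab => (hadj _ _).2 (Or.inl ⟨hab, ha, hb⟩)) hdeg
      (fun s hs => by rw [hSz s hs]; omega) ?_
    · exact ⟨u, hconn.preconnected v u, Or.inr (by simp)⟩
    · rintro a ha ⟨s, hs, has⟩
      by_cases h1 : a = y
      · exact h1 ▸ hyr
      by_cases h2 : a = x₁
      · obtain ⟨z, hz⟩ := hyr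
        exact ⟨z, h2 ▸ hx₁y.reachable.trans hz.1, hz.2⟩
      exact ⟨a, .refl _, hlost a s hs has h1 h2, by simp⟩
  obtain ⟨U', hU', hw⟩ := good_of_ok (subcub_of_le hG hdeg) hok
  obtain ⟨h1, h2, h4⟩ := adm_of_red hux huy hxx₁ hu.1.symm hx.1.symm hyx' hU'
  have h5 := card_of_pair hux.ne h1 h2
  refine ⟨_, h4, ?_⟩
  have e1 := baseWeight_add_le (G := G) (H := H) (S := {u, x}) (T := {u, x, y₂, x₂})
    hdeg (fun s _ => by rw [h3 s]; omega) hSz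
    (fun z hz hz' => by
      by_contra hcon
      simp only [Finset.mem_insert, Finset.mem_singleton, not_or] at hcon
      have hzy : z ≠ y := by rintro rfl; exact hz' (hyH.trans hz)
      have hzx : z ≠ x₁ := by rintro rfl; exact hz' (hx₁H.trans hz)
      refine hz' (hz ▸ deg_eq_deg fun b => ⟨fun h => (hold z hzy hzx b h).1, fun h => ?_⟩)
      refine (hadj _ _).2 (Or.inl ⟨h, by simp [hcon], ?_⟩)
      simp only [Finset.mem_insert, Finset.mem_singleton]
      rintro (rfl | rfl)
      · have := (hu.2.2.2 z).1 h.symm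
        tauto
      · have := (hx.2.2.2 z).1 h.symm
        tauto)
  have e2 := baseWeight_le_weight H
  have e3 : ({u, x, y₂, x₂} : Finset V).card ≤ 4 := Finset.card_le_four
  rw [Finset.card_pair hux.ne, baseWeight_of_cubic h3] at e1
  omega

/-- The six named vertices already have three neighbours each among themselves, so by connectedness
there are no others. -/
theorem isK33_of_adj (hconn : G.Connected) (hG : Subcub G) (hu : Nbrs₃ G u x y₁ y₂)
    (hx : Nbrs₃ G x u x₁ x₂) (h11 : G.Adj y₁ x₁) (h12 : G.Adj y₁ x₂) (h21 : G.Adj y₂ x₁)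
    (h22 : G.Adj y₂ x₂) : IsK33 G := by
  have hux : G.Adj u x := (hu.2.2.2 x).2 (by simp)
  have huy₁ : G.Adj u y₁ := (hu.2.2.2 y₁).2 (by simp)
  have huy₂ : G.Adj u y₂ := (hu.2.2.2 y₂).2 (by simp)
  have hxx₁ : G.Adj x x₁ := (hx.2.2.2 x₁).2 (by simp)
  have hxx₂ : G.Adj x x₂ := (hx.2.2.2 x₂).2 (by simp)
  have hy₁ : Nbrs₃ G y₁ u x₁ x₂ := nbrs₃_of_adj hG huy₁.symm h11 h12 hx.1 hx.2.1 hx.2.2.1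
  have hy₂ : Nbrs₃ G y₂ u x₁ x₂ := nbrs₃_of_adj hG huy₂.symm h21 h22 hx.1 hx.2.1 hx.2.2.1
  have hx₁ : Nbrs₃ G x₁ x y₁ y₂ :=
    nbrs₃_of_adj hG hxx₁.symm h11.symm h21.symm hu.1 hu.2.1 hu.2.2.1
  have hx₂ : Nbrs₃ G x₂ x y₁ y₂ :=
    nbrs₃_of_adj hG hxx₂.symm h12.symm h22.symm hu.1 hu.2.1 hu.2.2.1
  let A : Fin 3 → V := ![u, x₁, x₂]
  let B : Fin 3 → V := ![x, y₁, y₂]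
  have hA : ∀ i z, G.Adj (A i) z ↔ ∃ j, z = B j := by
    intro i z
    simp only [Fin.exists_fin_succ, B]
    fin_cases i
    · simpa [A] using hu.2.2.2 z
    · simpa [A] using hx₁.2.2.2 z
    · simpa [A] using hx₂.2.2.2 z
  have hB : ∀ i z, G.Adj (B i) z ↔ ∃ j, z = A j := by
    intro i z
    simp only [Fin.exists_fin_succ, A]
    fin_cases i
    · simpa [B] using hx.2.2.2 z
    · simpa [B] using hy₁.2.2.2 z
    · simpa [B] using hy₂.2.2.2 z
  have hinj : ∀ {a b c : V}, a ≠ b → a ≠ c → b ≠ c → Function.Injective ![a, b, c] := by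
    intro a b c h1 h2 h3 i j hij
    fin_cases i <;> fin_cases j <;> simp_all [eq_comm]
  have hAi : Function.Injective A := hinj hx.1 hx.2.1 hx.2.2.1
  have hBi : Function.Injective B := hinj hu.1 hu.2.1 hu.2.2.1
  have hAB : ∀ i j, G.Adj (A i) (B j) := fun i j => (hA i _).2 ⟨j, rfl⟩
  have hBA : ∀ i j, G.Adj (B i) (A j) := fun i j => (hB i _).2 ⟨j, rfl⟩
  have hAA : ∀ i j, ¬ G.Adj (A i) (A j) := fun i j h => by
    obtain ⟨k, hk⟩ := (hA i _).1 h
    exact (hAB j k).ne hk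
  have hBB : ∀ i j, ¬ G.Adj (B i) (B j) := fun i j h => by
    obtain ⟨k, hk⟩ := (hB i _).1 h
    exact (hBA j k).ne hk
  have hwalk : ∀ {z w : V}, G.Walk z w → (∃ s, Sum.elim A B s = w) → ∃ s, Sum.elim A B s = z := by
    intro z w p hw
    induction p with
    | nil => exact hw
    | cons hab p ih =>
      obtain ⟨s | s, hs⟩ := ih hw
      · obtain ⟨j, hj⟩ := (hA s _).1 (by rw [show A s = _ from hs]; exact hab.symm)
        exact ⟨Sum.inr j, hj.symm⟩
      · obtain ⟨j, hj⟩ := (hB s _).1 (by rw [show B s = _ from hs]; exact hab.symm)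
        exact ⟨Sum.inl j, hj.symm⟩
  have hsurj : Function.Surjective (Sum.elim A B) := by
    intro z
    obtain ⟨p⟩ := hconn.preconnected z u
    exact hwalk p ⟨Sum.inl 0, rfl⟩
  have hmap : ∀ s t, G.Adj (Sum.elim A B s) (Sum.elim A B t) ↔
      (completeBipartiteGraph (Fin 3) (Fin 3)).Adj s t := by
    rintro (i | i) (j | j) <;> simp [hAB, hBA, hAA, hBB]
  refine ⟨(⟨Equiv.ofBijective (Sum.elim A B) ⟨?_, hsurj⟩, fun {s t} => hmap s t⟩ :
    completeBipartiteGraph (Fin 3) (Fin 3) ≃g G).symm⟩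
  rintro (i | i) (j | j) hij
  · exact congrArg _ (hAi hij)
  · exact absurd hij (hAB i j).ne
  · exact absurd hij (hBA i j).ne
  · exact congrArg _ (hBi hij)

theorem exists_adm_of_cubic (hconn : G.Connected) (h3 : ∀ v, deg G v = 3) (hK : ¬ IsK33 G) :
    ∃ U, Adm G U ∧ Fintype.card V ≤ 6 * U.card + 4 := by
  have hG : Subcub G := fun v => (h3 v).le
  by_cases htri : ∃ u x y, G.Adj u x ∧ G.Adj u y ∧ G.Adj x y
  · obtain ⟨u, x, y, h1, h2, h4⟩ := htri
    exact exists_adm_of_cubic_triangle hconn h3 h1 h2 h4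
  push Not at htri
  have key : ∀ u x y y₂ x₁ x₂ : V, Nbrs₃ G u x y y₂ → Nbrs₃ G x u x₁ x₂ → ¬ G.Adj y x₁ →
      ∃ U, Adm G U ∧ Fintype.card V ≤ 6 * U.card + 4 := by
    intro u x y y₂ x₁ x₂ hu hx hyx₁
    have hux : G.Adj u x := (hu.2.2.2 x).2 (by simp)
    have huy : G.Adj u y := (hu.2.2.2 y).2 (by simp)
    have huy₂ : G.Adj u y₂ := (hu.2.2.2 y₂).2 (by simp)
    have hxx₁ : G.Adj x x₁ := (hx.2.2.2 x₁).2 (by simp)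
    have hxx₂ : G.Adj x x₂ := (hx.2.2.2 x₂).2 (by simp)
    have hxy := htri u x y hux huy
    have hxy₂ := htri u x y₂ hux huy₂
    have hux₁ := htri x u x₁ hux.symm hxx₁
    have hux₂ := htri x u x₂ hux.symm hxx₂
    have hyS : y ∉ ({u, x} : Finset V) := by simp [huy.ne.symm, hu.1.symm]
    by_cases hr : (del G {u, x}).Reachable y y₂ ∨ (del G {u, x}).Reachable y x₂
    · exact exists_adm_of_cubic_red hconn h3 hu hx hxy hux₁ hxy₂ hux₂ hyx₁ hr
    rw [not_or] at hr
    rcases good_or_exists_reachable hG (fun v => by rw [h3 v]; omega) (below G) (S := {u, x})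
      (a := u) (b := y) (fun v => ⟨y, hconn.preconnected v y, Or.inr rfl⟩) hyS (by simp) huy.symm
      (by
        simp only [Finset.mem_insert, Finset.mem_singleton]
        rintro s (rfl | rfl) hs
        exacts [rfl, absurd hs.symm hxy]) (h3 y) with ⟨U, hU, hw⟩ | ⟨z, h1, h2, h4⟩
    · refine ⟨U, hU, ?_⟩
      rw [weight_eq_baseWeight fun v => by rw [h3 v]; omega, baseWeight_of_cubic h3] at hw
      omega
    · have hzS := notMem_of_reachable_del hyS h1
      -- Only neighbours of `u` or `x` drop in degree, and `y`, `y₂`, `x₂` are excluded. So `y`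
      -- reaches `x₁`, and exchanging the roles of `x₁` and `x₂` makes the reduction applicable.
      have hz : z = x₁ := by
        by_contra hz
        have : deg (del G {u, x}) z = deg G z := deg_del_eq hzS fun s hs hzs => by
          simp only [Finset.mem_insert, Finset.mem_singleton, not_or] at hs hzS
          rcases hs with rfl | rfl
          · rcases (hu.2.2.2 z).1 hzs.symm with rfl | rfl | rfl
            exacts [hzS.2 rfl, h4 rfl, hr.1 h1]
          · rcases (hx.2.2.2 z).1 hzs.symm with rfl | rfl | rfl
            exacts [hzS.1 rfl, hz rfl, hr.2 h1]
        rw [h3 z] at this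
        omega
      subst hz
      refine exists_adm_of_cubic_red hconn h3 hu hx.swap hxy hux₂ hxy₂ hux₁ (fun h => hr.2 ?_)
        (Or.inr h1)
      have h' : (del G {u, x}).Adj y x₂ := ⟨h, hyS, by simp [hx.2.1.symm, hxx₂.ne.symm]⟩
      exact h'.reachable
  obtain ⟨u⟩ := hconn.nonempty
  obtain ⟨x, y₁, y₂, hu⟩ := deg_eq_three.1 (h3 u)
  have hu' : Nbrs₃ G u x y₁ y₂ := hu
  have hux : G.Adj u x := (hu.2.2.2 x).2 (by simp)
  obtain ⟨x₁, x₂, hx⟩ := exists_of_deg_three (h3 x) hux.symm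
  have hx' : Nbrs₃ G x u x₁ x₂ := hx
  by_cases h11 : G.Adj y₁ x₁
  · by_cases h12 : G.Adj y₁ x₂
    · by_cases h21 : G.Adj y₂ x₁
      · by_cases h22 : G.Adj y₂ x₂
        · exact absurd (isK33_of_adj hconn hG hu' hx' h11 h12 h21 h22) hK
        · exact key u x y₂ y₁ x₂ x₁ hu'.swap hx'.swap h22
      · exact key u x y₂ y₁ x₁ x₂ hu'.swap hx' h21
    · exact key u x y₁ y₂ x₂ x₁ hu' hx'.swap h12
  · exact key u x y₁ y₂ x₁ x₂ hu' hx' h11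

end Cubic

/-! ### From missed vertices to the stated bound -/

section Bound

variable {V : Type*} [Fintype V] [DecidableEq V] {G : SimpleGraph V}

theorem ok_of_connected (hconn : G.Connected) (hG : Subcub G) (h : ¬ ∀ v, deg G v = 3) : Ok G := by
  push Not at h
  obtain ⟨y, hy⟩ := h
  exact fun v => ⟨y, hconn.preconnected v y, by have := hG y; omega⟩

theorem isK2_of_deg_one (hconn : G.Connected) {v u : V} (hv : deg G v = 1) (hvu : G.Adj v u)
    (hu : deg G u = 1) : IsK2 G := by
  have hwalk : ∀ {z w : V}, G.Walk z w → w = v ∨ w = u → z = v ∨ z = u := by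
    intro z w p hw
    induction p with
    | nil => exact hw
    | cons hab p ih =>
      rcases ih hw with rfl | rfl
      · exact Or.inr (eq_of_deg_one hv hab.symm hvu)
      · exact Or.inl (eq_of_deg_one hu hab.symm hvu.symm)
  have hall : ∀ z, z = v ∨ z = u := fun z => by
    obtain ⟨p⟩ := hconn.preconnected z v
    exact hwalk p (Or.inl rfl)
  have htop : G = ⊤ := by
    ext a b
    refine ⟨fun h => h.ne, fun h => ?_⟩
    have hab : a ≠ b := h
    rcases hall a with rfl | rfl <;> rcases hall b with rfl | rfl
    exacts [absurd rfl hab, hvu, hvu.symm, absurd rfl hab]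
  have hcard : Fintype.card V = 2 := by
    rw [Fintype.card_eq_nat_card, Nat.card_eq_two_iff]
    exact ⟨v, u, hvu.ne, by ext z; simpa using hall z⟩
  subst htop
  exact ⟨SimpleGraph.Iso.completeGraph (Fintype.equivFinOfCardEq hcard)⟩

/-- Each leaf is charged to its unique neighbour, by exchanging the order of summation; the
hypothesis excludes `K₂` components, whose leaves carry no weight. -/
theorem card_add_card_le_weight
    (h : ∀ v u, deg G v = 1 → G.Adj v u → 2 ≤ deg G u) :
    (∑ v, if deg G v = 1 then 1 else 0) + (∑ v, if deg G v = 3 then 1 else 0) ≤ weight G := by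
  classical
  have h1 : (∑ v, if deg G v = 3 then 1 else 0) ≤ ∑ v, base G v :=
    Finset.sum_le_sum fun v _ => by rw [base]; split_ifs <;> omega
  have h2 : (∑ v, if deg G v = 1 then 1 else 0) ≤
      ∑ v, if 2 ≤ deg G v then leafNbrs G v else 0 := by
    calc (∑ v, if deg G v = 1 then 1 else 0)
        ≤ ∑ v, ∑ u, if G.Adj v u ∧ deg G v = 1 then 1 else 0 := by
          refine Finset.sum_le_sum fun v _ => ?_
          split_ifs with hv
          · obtain ⟨u, hu⟩ := deg_eq_one.1 hv
            refine le_trans ?_ (Finset.single_le_sum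
              (f := fun u => if G.Adj v u ∧ deg G v = 1 then 1 else 0)
              (fun _ _ => Nat.zero_le _) (Finset.mem_univ u))
            simp [(hu u).2 rfl, hv]
          · exact Nat.zero_le _
      _ = ∑ u, ∑ v, if G.Adj v u ∧ deg G v = 1 then 1 else 0 := Finset.sum_comm
      _ ≤ _ := by
          refine Finset.sum_le_sum fun u _ => ?_
          split_ifs with hu
          · exact (leafNbrs_eq_sum G u).ge.trans' (le_of_eq (by congr))
          · refine (Finset.sum_eq_zero fun v _ => if_neg fun hv => hu ?_).le
            exact h v u hv.2 hv.1
  calc _ ≤ (∑ v, if 2 ≤ deg G v then leafNbrs G v else 0) + ∑ v, base G v := add_le_add h2 h1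
    _ = weight G := by
      rw [add_comm, ← Finset.sum_add_distrib]
      rfl

theorem sum_deg_le (hG : Subcub G) :
    (∑ v, deg G v) + ∑ v, (if deg G v = 1 then 1 else 0) ≤
      2 * Fintype.card V + ∑ v, if deg G v = 3 then 1 else 0 := by
  rw [← Finset.sum_add_distrib, mul_comm, ← smul_eq_mul, ← Finset.card_univ, ← Finset.sum_const,
    ← Finset.sum_add_distrib]
  refine Finset.sum_le_sum fun v _ => ?_
  have := hG v
  split_ifs <;> omega

variable [DecidableRel G.Adj]

/-- Multiplied by 12, the claim is `hk` combined with `2m + n₁ ≤ 2n + n₃`; the constants 4 and 2 are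
`12/6` times the coefficients of `I` and `K`. -/
theorem size_le_bound (hG : Subcub G) {M : G.Subgraph} {k : ℕ}
    (hM : 2 * size M + k = Fintype.card V)
    (hk : ((∑ v, if deg G v = 1 then 1 else 0) + ∑ v, if deg G v = 3 then 1 else 0) ≤
      6 * k + (open Classical in if G.IsRegularOfDegree 3 then 4 else 0) +
        (open Classical in if IsK2 G then 2 else 0)) :
    (size M : ℚ) ≤ bound G := by
  have hm : ∑ v, deg G v = 2 * G.edgeFinset.card := by
    rw [← SimpleGraph.sum_degrees_eq_twice_card_edges]
    exact Finset.sum_congr rfl fun v _ => deg_eq_degree G v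
  have hn : (Finset.univ.filter fun v => G.degree v = 1).card =
      ∑ v, if deg G v = 1 then 1 else 0 := by
    rw [Finset.card_filter]
    exact Finset.sum_congr rfl fun v _ => by rw [deg_eq_degree]
  have hs := sum_deg_le hG
  rw [hm] at hs
  simp only [bound]
  rw [show (Finset.univ.filter fun v => G.degree v = 1).card =
      ∑ v, if deg G v = 1 then 1 else 0 from hn]
  generalize (∑ v, if deg G v = 1 then 1 else 0) = n₁ at *
  generalize (∑ v, if deg G v = 3 then 1 else 0) = n₃ at *
  have hM' : (2 * size M + k : ℚ) = Fintype.card V := by exact_mod_cast hM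
  have hs' : (2 * G.edgeFinset.card + n₁ : ℚ) ≤ 2 * Fintype.card V + n₃ := by exact_mod_cast hs
  by_cases h1 : G.IsRegularOfDegree 3 <;> by_cases h2 : IsK2 G <;>
    simp only [h1, h2, if_true, if_false] at hk ⊢ <;>
    · have hk' := (Nat.cast_le (α := ℚ)).2 hk
      push_cast at hk'
      linarith

theorem exists_adm_of_connected (hconn : G.Connected) (hG : Subcub G) (hK : ¬ IsK33 G) :
    ∃ U, Adm G U ∧ ((∑ v, if deg G v = 1 then 1 else 0) + ∑ v, if deg G v = 3 then 1 else 0) ≤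
      6 * U.card + (open Classical in if G.IsRegularOfDegree 3 then 4 else 0) +
        (open Classical in if IsK2 G then 2 else 0) := by
  classical
  by_cases h3 : ∀ v, deg G v = 3
  · obtain ⟨U, hU, hle⟩ := exists_adm_of_cubic hconn h3 hK
    refine ⟨U, hU, ?_⟩
    have hreg : G.IsRegularOfDegree 3 := fun v => by rw [← deg_eq_degree, h3]
    simp only [h3, hreg, if_true, Finset.sum_const, Finset.card_univ, smul_eq_mul]
    simp only [show (3 : ℕ) ≠ 1 by decide, if_false]
    omega
  obtain ⟨U, hU, hw⟩ := good_of_ok hG (ok_of_connected hconn hG h3)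
  refine ⟨U, hU, ?_⟩
  by_cases hleaf : ∀ v u, deg G v = 1 → G.Adj v u → 2 ≤ deg G u
  · have := card_add_card_le_weight hleaf
    omega
  push Not at hleaf
  obtain ⟨v, u, hv, hvu, hu⟩ := hleaf
  have hu1 : deg G u = 1 := by
    have : deg G u ≠ 0 := fun h => deg_eq_zero.1 h v hvu.symm
    omega
  have hK2 := isK2_of_deg_one hconn hv hvu hu1
  have hcard : Fintype.card V = 2 := by
    obtain ⟨e⟩ := hK2
    simpa using Fintype.card_congr e.toEquiv
  have hle : ((∑ v, if deg G v = 1 then 1 else 0) + ∑ v, if deg G v = 3 then 1 else 0) ≤ 2 := by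
    rw [← Finset.sum_add_distrib, ← hcard, ← Finset.card_univ, Finset.card_eq_sum_ones]
    exact Finset.sum_le_sum fun v _ => by split_ifs <;> omega
  simp only [hK2, if_true]
  omega

theorem gamma_le_bound (hconn : G.Connected) (hG : Subcub G) (hK : ¬ IsK33 G) :
    (gamma G : ℚ) ≤ bound G := by
  obtain ⟨U, hU, hle⟩ := exists_adm_of_connected hconn hG hK
  obtain ⟨M, hM, hcard, -⟩ := exists_matching_of_adm hU
  have hγ : gamma G ≤ size M := Nat.sInf_le ⟨M, hM, rfl⟩
  exact le_trans (by exact_mod_cast hγ) (size_le_bound hG hcard hle)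

theorem exists_isMaximalMatching_not_adj (hconn : G.Connected) (hG : Subcub G) (hK : ¬ IsK2 G)
    {v u : V} (hv : deg G v = 1) (hvu : G.Adj v u) :
    ∃ M : G.Subgraph, IsMaximalMatching M ∧ (size M : ℚ) ≤ bound G ∧ ¬ M.Adj u v := by
  have hleaf : ∀ a b, deg G a = 1 → G.Adj a b → 2 ≤ deg G b := fun a b ha hab => by
    have h0 : deg G b ≠ 0 := fun h => deg_eq_zero.1 h a hab.symm
    have h1 : deg G b ≠ 1 := fun h => hK (isK2_of_deg_one hconn ha hab h)
    omega
  have hok : Ok G := ok_of_connected hconn hG fun h => by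
    have := h v
    omega
  obtain ⟨U, hU, hw, hvU⟩ := exists_adm_mem_of_leaf hG (below G) hok hv hvu (hleaf v u hv hvu)
  obtain ⟨M, hM, hcard, hverts⟩ := exists_matching_of_adm hU
  refine ⟨M, hM, size_le_bound hG hcard ?_, fun h => ?_⟩
  · have := card_add_card_le_weight hleaf
    omega
  · have hmem := M.edge_vert h.symm
    rw [hverts] at hmem
    exact hmem hvU

end Bound

end MinMaxMatching

theorem mainTheorem1 {V : Type*} [Fintype V] (G : SimpleGraph V) [DecidableRel G.Adj]
    (hconn : G.Connected) (hsub : MinMaxMatching.IsSubcubic G)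
    (hK33 : ¬ MinMaxMatching.IsK33 G) :
    (MinMaxMatching.gamma G : ℚ) ≤ MinMaxMatching.bound G ∧
    (¬ MinMaxMatching.IsK2 G → ∀ v u : V, G.degree v = 1 → G.Adj v u →
      ∃ M : G.Subgraph, MinMaxMatching.IsMaximalMatching M ∧
        (MinMaxMatching.size M : ℚ) ≤ MinMaxMatching.bound G ∧ ¬ M.Adj u v) := by
  classical
  have hG : MinMaxMatching.Subcub G := fun v =>
    (MinMaxMatching.deg_eq_degree G v).trans_le (hsub v)
  exact ⟨MinMaxMatching.gamma_le_bound hconn hG hK33, fun hK2 v u hv hvu =>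
    MinMaxMatching.exists_isMaximalMatching_not_adj hconn hG hK2
      ((MinMaxMatching.deg_eq_degree G v).trans hv) hvu⟩
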